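/- **Theorem 4.** Computations take place on the word RAM: a machine with words of $w$ bits, constantly many registers, a random-access working memory of words, and a random-access read-only input; the usual operations on words (arithmetic including multiplication and division, bitwise operations, shifts, comparisons), memory accesses, accesses to the input and tests take one step each. There are a construction program, a query program and a constant $c$ such that for every constant $K$ there is a constant $C$ with the following property. Let $s\in\{0,1\}^n$ be a binary string containing $\rho$ runs of 1s (maximal nonempty substrings consisting of 1s only), let $|n|_2$ be the number of binary digits of $n$ (with $|0|_2=0$), and let the word length satisfy $|n|_2+c\le w\le K(|n|_2+c)$, so $w=\Theta(\log n)$. Then the construction program, given $n$ and read-only access to the characters of $s$, builds in at most $C(n+\rho^2+1)$ steps, that is in $O(n+\rho^2)$ time, an index of at most $C(n+1)$ bits, and its whole workspace (all registers and all of the working memory, including the index that it leaves there) is at most $C(n+1)$ bits, that is $O(n)$ bits. Given this index, without access to $s$, and any two nonnegative integers $a,b<2^w$, the query program decides in at most $C$ steps, that is in constant time, whether $s$ has a (nonempty) substring with exactly $a$ copies of 0 and exactly $b$ copies of 1. -/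

import Mathlib

/-! Binary strings are lists of Booleans, `true` being the character 1. -/

/-- `s[i..j]` (0-based, inclusive) is a run of 1s: a maximal substring consisting of 1s only. -/
def IsOneRun (s : List Bool) (i j : ℕ) : Prop :=
  i ≤ j ∧ (∀ l ∈ Finset.Icc i j, s[l]? = some true) ∧
    (i = 0 ∨ s[i - 1]? ≠ some true) ∧ s[j + 1]? ≠ some true

instance (s : List Bool) (i j : ℕ) : Decidable (IsOneRun s i j) := by
  unfold IsOneRun; infer_instance

/-- The number `ρ` of runs of 1s of `s`. -/
def numOneRuns (s : List Bool) : ℕ :=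
  ((Finset.range s.length ×ˢ Finset.range s.length).filter
    fun p => IsOneRun s p.1 p.2).card

/-- Some (nonempty) substring of `s` has exactly `a` copies of 0 and `b` copies of 1. -/
def JumbledOccurs (s : List Bool) (a b : ℕ) : Prop :=
  ∃ t : List Bool, t <:+: s ∧ t ≠ [] ∧ t.count false = a ∧ t.count true = b

namespace WordRAM

/-- The unit-cost operations on machine words. -/
inductive Op where
  | add | sub | mul | div | mod | and | or | xor | shl | shr | lt | eq

/-- The value of an operation on words of `w` bits. Words are natural numbers below `2 ^ w`;
results are reduced modulo `2 ^ w`, and subtraction is truncated at 0. -/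
def Op.eval (w : ℕ) (o : Op) (x y : ℕ) : ℕ :=
  (match o with
    | .add => x + y
    | .sub => x - y
    | .mul => x * y
    | .div => x / y
    | .mod => x % y
    | .and => x &&& y
    | .or => x ||| y
    | .xor => x ^^^ y
    | .shl => x <<< y
    | .shr => x >>> y
    | .lt => if x < y then 1 else 0
    | .eq => if x = y then 1 else 0) % 2 ^ w

/-- Programs of a random access machine, in structured form (a program is a fixed finite text, in
which finitely many registers are named). -/
inductive Prog where
  /-- do nothing -/
  | skip
  /-- `R[d] := v`, for a constant `v` -/
  | const (d v : ℕ)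
  /-- `R[d] := R[a] o R[b]` -/
  | op (o : Op) (d a b : ℕ)
  /-- `R[d] := M[R[a]]` -/
  | load (d a : ℕ)
  /-- `M[R[a]] := R[b]` -/
  | store (a b : ℕ)
  /-- `R[d] := I[R[a]]`, where `I` is the read-only input -/
  | read (d a : ℕ)
  /-- first `p`, then `q` -/
  | seq (p q : Prog)
  /-- if `R[a] ≠ 0` then `p` else `q` -/
  | ite (a : ℕ) (p q : Prog)
  /-- while `R[a] ≠ 0` do `p` -/
  | loop (a : ℕ) (p : Prog)

/-- The number of registers of the machine running a program: 1 plus the largest index of a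
register that the program names. -/
def Prog.numRegs : Prog → ℕ
  | .skip => 1
  | .const d _ => d + 1
  | .op _ d a b => max (d + 1) (max (a + 1) (b + 1))
  | .load d a => max (d + 1) (a + 1)
  | .store a b => max (a + 1) (b + 1)
  | .read d a => max (d + 1) (a + 1)
  | .seq p q => max p.numRegs q.numRegs
  | .ite a p q => max (a + 1) (max p.numRegs q.numRegs)
  | .loop a p => max (a + 1) p.numRegs

/-- The contents of the registers and of the working memory. -/
structure State where
  reg : ℕ → ℕ
  mem : ℕ → ℕ

/-- Assign the word `v` to the register `d`. -/
def State.setReg (σ : State) (d v : ℕ) : State :=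
  ⟨Function.update σ.reg d v, σ.mem⟩

/-- Assign the word `v` to the memory cell `i`. -/
def State.setMem (σ : State) (i v : ℕ) : State :=
  ⟨σ.reg, Function.update σ.mem i v⟩

/-- The initial state: the arguments are in the registers `0, 1, …`, all else is 0. -/
def State.init (args : List ℕ) : State :=
  ⟨fun i => args.getD i 0, fun _ => 0⟩

/-- `Exec w S I p σ t τ`: on the machine with words of `w` bits, a working memory consisting of the
`S` cells `M[0], …, M[S - 1]`, and the read-only input `I`, the program `p`, started in the
state `σ`, halts after exactly `t` steps in the state `τ`. Every elementary instruction and every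
test costs one step. An access outside the working memory or outside the input is a fault (there
is no rule for it, so that the program does not halt properly). -/
inductive Exec (w S : ℕ) (I : List ℕ) : Prog → State → ℕ → State → Prop where
  | skip (σ : State) : Exec w S I .skip σ 1 σ
  | const (d v : ℕ) (σ : State) : Exec w S I (.const d v) σ 1 (σ.setReg d (v % 2 ^ w))
  | op (o : Op) (d a b : ℕ) (σ : State) :
      Exec w S I (.op o d a b) σ 1 (σ.setReg d (o.eval w (σ.reg a) (σ.reg b)))
  | load (d a : ℕ) (σ : State) (h : σ.reg a < S) :
      Exec w S I (.load d a) σ 1 (σ.setReg d (σ.mem (σ.reg a)))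
  | store (a b : ℕ) (σ : State) (h : σ.reg a < S) :
      Exec w S I (.store a b) σ 1 (σ.setMem (σ.reg a) (σ.reg b))
  | read (d a : ℕ) (σ : State) (h : σ.reg a < I.length) :
      Exec w S I (.read d a) σ 1 (σ.setReg d I[σ.reg a])
  | seq {p q : Prog} {σ τ υ : State} {t u : ℕ}
      (hp : Exec w S I p σ t τ) (hq : Exec w S I q τ u υ) :
      Exec w S I (.seq p q) σ (t + u) υ
  | iteTrue {a : ℕ} {p q : Prog} {σ τ : State} {t : ℕ}
      (h : σ.reg a ≠ 0) (hp : Exec w S I p σ t τ) :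
      Exec w S I (.ite a p q) σ (t + 1) τ
  | iteFalse {a : ℕ} {p q : Prog} {σ τ : State} {t : ℕ}
      (h : σ.reg a = 0) (hq : Exec w S I q σ t τ) :
      Exec w S I (.ite a p q) σ (t + 1) τ
  | loopTrue {a : ℕ} {p : Prog} {σ τ υ : State} {t u : ℕ}
      (h : σ.reg a ≠ 0) (hp : Exec w S I p σ t τ) (hl : Exec w S I (.loop a p) τ u υ) :
      Exec w S I (.loop a p) σ (t + u + 1) υ
  | loopFalse {a : ℕ} {p : Prog} {σ : State} (h : σ.reg a = 0) :
      Exec w S I (.loop a p) σ 1 σ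

/-- The data structure that a halted program leaves: the first `R[0]` cells of its memory. -/
def State.output (σ : State) : List ℕ :=
  (List.range (σ.reg 0)).map σ.mem

end WordRAM

/-- `BuildsIndex build w s bits time ix`: on the machine with words of `w` bits, the program
`build`, given read-only access to the characters of `s` and given the length of `s` in a register,
halts within `time` steps and leaves the index `ix` in its memory, where memory (which contains the
index) and registers together have at most `bits` bits. -/
def BuildsIndex (build : WordRAM.Prog) (w : ℕ) (s : List Bool) (bits time : ℕ)
    (ix : List ℕ) : Prop :=
  ∃ (S t : ℕ) (σ : WordRAM.State),
    WordRAM.Exec w S (s.map Bool.toNat) build (WordRAM.State.init [s.length]) t σ ∧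
      t ≤ time ∧ (S + build.numRegs) * w ≤ bits ∧ σ.reg 0 ≤ S ∧ σ.output = ix

/-- `AnswersQueries query w s time ix`: from the read-only index `ix` alone (without access to
`s`), and with no memory besides its registers, the program `query` decides within `time` steps, for
any given words `a` and `b`, whether `s` has a substring with `a` copies of 0 and `b` copies of 1.
The answer (1 for yes, 0 for no) is left in the register 0. -/
def AnswersQueries (query : WordRAM.Prog) (w : ℕ) (s : List Bool) (time : ℕ)
    (ix : List ℕ) : Prop :=
  ∀ a b : ℕ, a < 2 ^ w → b < 2 ^ w →
    ∃ (t : ℕ) (σ : WordRAM.State),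
      WordRAM.Exec w 0 ix query (WordRAM.State.init [a, b]) t σ ∧ t ≤ time ∧
        (JumbledOccurs s a b → σ.reg 0 = 1) ∧ (¬ JumbledOccurs s a b → σ.reg 0 = 0)

/-! Characterization of the pairs. For `p` = 0, 1 let `maxOcc I p z` be the largest number of
characters `p` in a window with at most `z` other characters. Sliding a window of fixed length by
one position changes its number of ones by at most one. Hence `(a, b)` occurs iff `0 < a + b ≤ n`,
`b ≤ maxOcc I 1 a` and `a ≤ maxOcc I 0 b` (`exists_window_iff`, `jumbledOccurs_iff`).

Index. Each `maxOcc I p` is a nondecreasing staircase, written as a bit string: a zero increments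
the argument `z`, a one increments the value. For `p = 1`, `b ≤ maxOcc I 1 a` holds iff the first `a
+ b` bits contain at least `b` ones (`RankSpec.le_iff`), so a query is two rank computations. Ranks
take constant time: there are about `(log n) / 2` bits per word, the rank at the start of each word
is stored, and a table of population counts has only `O(√n)` entries.

Construction. The input is cut into `R = O(ρ + 1)` blocks of equal characters. Windows between block
boundaries suffice (`Cuts.maxOcc_le`), so `O(R²)` windows determine `maxOcc`. A table with one word
for each `z` would need `n log n` bits. Therefore `z` runs through `O(log n)` ranges of length `L ≈
n / log n` that share one table of `L` words. For a fixed left boundary the right boundaries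
relevant to a range form an interval, and the start of this interval only moves right when the left
boundary does. Summed over all ranges, the scans take `O(R²)` steps plus `O(R)` overhead per range
(`triple_rows`, `triple_pass`). The total is `O(n + R² + R log n)`, which is `O(n + ρ²)` because `R
log n ≤ R² + (log n)²`.

Block lengths. With `D` changes of character, blocks are capped at length about `n / (D + 1)`. There
are still at most `2 (D + 1)` blocks, and now their lengths, packed several to a word, take `O(n)`
bits (`div_lensPerWord_lt`).

Memory. Eight arrays are interleaved, array `c` occupying the addresses `8 k + c`. Arrays `2 p` and
`2 p + 1` hold the word ranks and the bit words for `p`, array 4 the population counts, array 5 the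
packed block lengths, array 6 the table; addresses 7 and 15 hold `n` and the number of bits per
word. -/

namespace WordRAM

/-! ### Expressions and their compilation into machine code -/

/-- The value of an operation on natural numbers, without reduction modulo the word size. -/
def Op.ideal (o : Op) (x y : ℕ) : ℕ :=
  match o with
    | .add => x + y
    | .sub => x - y
    | .mul => x * y
    | .div => x / y
    | .mod => x % y
    | .and => x &&& y
    | .or => x ||| y
    | .xor => x ^^^ y
    | .shl => x * 2 ^ y
    | .shr => x / 2 ^ y
    | .lt => if x < y then 1 else 0
    | .eq => if x = y then 1 else 0

/-- A condition under which the operation `o` does not overflow. -/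
def Op.Fits (w : ℕ) (o : Op) (x y : ℕ) : Prop :=
  match o with
    | .sub | .div | .mod | .shr | .lt | .eq => True
    | o => o.ideal x y < 2 ^ w

theorem Op.eval_eq_ideal {w : ℕ} {o : Op} {x y : ℕ} (hw : 0 < w) (hx : x < 2 ^ w)
    (h : o.Fits w x y) : o.eval w x y = o.ideal x y := by
  have h1 : 1 < 2 ^ w := Nat.one_lt_two_pow hw.ne'
  cases o <;> simp only [Op.eval, Op.ideal, Op.Fits, Nat.shiftLeft_eq, Nat.shiftRight_eq_div_pow]
    at h ⊢
  case sub => exact Nat.mod_eq_of_lt (by omega)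
  case div => exact Nat.mod_eq_of_lt (lt_of_le_of_lt (Nat.div_le_self _ _) hx)
  case mod => exact Nat.mod_eq_of_lt (lt_of_le_of_lt (Nat.mod_le _ _) hx)
  case shr => exact Nat.mod_eq_of_lt (lt_of_le_of_lt (Nat.div_le_self _ _) hx)
  case lt => split <;> exact Nat.mod_eq_of_lt (by omega)
  case eq => split <;> exact Nat.mod_eq_of_lt (by omega)
  all_goals exact Nat.mod_eq_of_lt h

/-- Expressions over the registers `0, …, 31`. -/
inductive Expr where
  | lit (v : ℕ)
  | var (r : ℕ)
  | op (o : Op) (a b : Expr)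
  | load (a : Expr)
  | read (a : Expr)

namespace Expr

instance : Add Expr := ⟨.op .add⟩
instance : Sub Expr := ⟨.op .sub⟩
instance : Mul Expr := ⟨.op .mul⟩
instance : Div Expr := ⟨.op .div⟩
instance : Mod Expr := ⟨.op .mod⟩
instance : HShiftLeft Expr Expr Expr := ⟨.op .shl⟩
instance : HShiftRight Expr Expr Expr := ⟨.op .shr⟩

/-- Comparison of words. -/
def lt (a b : Expr) : Expr := .op .lt a b

/-- Equality test of words. -/
def eq (a b : Expr) : Expr := .op .eq a b

/-- The value of an expression. -/
def val (I : List ℕ) (σ : State) : Expr → ℕ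
  | .lit v => v
  | .var r => σ.reg r
  | .op o a b => o.ideal (a.val I σ) (b.val I σ)
  | .load a => σ.mem (a.val I σ)
  | .read a => I.getD (a.val I σ) 0

/-- The evaluation of an expression causes neither a fault nor an overflow. -/
def Ok (w S : ℕ) (I : List ℕ) (σ : State) : Expr → Prop
  | .lit v => v < 2 ^ w
  | .var r => r < 32
  | .op o a b => a.Ok w S I σ ∧ b.Ok w S I σ ∧ o.Fits w (a.val I σ) (b.val I σ)
  | .load a => a.Ok w S I σ ∧ a.val I σ < S
  | .read a => a.Ok w S I σ ∧ a.val I σ < I.length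

/-- The number of steps of the evaluation of an expression. -/
def cost : Expr → ℕ
  | .lit _ => 1
  | .var _ => 1
  | .op _ a b => a.cost + b.cost + 1
  | .load a => a.cost + 1
  | .read a => a.cost + 1

/-- Code that evaluates an expression into the register `d` and uses no other registers than those
from `d` on. -/
def code (d : ℕ) : Expr → Prog
  | .lit v => .const d v
  | .var r => .op .or d r r
  | .op o a b => .seq (.seq (a.code d) (b.code (d + 1))) (.op o d d (d + 1))
  | .load a => .seq (a.code d) (.load d d)
  | .read a => .seq (a.code d) (.read d d)

variable (I : List ℕ) (σ : State) (w S : ℕ)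

@[simp] theorem val_lit (n : ℕ) : val I σ (.lit n) = n := rfl
@[simp] theorem val_var (r : ℕ) : val I σ (.var r) = σ.reg r := rfl
@[simp] theorem val_add (a b : Expr) : val I σ (a + b) = a.val I σ + b.val I σ := rfl
@[simp] theorem val_sub (a b : Expr) : val I σ (a - b) = a.val I σ - b.val I σ := rfl
@[simp] theorem val_mul (a b : Expr) : val I σ (a * b) = a.val I σ * b.val I σ := rfl
@[simp] theorem val_div (a b : Expr) : val I σ (a / b) = a.val I σ / b.val I σ := rfl
@[simp] theorem val_mod (a b : Expr) : val I σ (a % b) = a.val I σ % b.val I σ := rfl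
@[simp] theorem val_shl (a b : Expr) : val I σ (a <<< b) = a.val I σ * 2 ^ b.val I σ := rfl
@[simp] theorem val_shr (a b : Expr) : val I σ (a >>> b) = a.val I σ / 2 ^ b.val I σ := rfl
@[simp] theorem val_lt (a b : Expr) :
    val I σ (a.lt b) = if a.val I σ < b.val I σ then 1 else 0 := rfl
@[simp] theorem val_eq (a b : Expr) :
    val I σ (a.eq b) = if a.val I σ = b.val I σ then 1 else 0 := rfl
@[simp] theorem val_load (a : Expr) : val I σ (.load a) = σ.mem (a.val I σ) := rfl
theorem val_read (a : Expr) : val I σ (.read a) = I.getD (a.val I σ) 0 := rfl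

@[simp] theorem ok_lit (n : ℕ) : Ok w S I σ (.lit n) ↔ n < 2 ^ w := Iff.rfl
@[simp] theorem ok_var (r : ℕ) : Ok w S I σ (.var r) ↔ r < 32 := Iff.rfl
@[simp] theorem ok_add (a b : Expr) : Ok w S I σ (a + b) ↔
    a.Ok w S I σ ∧ b.Ok w S I σ ∧ a.val I σ + b.val I σ < 2 ^ w := Iff.rfl
@[simp] theorem ok_sub (a b : Expr) : Ok w S I σ (a - b) ↔
    a.Ok w S I σ ∧ b.Ok w S I σ := by
  show (_ ∧ _ ∧ True) ↔ _; simp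
@[simp] theorem ok_mul (a b : Expr) : Ok w S I σ (a * b) ↔
    a.Ok w S I σ ∧ b.Ok w S I σ ∧ a.val I σ * b.val I σ < 2 ^ w := Iff.rfl
@[simp] theorem ok_div (a b : Expr) : Ok w S I σ (a / b) ↔
    a.Ok w S I σ ∧ b.Ok w S I σ := by
  show (_ ∧ _ ∧ True) ↔ _; simp
@[simp] theorem ok_mod (a b : Expr) : Ok w S I σ (a % b) ↔
    a.Ok w S I σ ∧ b.Ok w S I σ := by
  show (_ ∧ _ ∧ True) ↔ _; simp
@[simp] theorem ok_shl (a b : Expr) : Ok w S I σ (a <<< b) ↔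
    a.Ok w S I σ ∧ b.Ok w S I σ ∧ a.val I σ * 2 ^ b.val I σ < 2 ^ w := Iff.rfl
@[simp] theorem ok_shr (a b : Expr) : Ok w S I σ (a >>> b) ↔
    a.Ok w S I σ ∧ b.Ok w S I σ := by
  show (_ ∧ _ ∧ True) ↔ _; simp
@[simp] theorem ok_lt (a b : Expr) : Ok w S I σ (a.lt b) ↔
    a.Ok w S I σ ∧ b.Ok w S I σ := by
  show (_ ∧ _ ∧ True) ↔ _; simp
@[simp] theorem ok_eq (a b : Expr) : Ok w S I σ (a.eq b) ↔
    a.Ok w S I σ ∧ b.Ok w S I σ := by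
  show (_ ∧ _ ∧ True) ↔ _; simp
@[simp] theorem ok_load (a : Expr) : Ok w S I σ (.load a) ↔
    a.Ok w S I σ ∧ a.val I σ < S := Iff.rfl
@[simp] theorem ok_read (a : Expr) : Ok w S I σ (.read a) ↔
    a.Ok w S I σ ∧ a.val I σ < I.length := Iff.rfl

@[simp] theorem cost_lit (n : ℕ) : cost (.lit n) = 1 := rfl
@[simp] theorem cost_var (r : ℕ) : cost (.var r) = 1 := rfl
@[simp] theorem cost_add (a b : Expr) : cost (a + b) = a.cost + b.cost + 1 := rfl
@[simp] theorem cost_sub (a b : Expr) : cost (a - b) = a.cost + b.cost + 1 := rfl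
@[simp] theorem cost_mul (a b : Expr) : cost (a * b) = a.cost + b.cost + 1 := rfl
@[simp] theorem cost_div (a b : Expr) : cost (a / b) = a.cost + b.cost + 1 := rfl
@[simp] theorem cost_mod (a b : Expr) : cost (a % b) = a.cost + b.cost + 1 := rfl
@[simp] theorem cost_shl (a b : Expr) : cost (a <<< b) = a.cost + b.cost + 1 := rfl
@[simp] theorem cost_shr (a b : Expr) : cost (a >>> b) = a.cost + b.cost + 1 := rfl
@[simp] theorem cost_lt (a b : Expr) : cost (a.lt b) = a.cost + b.cost + 1 := rfl
@[simp] theorem cost_eq (a b : Expr) : cost (a.eq b) = a.cost + b.cost + 1 := rfl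
@[simp] theorem cost_load (a : Expr) : cost (.load a) = a.cost + 1 := rfl
@[simp] theorem cost_read (a : Expr) : cost (.read a) = a.cost + 1 := rfl

end Expr

@[simp] theorem State.setReg_reg (σ : State) (d v r : ℕ) :
    (σ.setReg d v).reg r = if r = d then v else σ.reg r := by
  simp [State.setReg, Function.update_apply]
@[simp] theorem State.setReg_mem (σ : State) (d v : ℕ) : (σ.setReg d v).mem = σ.mem := rfl
@[simp] theorem State.setMem_reg (σ : State) (d v : ℕ) : (σ.setMem d v).reg = σ.reg := rfl
@[simp] theorem State.setMem_mem (σ : State) (d v a : ℕ) :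
    (σ.setMem d v).mem a = if a = d then v else σ.mem a := by
  simp [State.setMem, Function.update_apply]
theorem State.setReg_self (σ : State) (d : ℕ) : σ.setReg d (σ.reg d) = σ := by
  simp [State.setReg]

/-- All registers and memory cells hold words of `w` bits. -/
def State.Bounded (w : ℕ) (σ : State) : Prop :=
  (∀ r, σ.reg r < 2 ^ w) ∧ ∀ a, σ.mem a < 2 ^ w

/-- Two states agree on the memory and on all registers but those used for temporaries. -/
def State.Agree (σ ρ : State) : Prop :=
  (∀ r < 32, ρ.reg r = σ.reg r) ∧ ρ.mem = σ.mem

theorem State.Bounded.setReg {w : ℕ} {σ : State} (h : σ.Bounded w) {d v : ℕ} (hv : v < 2 ^ w) :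
    (σ.setReg d v).Bounded w :=
  ⟨fun r => by rw [setReg_reg]; split; exacts [hv, h.1 r], h.2⟩

theorem State.Bounded.setMem {w : ℕ} {σ : State} (h : σ.Bounded w) {d v : ℕ} (hv : v < 2 ^ w) :
    (σ.setMem d v).Bounded w :=
  ⟨h.1, fun r => by rw [setMem_mem]; split; exacts [hv, h.2 r]⟩

theorem State.Agree.setReg {σ ρ : State} (h : σ.Agree ρ) {d : ℕ} (v : ℕ) (hd : 32 ≤ d) :
    σ.Agree (ρ.setReg d v) :=
  ⟨fun r hr => by rw [setReg_reg, if_neg (by omega)]; exact h.1 r hr, h.2⟩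

/-- The word length is positive and the input consists of words. -/
def Proper (w : ℕ) (I : List ℕ) : Prop := 0 < w ∧ ∀ x, I.getD x 0 < 2 ^ w

/-- Temporaries form a stack starting at register `d`: the second operand is evaluated from `d + 1`
on, so the first one survives in `d`. Since `d ≥ 32`, the named registers are untouched, and the
value may be computed in the abstract state `σ` although the machine runs in `ρ`. -/
theorem Expr.exec_code {w S : ℕ} {I : List ℕ} (hI : Proper w I) {σ : State} (e : Expr)
    (he : e.Ok w S I σ) (d : ℕ) (hd : 32 ≤ d) (ρ : State) (hρ : ρ.Bounded w) (ha : σ.Agree ρ) :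
    ∃ τ, Exec w S I (e.code d) ρ e.cost τ ∧ τ.Bounded w ∧ σ.Agree τ ∧
      (∀ r < d, τ.reg r = ρ.reg r) ∧ τ.reg d = e.val I σ := by
  induction e generalizing d ρ with
  | lit v =>
    have hv : v % 2 ^ w = v := Nat.mod_eq_of_lt he
    refine ⟨_, Exec.const d v ρ, ?_, ?_, ?_, ?_⟩
    · exact hρ.setReg (by rw [hv]; exact he)
    · exact ha.setReg _ hd
    · intro r hr; simp [hr.ne]
    · simp [hv, Expr.val]
  | var r =>
    -- There is no move instruction; a register is copied by a bitwise or with itself.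
    have hv : Op.or.eval w (ρ.reg r) (ρ.reg r) = ρ.reg r := by
      simp only [Op.eval, Nat.or_self]
      exact Nat.mod_eq_of_lt (hρ.1 r)
    refine ⟨_, Exec.op .or d r r ρ, ?_, ?_, ?_, ?_⟩
    · exact hρ.setReg (by rw [hv]; exact hρ.1 r)
    · exact ha.setReg _ hd
    · intro r hr; simp [hr.ne]
    · rw [hv]; simpa [Expr.val] using ha.1 r he
  | op o a b iha ihb =>
    obtain ⟨ha1, hb1, hf⟩ := he
    obtain ⟨τ, h1, h2, h3, h4, h5⟩ := iha ha1 d hd ρ hρ ha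
    obtain ⟨υ, k1, k2, k3, k4, k5⟩ := ihb hb1 (d + 1) (by omega) τ h2 h3
    have h6 : υ.reg d = a.val I σ := by rw [k4 d (by omega), h5]
    have hv : o.eval w (υ.reg d) (υ.reg (d + 1)) = o.ideal (a.val I σ) (b.val I σ) := by
      rw [h6, k5]
      exact Op.eval_eq_ideal hI.1 (by rw [← h5]; exact h2.1 d) hf
    refine ⟨_, Exec.seq (Exec.seq h1 k1) (Exec.op o d d (d + 1) υ), ?_, ?_, ?_, ?_⟩
    · exact k2.setReg (Nat.mod_lt _ (by positivity))
    · exact k3.setReg _ hd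
    · intro r hr; simp only [State.setReg_reg, if_neg hr.ne]; rw [k4 r (by omega), h4 r hr]
    · simp [hv, Expr.val]
  | load a iha =>
    obtain ⟨ha1, hS⟩ := he
    obtain ⟨τ, h1, h2, h3, h4, h5⟩ := iha ha1 d hd ρ hρ ha
    refine ⟨_, Exec.seq h1 (Exec.load d d τ (by rw [h5]; exact hS)), ?_, ?_, ?_, ?_⟩
    · exact h2.setReg (h2.2 _)
    · exact h3.setReg _ hd
    · intro r hr; simp only [State.setReg_reg, if_neg hr.ne]; rw [h4 r hr]
    · simp [Expr.val, h5, h3.2]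
  | read a iha =>
    obtain ⟨ha1, hS⟩ := he
    obtain ⟨τ, h1, h2, h3, h4, h5⟩ := iha ha1 d hd ρ hρ ha
    have hlt : τ.reg d < I.length := by rw [h5]; exact hS
    have hv : I[τ.reg d] = I.getD (a.val I σ) 0 := by
      rw [← h5, List.getD_eq_getElem _ _ hlt]
    refine ⟨_, Exec.seq h1 (Exec.read d d τ hlt), ?_, ?_, ?_, ?_⟩
    · exact h2.setReg (by rw [hv]; exact hI.2 _)
    · exact h3.setReg _ hd
    · intro r hr; simp only [State.setReg_reg, if_neg hr.ne]; rw [h4 r hr]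
    · simp [Expr.val, hv]

/-! ### Structured programs and triples that count steps -/

namespace Prog

/-- `R[r] := e`. -/
def assign (r : ℕ) (e : Expr) : Prog := .seq (e.code 32) (.op .or r 32 32)

/-- `M[a] := e`. -/
def put (a e : Expr) : Prog := .seq (.seq (a.code 32) (e.code 33)) (.store 32 33)

/-- If `e ≠ 0` then `p` else `q`. -/
def cond (e : Expr) (p q : Prog) : Prog := .seq (e.code 32) (.ite 32 p q)

/-- While `e ≠ 0` do `p`. -/
def whileDo (e : Expr) (p : Prog) : Prog := .seq (e.code 32) (.loop 32 (.seq p (e.code 32)))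

/-- Sequential composition of a list of programs. -/
def block : List Prog → Prog
  | [] => .skip
  | [p] => p
  | p :: q :: l => .seq p (block (q :: l))

end Prog

/-- `Triple w S I p σ Q`: started in a state that agrees with `σ`, the program `p` halts after some
number `t` of steps in a state that agrees with some `τ` such that `Q t τ`. -/
def Triple (w S : ℕ) (I : List ℕ) (p : Prog) (σ : State) (Q : ℕ → State → Prop) : Prop :=
  ∀ ρ : State, ρ.Bounded w → σ.Agree ρ → ∃ t υ τ, Exec w S I p ρ t υ ∧ υ.Bounded w ∧
    τ.Agree υ ∧ Q t τ

namespace Triple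

variable {w S : ℕ} {I : List ℕ} {p q : Prog} {σ : State} {Q Q' : ℕ → State → Prop} {e : Expr}

theorem mono (h : Triple w S I p σ Q) (hQ : ∀ t τ, Q t τ → Q' t τ) : Triple w S I p σ Q' := by
  intro ρ h1 h2
  obtain ⟨t, υ, τ, h3, h4, h5, h6⟩ := h ρ h1 h2
  exact ⟨t, υ, τ, h3, h4, h5, hQ _ _ h6⟩

theorem skip (h : Q 1 σ) : Triple w S I .skip σ Q :=
  fun ρ h1 h2 => ⟨1, ρ, σ, Exec.skip ρ, h1, h2, h⟩

theorem seq (h : Triple w S I p σ fun t τ => Triple w S I q τ fun u υ => Q (t + u) υ) :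
    Triple w S I (.seq p q) σ Q := by
  intro ρ h1 h2
  obtain ⟨t, υ, τ, h3, h4, h5, h6⟩ := h ρ h1 h2
  obtain ⟨u, υ', τ', k3, k4, k5, k6⟩ := h6 υ h4 h5
  exact ⟨t + u, υ', τ', h3.seq k3, k4, k5, k6⟩

theorem assign (hI : Proper w I) {r : ℕ} (he : e.Ok w S I σ)
    (h : Q (e.cost + 1) (σ.setReg r (e.val I σ))) : Triple w S I (.assign r e) σ Q := by
  intro ρ h1 h2
  obtain ⟨τ, h3, h4, h5, -, h7⟩ := Expr.exec_code hI e he 32 le_rfl ρ h1 h2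
  have hv : Op.or.eval w (τ.reg 32) (τ.reg 32) = e.val I σ := by
    simp only [Op.eval, Nat.or_self]
    rw [Nat.mod_eq_of_lt (h4.1 32), h7]
  refine ⟨_, _, σ.setReg r (e.val I σ), h3.seq (Exec.op .or r 32 32 τ),
    h4.setReg (Nat.mod_lt _ (by positivity)),
    ⟨fun r' hr' => ?_, h5.2⟩, h⟩
  rw [hv, State.setReg_reg, State.setReg_reg]
  split
  · rfl
  · exact h5.1 r' hr'

theorem put (hI : Proper w I) {a : Expr} (ha : a.Ok w S I σ) (he : e.Ok w S I σ)
    (hS : a.val I σ < S) (h : Q (a.cost + e.cost + 1) (σ.setMem (a.val I σ) (e.val I σ))) :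
    Triple w S I (.put a e) σ Q := by
  intro ρ h1 h2
  obtain ⟨τ, h3, h4, h5, -, h7⟩ := Expr.exec_code hI a ha 32 le_rfl ρ h1 h2
  obtain ⟨υ, k3, k4, k5, k6, k7⟩ := Expr.exec_code hI e he 33 (by norm_num) τ h4 h5
  have k8 : υ.reg 32 = a.val I σ := by rw [k6 32 (by norm_num), h7]
  refine ⟨_, _, σ.setMem (a.val I σ) (e.val I σ),
    (h3.seq k3).seq (Exec.store 32 33 υ (by rw [k8]; exact hS)),
    k4.setMem (k4.1 _), ⟨fun r' hr' => k5.1 r' hr', ?_⟩, h⟩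
  simp only [State.setMem, k8, k7, k5.2]

theorem cond (hI : Proper w I) (he : e.Ok w S I σ)
    (hp : e.val I σ ≠ 0 → Triple w S I p σ fun t τ => Q (e.cost + 1 + t) τ)
    (hq : e.val I σ = 0 → Triple w S I q σ fun t τ => Q (e.cost + 1 + t) τ) :
    Triple w S I (.cond e p q) σ Q := by
  intro ρ h1 h2
  obtain ⟨τ, h3, h4, h5, -, h7⟩ := Expr.exec_code hI e he 32 le_rfl ρ h1 h2
  by_cases h0 : e.val I σ = 0
  · obtain ⟨t, υ, τ', k3, k4, k5, k6⟩ := hq h0 τ h4 h5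
    refine ⟨_, υ, τ', h3.seq (Exec.iteFalse (by rw [h7, h0]) k3), k4, k5, ?_⟩
    rwa [← add_assoc, add_right_comm]
  · obtain ⟨t, υ, τ', k3, k4, k5, k6⟩ := hp h0 τ h4 h5
    refine ⟨_, υ, τ', h3.seq (Exec.iteTrue (by rwa [h7]) k3), k4, k5, ?_⟩
    rwa [← add_assoc, add_right_comm]

/-- Loops: the invariant bounds the number of steps so far. -/
theorem whileDo (hI : Proper w I) (Inv : ℕ → State → Prop) (T : ℕ) (h0 : Inv 0 σ)
    (hT : ∀ t τ, Inv t τ → t ≤ T) (he : ∀ t τ, Inv t τ → e.Ok w S I τ)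
    (hp : ∀ t τ, Inv t τ → e.val I τ ≠ 0 →
      Triple w S I p τ fun u υ => Inv (t + u + e.cost + 1) υ)
    (hQ : ∀ t τ, Inv t τ → e.val I τ = 0 → Q (t + e.cost + 1) τ) :
    Triple w S I (.whileDo e p) σ Q := by
  -- `m` is fuel. Every round adds at least one step to the clock `t`, and the invariant keeps `t ≤
  -- T`, so the time bound itself proves termination.
  have key : ∀ m t τ ρ, T < t + m → Inv t τ → ρ.Bounded w → τ.Agree ρ →
      ρ.reg 32 = e.val I τ → ∃ u υ τ', Exec w S I (.loop 32 (.seq p (e.code 32))) ρ u υ ∧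
        υ.Bounded w ∧ τ'.Agree υ ∧ Q (t + u + e.cost) τ' := by
    intro m
    induction m with
    | zero => intro t τ ρ hm hi; have := hT t τ hi; omega
    | succ m ih =>
      intro t τ ρ hm hi h1 h2 h3
      by_cases hz : e.val I τ = 0
      · refine ⟨1, ρ, τ, Exec.loopFalse (by rw [h3, hz]), h1, h2, ?_⟩
        rw [add_right_comm]
        exact hQ t τ hi hz
      · obtain ⟨u, υ, τ', k1, k2, k3, k4⟩ := hp t τ hi hz ρ h1 h2
        obtain ⟨υ', l1, l2, l3, -, l5⟩ := Expr.exec_code hI e (he _ _ k4) 32 le_rfl υ k2 k3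
        obtain ⟨u', υ'', τ'', m1, m2, m3, m4⟩ := ih _ _ υ' (by omega) k4 l2 l3 l5
        refine ⟨_, υ'', τ'', Exec.loopTrue (by rwa [h3]) (k1.seq l1) m1, m2, m3, ?_⟩
        convert m4 using 1
        omega
  intro ρ h1 h2
  obtain ⟨τ, h3, h4, h5, -, h7⟩ := Expr.exec_code hI e (he _ _ h0) 32 le_rfl ρ h1 h2
  obtain ⟨u, υ, τ', k1, k2, k3, k4⟩ := key (T + 1) 0 σ τ (by omega) h0 h4 h5 h7
  refine ⟨_, υ, τ', h3.seq k1, k2, k3, ?_⟩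
  convert k4 using 1
  omega

end Triple
end WordRAM

/-! Windows of a binary string. -/

/-- The characters of the input, as 0 and 1; beyond the end of the input there are zeros. -/
def chr (I : List ℕ) (x : ℕ) : ℕ := I.getD x 0

/-- The number of characters other than `p` among the first `x` characters. -/
def others (I : List ℕ) (p x : ℕ) : ℕ := Nat.count (fun y => chr I y ≠ p) x

/-- The largest number of characters `p` in a window with at most `z` other characters. -/
def maxOcc (I : List ℕ) (p z : ℕ) : ℕ :=
  ((Finset.range (I.length + 1) ×ˢ Finset.range (I.length + 1)).filter fun x =>
    others I p x.2 - others I p x.1 ≤ z).sup fun x =>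
      (x.2 - x.1) - (others I p x.2 - others I p x.1)

section
variable {I : List ℕ} {p z l r : ℕ}

theorem others_succ (I : List ℕ) (p x : ℕ) :
    others I p (x + 1) = others I p x + if chr I x ≠ p then 1 else 0 := Nat.count_succ _ _

theorem others_zero (I : List ℕ) (p : ℕ) : others I p 0 = 0 := Nat.count_zero _

theorem others_mono (I : List ℕ) (p : ℕ) : Monotone (others I p) := Nat.count_monotone _

theorem others_add_le (I : List ℕ) (p x y : ℕ) : others I p (x + y) ≤ others I p x + y := by
  unfold others
  rw [Nat.count_add]
  exact Nat.add_le_add_left (Nat.count_le ..) _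

theorem others_le_add_sub (I : List ℕ) (p : ℕ) {x y : ℕ} (h : x ≤ y) :
    others I p y ≤ others I p x + (y - x) := by
  obtain ⟨d, rfl⟩ := Nat.exists_eq_add_of_le h
  simpa using others_add_le I p x d

theorem others_le (I : List ℕ) (p x : ℕ) : others I p x ≤ x := by
  simpa [others_zero] using others_le_add_sub I p (Nat.zero_le x)

theorem le_maxOcc (hl : l ≤ I.length) (hr : r ≤ I.length)
    (h : others I p r - others I p l ≤ z) :
    (r - l) - (others I p r - others I p l) ≤ maxOcc I p z :=
  Finset.le_sup (f := fun x : ℕ × ℕ => (x.2 - x.1) - (others I p x.2 - others I p x.1))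
    (b := (l, r)) (by simp; omega)

theorem maxOcc_le {B : ℕ} (h : ∀ l r, l ≤ I.length → r ≤ I.length →
    others I p r - others I p l ≤ z → (r - l) - (others I p r - others I p l) ≤ B) :
    maxOcc I p z ≤ B := by
  refine Finset.sup_le fun x hx => ?_
  simp only [Finset.mem_filter, Finset.mem_product, Finset.mem_range] at hx
  exact h x.1 x.2 (by omega) (by omega) hx.2

theorem exists_of_le_maxOcc {b : ℕ} (h : b ≤ maxOcc I p z) : ∃ l r, l ≤ r ∧ r ≤ I.length ∧
    others I p r - others I p l ≤ z ∧ b ≤ (r - l) - (others I p r - others I p l) := by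
  rcases Nat.eq_zero_or_pos b with rfl | hb
  · exact ⟨0, 0, le_rfl, by simp, by simp, by simp⟩
  · by_contra! hc
    have : maxOcc I p z ≤ b - 1 := maxOcc_le fun l r hl hr hz => by
      by_cases hlr : l ≤ r
      · have := hc l r hlr hr hz; omega
      · omega
    omega

theorem maxOcc_mono (I : List ℕ) (p : ℕ) : Monotone (maxOcc I p) := fun _ _ h =>
  maxOcc_le fun _ _ hl hr hz => le_maxOcc hl hr (hz.trans h)

theorem maxOcc_le_length (I : List ℕ) (p z : ℕ) : maxOcc I p z ≤ I.length :=
  maxOcc_le fun l r _ hr _ => by omega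

/-- A window with at most `a` characters other than `p` and at least `b` characters `p` can be
trimmed or extended to one of length `a + b` with at least `b` characters `p`. -/
theorem exists_window {a b : ℕ} (hab : a + b ≤ I.length) (h : b ≤ maxOcc I p a) :
    ∃ l, l + (a + b) ≤ I.length ∧ others I p (l + (a + b)) ≤ others I p l + a := by
  obtain ⟨l, r, hlr, hr, hz, ho⟩ := exists_of_le_maxOcc h
  have hm := others_mono I p hlr
  have hd := others_le_add_sub I p hlr
  by_cases hlen : r - l ≤ a + b
  · by_cases hend : l + (a + b) ≤ I.length
    · refine ⟨l, hend, ?_⟩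
      have := others_le_add_sub I p (x := r) (y := l + (a + b)) (by omega)
      omega
    -- The window cannot be extended far enough to the right, so the last window of length `a + b`
    -- is taken; it contains the given one.
    · refine ⟨I.length - (a + b), by omega, ?_⟩
      rw [Nat.sub_add_cancel hab]
      have h1 := others_le_add_sub I p hr
      have h2 := others_le_add_sub I p (x := I.length - (a + b)) (y := l) (by omega)
      omega
  · refine ⟨l, by omega, ?_⟩
    have := others_mono I p (show l + (a + b) ≤ r by omega)
    omega

theorem others_zero_add_one (hI : ∀ x, chr I x = 0 ∨ chr I x = 1) (x : ℕ) :
    others I 0 x + others I 1 x = x := by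
  induction x with
  | zero => simp [others_zero]
  | succ x ih =>
    rw [others_succ, others_succ]
    rcases hI x with h | h <;> simp [h] <;> omega

/-- A discrete intermediate value theorem for windows of fixed length. -/
theorem exists_window_eq {m b l₀ l₁ n : ℕ} (h₀ : l₀ + m ≤ n) (h₁ : l₁ + m ≤ n)
    (h : others I p (l₀ + m) ≤ others I p l₀ + b) (h' : others I p l₁ + b ≤ others I p (l₁ + m)) :
    ∃ l, l + m ≤ n ∧ others I p (l + m) = others I p l + b := by
  have step : ∀ l, others I p (l + 1 + m) = others I p (l + m) +
      if chr I (l + m) ≠ p then 1 else 0 := fun l => by rw [add_right_comm, others_succ]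
  rcases le_total l₀ l₁ with hle | hle
  · obtain ⟨d, rfl⟩ := Nat.exists_eq_add_of_le hle
    induction d with
    | zero => exact ⟨l₀, h₀, le_antisymm h h'⟩
    | succ d ih =>
      -- If the window one position before `l₁` already has at least `b` characters other than `p`,
      -- it replaces `l₁`. Otherwise it has fewer than `b`, and the next one, having at most one
      -- more, has exactly `b`.
      by_cases hd : others I p (l₀ + d) + b ≤ others I p (l₀ + d + m)
      · exact ih (by omega) hd (by omega)
      · refine ⟨l₀ + d + 1, by omega, ?_⟩
        rw [← add_assoc, step, others_succ] at h'
        rw [step, others_succ]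
        split_ifs at h' ⊢ <;> omega
  · obtain ⟨d, rfl⟩ := Nat.exists_eq_add_of_le hle
    induction d with
    | zero => exact ⟨l₁, h₁, le_antisymm h h'⟩
    | succ d ih =>
      by_cases hd : others I p (l₁ + d + m) ≤ others I p (l₁ + d) + b
      · exact ih (by omega) hd (by omega)
      · refine ⟨l₁ + d + 1, by omega, ?_⟩
        rw [← add_assoc, step, others_succ] at h
        rw [step, others_succ]
        split_ifs at h ⊢ <;> omega

/-- Binary strings whose Parikh vectors occur, in terms of `maxOcc`. -/
theorem exists_window_iff (hI : ∀ x, chr I x = 0 ∨ chr I x = 1) {a b : ℕ} :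
    (∃ l r, l < r ∧ r ≤ I.length ∧ others I 1 r = others I 1 l + a ∧
      others I 0 r = others I 0 l + b) ↔
    a + b ≠ 0 ∧ a + b ≤ I.length ∧ b ≤ maxOcc I 1 a ∧ a ≤ maxOcc I 0 b := by
  have hs := others_zero_add_one hI
  constructor
  · rintro ⟨l, r, hlr, hr, h1, h0⟩
    have e1 := hs l
    have e2 := hs r
    have g1 := le_maxOcc (I := I) (p := 1) (z := a) (l := l) (r := r) (by omega) hr (by omega)
    have g0 := le_maxOcc (I := I) (p := 0) (z := b) (l := l) (r := r) (by omega) hr (by omega)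
    refine ⟨by omega, by omega, by omega, by omega⟩
  · rintro ⟨hne, hle, h1, h0⟩
    obtain ⟨l₁, k1, k2⟩ := exists_window hle h1
    obtain ⟨l₀, k3, k4⟩ := exists_window (by omega) h0
    rw [add_comm b a] at k3 k4
    have e1 := hs l₁
    have e2 := hs (l₁ + (a + b))
    -- For `p = 0` the function `others` counts ones: the window at `l₀` has at most `b` of them.
    -- The window at `l₁` has at most `a` zeros and length `a + b`, hence at least `b` ones.
    obtain ⟨l, m1, m2⟩ := exists_window_eq (p := 0) (b := b) k3 k1 k4 (by omega)
    have e3 := hs l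
    have e4 := hs (l + (a + b))
    exact ⟨l, l + (a + b), by omega, m1, by omega, m2⟩

end

/-! ### Binary strings as inputs; runs and changes of character -/

/-- The input given to a program: the characters of a binary string. -/
abbrev inputOf (s : List Bool) : List ℕ := s.map Bool.toNat

section
variable (s : List Bool)

theorem chr_inputOf (x : ℕ) : chr (inputOf s) x = (s.getD x false).toNat := by
  simp only [chr, inputOf, List.getD_eq_getElem?_getD, List.getElem?_map]
  cases s[x]? <;> rfl

theorem chr_inputOf_eq (x : ℕ) : chr (inputOf s) x = 0 ∨ chr (inputOf s) x = 1 := by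
  rw [chr_inputOf]
  cases s.getD x false <;> simp

theorem chr_eq_one_iff (x : ℕ) : chr (inputOf s) x = 1 ↔ s[x]? = some true := by
  rw [chr_inputOf, List.getD_eq_getElem?_getD]
  rcases s[x]? with _ | _ | _ <;> simp

theorem count_take (b : Bool) (x : ℕ) (hx : x ≤ s.length) :
    (s.take x).count b = others (inputOf s) (!b).toNat x := by
  induction x with
  | zero => simp [others_zero]
  | succ x ih =>
    have hx' : x < s.length := hx
    rw [List.take_add_one, List.count_append, ih hx'.le, others_succ, chr_inputOf,
      List.getD_eq_getElem?_getD, List.getElem?_eq_getElem hx']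
    cases b <;> cases s[x] <;> simp

theorem jumbledOccurs_iff (a b : ℕ) : JumbledOccurs s a b ↔
    a + b ≠ 0 ∧ a + b ≤ s.length ∧ b ≤ maxOcc (inputOf s) 1 a ∧ a ≤ maxOcc (inputOf s) 0 b := by
  have key := exists_window_iff (I := inputOf s) (chr_inputOf_eq s) (a := a) (b := b)
  rw [List.length_map] at key
  rw [← key]
  constructor
  · rintro ⟨t, ⟨u, v, rfl⟩, hne, rfl, rfl⟩
    have hpos : 0 < t.length := List.length_pos_iff.mpr hne
    refine ⟨u.length, u.length + t.length, by omega, by simp, ?_, ?_⟩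
    · rw [← show (!false).toNat = 1 from rfl, ← count_take _ _ _ (by simp),
        ← count_take _ _ _ (by simp)]
      simp [List.take_append, List.take_of_length_le]
    · rw [← show (!true).toNat = 0 from rfl, ← count_take _ _ _ (by simp),
        ← count_take _ _ _ (by simp)]
      simp [List.take_append, List.take_of_length_le]
  · rintro ⟨l, r, hlr, hr, h1, h0⟩
    rw [← show (!false).toNat = 1 from rfl, ← count_take _ _ _ hr,
      ← count_take _ _ _ (by omega)] at h1
    rw [← show (!true).toNat = 0 from rfl, ← count_take _ _ _ hr,
      ← count_take _ _ _ (by omega)] at h0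
    have e : s.take r = s.take l ++ (s.take r).drop l := by
      conv_lhs => rw [← List.take_append_drop l (s.take r)]
      rw [List.take_take, min_eq_left hlr.le]
    refine ⟨(s.take r).drop l, ?_, ?_, ?_, ?_⟩
    · exact ((s.take r).drop_suffix l).isInfix.trans (s.take_prefix r).isInfix
    · rw [← List.length_pos_iff]; simp; omega
    · rw [e, List.count_append] at h1; omega
    · rw [e, List.count_append] at h0; omega

/-- The number of changes between consecutive characters, the first `x` pairs being considered. -/
def changes (I : List ℕ) (x : ℕ) : ℕ := Nat.count (fun y => chr I (y + 1) ≠ chr I y) x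

theorem exists_run_end (i : ℕ) (hi : s[i]? = some true) :
    ∃ j, i ≤ j ∧ (∀ l ∈ Finset.Icc i j, s[l]? = some true) ∧ s[j + 1]? ≠ some true := by
  have hex : ∃ d, s[i + d + 1]? ≠ some true :=
    ⟨s.length, by rw [List.getElem?_eq_none (by omega)]; simp⟩
  refine ⟨i + Nat.find hex, by omega, fun l hl => ?_, Nat.find_spec hex⟩
  rw [Finset.mem_Icc] at hl
  rcases hl.1.eq_or_lt with rfl | h
  · exact hi
  · have := Nat.find_min hex (m := l - i - 1) (by omega)
    rwa [show i + (l - i - 1) + 1 = l by omega, not_not] at this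

theorem exists_run_start (j : ℕ) (hj : s[j]? = some true) :
    ∃ i ≤ j, (∀ l ∈ Finset.Icc i j, s[l]? = some true) ∧ (i = 0 ∨ s[i - 1]? ≠ some true) := by
  have hex : ∃ i, i ≤ j ∧ ∀ l ∈ Finset.Icc i j, s[l]? = some true :=
    ⟨j, le_rfl, fun l hl => by rw [Finset.mem_Icc] at hl; rwa [show l = j by omega]⟩
  classical
  obtain ⟨h1, h2⟩ := Nat.find_spec hex
  refine ⟨Nat.find hex, h1, h2, ?_⟩
  by_contra! hc
  refine Nat.find_min hex (m := Nat.find hex - 1) (by omega) ⟨by omega, fun l hl => ?_⟩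
  rw [Finset.mem_Icc] at hl
  by_cases hl' : l = Nat.find hex - 1
  · rw [hl']; exact hc.2
  · exact h2 l (by rw [Finset.mem_Icc]; omega)

/-- A change from 1 to 0 sits at the last position of a run, a change from 0 to 1 just before the
first position of a run. So each run accounts for at most two changes. -/
theorem changes_le (x : ℕ) :
    changes (inputOf s) x ≤ 2 * numOneRuns s := by
  classical
  set F := (Finset.range s.length ×ˢ Finset.range s.length).filter fun p => IsOneRun s p.1 p.2
  have hF : ∀ i j, IsOneRun s i j → (i, j) ∈ F := fun i j h => by
    have hj : s[j]? = some true := h.2.1 j (by rw [Finset.mem_Icc]; exact ⟨h.1, le_rfl⟩)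
    have hlt : j < s.length := by
      by_contra hc
      rw [List.getElem?_eq_none (by omega)] at hj
      cases hj
    have hij := h.1
    simp only [F, Finset.mem_filter, Finset.mem_product, Finset.mem_range]
    exact ⟨⟨by omega, hlt⟩, h⟩
  have hsub : (Finset.range x).filter (fun y => chr (inputOf s) (y + 1) ≠ chr (inputOf s) y) ⊆
      F.image Prod.snd ∪ F.image (fun p => p.1 - 1) := by
    intro y hy
    rw [Finset.mem_filter, Finset.mem_range] at hy
    rw [Finset.mem_union, Finset.mem_image, Finset.mem_image]
    rcases chr_inputOf_eq s y with h | h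
    · have h1 : chr (inputOf s) (y + 1) = 1 := by
        rcases chr_inputOf_eq s (y + 1) with h' | h'
        · exact absurd (h'.trans h.symm) hy.2
        · exact h'
      rw [chr_eq_one_iff] at h1
      obtain ⟨j, k1, k2, k3⟩ := exists_run_end s _ h1
      refine Or.inr ⟨(y + 1, j), hF _ _ ⟨k1, k2, Or.inr ?_, k3⟩, rfl⟩
      rw [Nat.add_sub_cancel, Ne, ← chr_eq_one_iff, h]
      simp
    · have h1 : chr (inputOf s) (y + 1) ≠ 1 := fun h' => hy.2 (h'.trans h.symm)
      rw [chr_eq_one_iff] at h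
      rw [Ne, chr_eq_one_iff] at h1
      obtain ⟨i, k1, k2, k3⟩ := exists_run_start s _ h
      exact Or.inl ⟨(i, y), hF _ _ ⟨k1, k2, k3, h1⟩, rfl⟩
  unfold changes
  rw [Nat.count_eq_card_filter_range]
  calc _ ≤ _ := Finset.card_le_card hsub
    _ ≤ _ := Finset.card_union_le _ _
    _ ≤ F.card + F.card := Nat.add_le_add Finset.card_image_le Finset.card_image_le
    _ = 2 * numOneRuns s := by rw [two_mul]; rfl

end

/-! Windows between the boundaries of blocks that consist of equal characters. -/

/-- `P 0 ≤ P 1 ≤ … ≤ P R` cut the input into blocks of equal characters. -/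
structure Cuts (I : List ℕ) (R : ℕ) (P : ℕ → ℕ) : Prop where
  mono : Monotone P
  zero : P 0 = 0
  last : P R = I.length
  same : ∀ k < R, ∀ x, P k ≤ x → x < P (k + 1) → chr I x = chr I (P k)

namespace Cuts
variable {I : List ℕ} {R : ℕ} {P : ℕ → ℕ} (h : Cuts I R P)
include h

theorem others_eq (p : ℕ) {k x : ℕ} (hk : k < R) (h1 : P k ≤ x) (h2 : x ≤ P (k + 1)) :
    others I p x = others I p (P k) + if chr I (P k) = p then 0 else x - P k := by
  induction x, h1 using Nat.le_induction with
  | base => simp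
  | succ x hx ih =>
    rw [others_succ, ih (by omega), h.same k hk x hx (by omega)]
    split_ifs <;> omega

theorem exists_block {x : ℕ} (hx : x < I.length) : ∃ k < R, P k ≤ x ∧ x < P (k + 1) := by
  have hR := h.last
  have hex : ∃ k, x < P k := ⟨R, by omega⟩
  have h1 := Nat.find_spec hex
  have h0 : Nat.find hex ≠ 0 := fun h0 => by rw [h0, h.zero] at h1; omega
  have h2 := Nat.find_min hex (m := Nat.find hex - 1) (by omega)
  have h3 : Nat.find hex ≤ R := Nat.find_min' hex (by omega)
  exact ⟨Nat.find hex - 1, by omega, by omega, by rwa [Nat.sub_add_cancel (by omega)]⟩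

/-- The two inequalities say that moving the left end of a window from `x` to `P i` gains no other
character and loses no `p`. Inside a block of `p` the end moves left to the start of the block,
inside another block it moves right to the end. `exists_right` is the mirror image. -/
theorem exists_left (p : ℕ) {x : ℕ} (hx : x ≤ I.length) : ∃ i ≤ R,
    others I p x ≤ others I p (P i) ∧ P i + others I p x ≤ x + others I p (P i) := by
  rcases hx.eq_or_lt with rfl | hx
  · exact ⟨R, le_rfl, by rw [h.last], by rw [h.last]⟩
  · obtain ⟨k, hk, h1, h2⟩ := h.exists_block hx
    have e1 := h.others_eq p hk h1 h2.le
    have e2 := h.others_eq p hk (h.mono (Nat.le_add_right k 1)) le_rfl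
    by_cases hc : chr I (P k) = p
    · rw [if_pos hc] at e1
      exact ⟨k, hk.le, by omega, by omega⟩
    · rw [if_neg hc] at e1 e2
      exact ⟨k + 1, hk, by omega, by omega⟩

theorem exists_right (p : ℕ) {x : ℕ} (hx : x ≤ I.length) : ∃ i ≤ R,
    others I p (P i) ≤ others I p x ∧ x + others I p (P i) ≤ P i + others I p x := by
  rcases hx.eq_or_lt with rfl | hx
  · exact ⟨R, le_rfl, by rw [h.last], by rw [h.last]⟩
  · obtain ⟨k, hk, h1, h2⟩ := h.exists_block hx
    have e1 := h.others_eq p hk h1 h2.le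
    have e2 := h.others_eq p hk (h.mono (Nat.le_add_right k 1)) le_rfl
    by_cases hc : chr I (P k) = p
    · rw [if_pos hc] at e1 e2
      exact ⟨k + 1, hk, by omega, by omega⟩
    · rw [if_neg hc] at e1
      exact ⟨k, hk.le, by omega, by omega⟩

/-- Only windows between boundaries matter. -/
theorem maxOcc_le {p z B : ℕ} (hB : ∀ i ≤ R, ∀ j ≤ R,
    others I p (P j) - others I p (P i) ≤ z →
      (P j - P i) - (others I p (P j) - others I p (P i)) ≤ B) : maxOcc I p z ≤ B := by
  refine _root_.maxOcc_le fun l r hl hr hz => ?_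
  obtain ⟨i, hi, i1, i2⟩ := h.exists_left p hl
  obtain ⟨j, hj, j1, j2⟩ := h.exists_right p hr
  have := hB i hi j hj (by omega)
  by_cases hlr : l ≤ r
  · have m1 := others_mono I p hlr
    rcases le_total (P i) (P j) with hij | hij
    · have m2 := others_mono I p hij
      omega
    -- If the moved ends have crossed, the original window contained no `p` at all.
    · have m2 := others_le_add_sub I p hij
      omega
  · omega

theorem le_length {k : ℕ} (hk : k ≤ R) : P k ≤ I.length := by
  rw [← h.last]; exact h.mono hk

end Cuts

/-! Population counts, rank structures and packed arrays. -/

/-- The number of ones in the binary representation of `x`. -/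
def popCount (x : ℕ) : ℕ := (Nat.digits 2 x).sum

theorem popCount_zero : popCount 0 = 0 := by simp [popCount]

theorem popCount_eq (x : ℕ) : popCount x = popCount (x / 2) + x % 2 := by
  rcases Nat.eq_zero_or_pos x with rfl | h
  · simp [popCount]
  · unfold popCount
    rw [Nat.digits_def' (by norm_num) h, List.sum_cons, add_comm]

theorem popCount_le (x : ℕ) : popCount x ≤ x := by
  induction x using Nat.strong_induction_on with
  | _ x ih =>
    rcases Nat.eq_zero_or_pos x with rfl | h
    · simp [popCount]
    · rw [popCount_eq]
      have := ih (x / 2) (by omega)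
      omega

theorem popCount_add_two_pow (j : ℕ) : ∀ x < 2 ^ j, popCount (x + 2 ^ j) = popCount x + 1 := by
  induction j with
  | zero =>
    intro x hx
    have : x = 0 := by simpa using hx
    subst this
    simp [popCount]
  | succ j ih =>
    intro x hx
    rw [popCount_eq, popCount_eq x]
    rw [pow_succ] at hx ⊢
    rw [show (x + 2 ^ j * 2) / 2 = x / 2 + 2 ^ j by omega, ih (x / 2) (by omega)]
    omega

theorem succ_div_mod {q : ℕ} (hq : 0 < q) (r : ℕ) :
    ((r + 1) / q = r / q ∧ (r + 1) % q = r % q + 1 ∧ r % q + 1 < q) ∨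
      ((r + 1) / q = r / q + 1 ∧ (r + 1) % q = 0 ∧ r % q + 1 = q) := by
  have h1 := Nat.div_add_mod r q
  have h2 := Nat.mod_lt r hq
  rcases Nat.lt_or_ge (r % q + 1) q with h | h
  · left
    have e : r + 1 = (r % q + 1) + q * (r / q) := by omega
    refine ⟨?_, ?_, h⟩
    · rw [e, Nat.add_mul_div_left _ _ hq, Nat.div_eq_of_lt h, zero_add]
    · rw [e, Nat.add_mul_mod_self_left, Nat.mod_eq_of_lt h]
  · right
    have e : r + 1 = q * (r / q + 1) := by rw [mul_add]; omega
    refine ⟨?_, ?_, by omega⟩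
    · rw [e, Nat.mul_div_cancel_left _ hq]
    · rw [e, Nat.mul_mod_right]

/-- The rank of the position `m` in the bit string with `t` bits in each of the words `B k`, where
`A k` is the rank of the first position of the word `B k`. -/
def rank (t : ℕ) (A B : ℕ → ℕ) (m : ℕ) : ℕ := A (m / t) + popCount (B (m / t) % 2 ^ (m % t))

/-- The first `m` bits of a rank structure have been written; they contain `r` ones. -/
structure RankInv (t : ℕ) (Spec : ℕ → ℕ → Prop) (A B : ℕ → ℕ) (m r : ℕ) : Prop where
  spec : ∀ m' ≤ m, Spec m' (rank t A B m')
  rank_eq : rank t A B m = r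
  low : B (m / t) < 2 ^ (m % t)
  high : ∀ k, m / t < k → B k = 0

theorem RankInv.init {t : ℕ} {Spec : ℕ → ℕ → Prop} {A B : ℕ → ℕ} (hA : A 0 = 0)
    (hB : ∀ k, B k = 0) (h : Spec 0 0) : RankInv t Spec A B 0 0 := by
  have : rank t A B 0 = 0 := by simp [rank, hA, hB, popCount]
  exact ⟨fun m' hm' => by rw [Nat.le_zero.mp hm', this]; exact h, this, by simp [hB],
    fun k _ => hB k⟩

/-- The new bit is put on top of the bits of the current word, so ranks at positions up to `m`,
which look only at lower bits, are unaffected. The entry of `A` for the next word is overwritten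
with the running rank at every step; when the current word is full it is therefore already correct.
-/
theorem RankInv.step {t : ℕ} (ht : 0 < t) {Spec : ℕ → ℕ → Prop} {A B A' B' : ℕ → ℕ} {m r β : ℕ}
    (h : RankInv t Spec A B m r) (hβ : β ≤ 1) (hs : Spec (m + 1) (r + β))
    (hA : ∀ k, A' k = if k = m / t + 1 then r + β else A k)
    (hB : ∀ k, B' k = if k = m / t then B (m / t) + β * 2 ^ (m % t) else B k) :
    RankInv t Spec A' B' (m + 1) (r + β) := by
  have hlow := h.low
  have old : ∀ m' ≤ m, rank t A' B' m' = rank t A B m' := by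
    intro m' hm'
    have hd : m' / t ≤ m / t := Nat.div_le_div_right hm'
    unfold rank
    rw [hA, if_neg (by omega), hB]
    split_ifs with hk
    · have e1 := Nat.div_add_mod m' t
      have e2 := Nat.div_add_mod m t
      rw [hk] at e1
      -- Within the same word, `2 ^ (m' % t)` divides the added `β * 2 ^ (m % t)`, which the
      -- reduction thus removes.
      have hle : m' % t ≤ m % t := by omega
      obtain ⟨d, hd⟩ := Nat.exists_eq_add_of_le hle
      rw [hk, hd, pow_add, mul_left_comm, Nat.add_mul_mod_self_left]
    · rfl
  have hr : A (m / t) + popCount (B (m / t)) = r := by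
    have := h.rank_eq
    rwa [rank, Nat.mod_eq_of_lt hlow] at this
  have hsum : B (m / t) + β * 2 ^ (m % t) < 2 ^ (m % t + 1) := by
    rw [pow_succ]
    have : β * 2 ^ (m % t) ≤ 1 * 2 ^ (m % t) := Nat.mul_le_mul_right _ hβ
    omega
  have hpop : popCount (B (m / t) + β * 2 ^ (m % t)) = popCount (B (m / t)) + β := by
    rcases Nat.le_one_iff_eq_zero_or_eq_one.mp hβ with rfl | rfl
    · simp
    · rw [one_mul, popCount_add_two_pow _ _ hlow]
  have new : rank t A' B' (m + 1) = r + β ∧ B' ((m + 1) / t) < 2 ^ ((m + 1) % t) := by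
    unfold rank
    rcases succ_div_mod ht m with ⟨e1, e2, e3⟩ | ⟨e1, e2, e3⟩
    · rw [e1, e2, hA, if_neg (by omega), hB, if_pos rfl, Nat.mod_eq_of_lt hsum, hpop]
      exact ⟨by omega, hsum⟩
    · rw [e1, e2, hA, if_pos rfl, hB, if_neg (by omega), h.high _ (by omega)]
      simp [popCount]
  refine ⟨fun m' hm' => ?_, new.1, new.2, fun k hk => ?_⟩
  · rcases Nat.le_or_eq_of_le_succ hm' with hm' | rfl
    · rw [old m' hm']; exact h.spec m' hm'
    · rw [new.1]; exact hs
  · have : m / t ≤ (m + 1) / t := Nat.div_le_div_right (Nat.le_succ m)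
    rw [hB, if_neg (by omega), h.high k (by omega)]

/-- The `k`-th entry of an array whose entries of `f` bits are packed into words, with `q` entries
per word. -/
def packed (f q : ℕ) (A : ℕ → ℕ) (k : ℕ) : ℕ := A (k / q) / 2 ^ (k % q * f) % 2 ^ f

/-- The first `r` entries of the packed array have been written. -/
structure PackedInv (f q : ℕ) (A : ℕ → ℕ) (r : ℕ) : Prop where
  low : A (r / q) < 2 ^ (r % q * f)
  high : ∀ k, r / q < k → A k = 0

/-- The bits of the word from `r % q * f` on are still zero, so adding the shifted value writes the
new entry without a carry and without touching earlier ones. -/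
theorem PackedInv.step {f q : ℕ} (hq : 0 < q) {A A' : ℕ → ℕ} {r v : ℕ}
    (h : PackedInv f q A r) (hv : v < 2 ^ f)
    (hA : ∀ k, A' k = if k = r / q then A (r / q) + v * 2 ^ (r % q * f) else A k) :
    PackedInv f q A' (r + 1) ∧ packed f q A' r = v ∧
      ∀ k < r, packed f q A' k = packed f q A k := by
  have hlow := h.low
  have hsum : A (r / q) + v * 2 ^ (r % q * f) < 2 ^ ((r % q + 1) * f) := by
    rw [add_mul, one_mul, pow_add]
    have : (v + 1) * 2 ^ (r % q * f) ≤ 2 ^ f * 2 ^ (r % q * f) := Nat.mul_le_mul_right _ hv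
    rw [add_mul, one_mul] at this
    rw [mul_comm (2 ^ (r % q * f))]
    omega
  refine ⟨?_, ?_, fun k hk => ?_⟩
  · constructor
    · rcases succ_div_mod hq r with ⟨e1, e2, e3⟩ | ⟨e1, e2, e3⟩
      · rw [e1, e2, hA, if_pos rfl]; exact hsum
      · rw [e1, e2, hA, if_neg (by omega), h.high _ (by omega)]; simp
    · intro k hk
      have : r / q ≤ (r + 1) / q := Nat.div_le_div_right (Nat.le_succ r)
      rw [hA, if_neg (by omega), h.high k (by omega)]
  · unfold packed
    rw [hA, if_pos rfl, Nat.add_mul_div_right _ _ (by positivity), Nat.div_eq_of_lt hlow, zero_add,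
      Nat.mod_eq_of_lt hv]
  · unfold packed
    rw [hA]
    split_ifs with hkr
    · have e1 := Nat.div_add_mod k q
      have e2 := Nat.div_add_mod r q
      rw [hkr] at e1
      obtain ⟨d, hd⟩ := Nat.exists_eq_add_of_lt (show k % q < r % q by omega)
      have e3 : r % q * f = k % q * f + (f + d * f) := by rw [hd]; ring
      rw [hkr, e3, pow_add, pow_add,
        show ∀ a b c : ℕ, v * (a * (b * c)) = b * (v * c) * a from fun a b c => by ring,
        Nat.add_mul_div_right _ _ (by positivity), Nat.add_mul_mod_self_left]
    · rfl

/-! Registers holding parameters of the data structure. -/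

open WordRAM.Expr (var lit load read)

namespace WordRAM

notation "rN" => 0
notation "rW" => 1
notation "rT" => 2
notation "rF" => 3
notation "rQ" => 4
notation "rE" => 5
notation "rM" => 6
notation "rR" => 7
notation "rL" => 8
notation "rZ" => 9
notation "rU" => 10
notation "rK" => 11
notation "rI" => 12
notation "rA" => 16
notation "rJ" => 20
notation "rY" => 24

/-- The address of the `k`-th cell of the `c`-th of 8 interleaved arrays. -/
def cell (k : Expr) (c : ℕ) : Expr := lit 8 * k + lit c

section
variable (I : List ℕ) (σ : State) (w S : ℕ)
@[simp] theorem val_read_eq_chr (a : Expr) : (read a).val I σ = chr I (a.val I σ) := rfl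
@[simp] theorem val_cell (k : Expr) (c : ℕ) : (cell k c).val I σ = 8 * k.val I σ + c := rfl
@[simp] theorem cost_cell (k : Expr) (c : ℕ) : (cell k c).cost = k.cost + 4 := by
  simp [cell]; omega
theorem ok_cell (k : Expr) (c : ℕ) (hc : c < 8) (hk : k.Ok w S I σ) (h8 : 8 < 2 ^ w)
    (h : 8 * k.val I σ + 8 ≤ 2 ^ w) : (cell k c).Ok w S I σ := by
  simp only [cell, Expr.ok_add, Expr.ok_mul, Expr.ok_lit, Expr.val_mul, Expr.val_lit]
  exact ⟨⟨by omega, hk, by omega⟩, by omega, by omega⟩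
end

/-- The numerical parameters of the data structure, for boundaries `P 0, …, P R` of blocks. -/
structure Setting (w S : ℕ) (I : List ℕ) (t f q L R N : ℕ) (P : ℕ → ℕ) : Prop where
  proper : Proper w I
  cuts : Cuts I R P
  beyond : ∀ k, R ≤ k → P k = I.length
  t_pos : 0 < t
  q_pos : 0 < q
  L_pos : 0 < L
  space : 8 * N ≤ S
  S_le : S ≤ 2 ^ w
  small : 16 * (I.length + 1) < 2 ^ w
  L_le : L ≤ I.length + 1
  R_lt : R + 1 < 2 ^ w
  two_pow_t : 2 ^ t < 2 ^ w
  shift_lt : q * f < 2 ^ w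
  lt_succ : ∀ k < R, P k < P (k + 1)
  len_lt : ∀ k < R, P (k + 1) - P k < 2 ^ f
  rec_lt : R / q < N
  tab_le : L ≤ N
  out_lt : (3 * I.length + 3) / t + 1 < N

/-- The parameters are in their registers and the lengths of the blocks are in the packed array. -/
structure Ready (I : List ℕ) (t f q L R : ℕ) (P : ℕ → ℕ) (σ : State) : Prop where
  reg_n : σ.reg rN = I.length
  reg_t : σ.reg rT = t
  reg_f : σ.reg rF = f
  reg_q : σ.reg rQ = q
  reg_m : σ.reg rM = 2 ^ f
  reg_r : σ.reg rR = R
  reg_l : σ.reg rL = L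
  lens : ∀ k < R, packed f q (fun i => σ.mem (8 * i + 5)) k = P (k + 1) - P k

section
variable {I : List ℕ} {t f q L R : ℕ} {P : ℕ → ℕ} {σ τ : State}

theorem Ready.frame (h : Ready I t f q L R P σ) (hr : ∀ r < 9, τ.reg r = σ.reg r)
    (hm : ∀ k, τ.mem (8 * k + 5) = σ.mem (8 * k + 5)) : Ready I t f q L R P τ where
  reg_n := (hr _ (by norm_num)).trans h.reg_n
  reg_t := (hr _ (by norm_num)).trans h.reg_t
  reg_f := (hr _ (by norm_num)).trans h.reg_f
  reg_q := (hr _ (by norm_num)).trans h.reg_q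
  reg_m := (hr _ (by norm_num)).trans h.reg_m
  reg_r := (hr _ (by norm_num)).trans h.reg_r
  reg_l := (hr _ (by norm_num)).trans h.reg_l
  lens := by simpa only [hm] using h.lens

end

/-! ### Cursors moving over the block boundaries -/

/-- The cursor in the registers `c, c + 1, c + 2` (the number of a boundary, its position, and the
number of characters other than `p` before it) proceeds to the next boundary. -/
def advance (p c : ℕ) : Prog := .block [
  .cond (.lt (var c) (var rR)) (.block [
    .assign (c + 3) ((load (cell (var c / var rQ) 5) >>>
      (var c % var rQ * var rF)) % var rM),
    .cond (.eq (read (var (c + 1))) (lit p)) .skip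
      (.assign (c + 2) (var (c + 2) + var (c + 3))),
    .assign (c + 1) (var (c + 1) + var (c + 3))]) .skip,
  .assign c (var c + lit 1)]

variable {w S : ℕ} {I : List ℕ} {t f q L R N : ℕ} {P : ℕ → ℕ}

theorem Setting.ok_cell (d : Setting w S I t f q L R N P) {σ : State} (k : Expr) (c : ℕ)
    (hc : c < 8) (hk : k.Ok w S I σ) (h : k.val I σ < N) :
    (cell k c).Ok w S I σ ∧ (cell k c).val I σ < S := by
  have h1 := d.small
  have h2 := d.space
  have h3 := d.S_le
  refine ⟨WordRAM.ok_cell _ _ _ _ _ _ hc hk (by omega) (by omega), ?_⟩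
  simp only [val_cell]
  omega

/-- Only block lengths are stored, so position and count are updated incrementally, the input
telling the character of the block. Since `P` is constant from `R` on, the step from `R` to `R + 1`
changes just the number; `R + 1` serves as the stop value of loops over all boundaries. -/
theorem triple_advance_eq (d : Setting w S I t f q L R N P) {p c j : ℕ} (hp : p ≤ 1) (hc : 9 ≤ c)
    (hc' : c ≤ 20) {σ : State} (hσ : Ready I t f q L R P σ) (hj : j ≤ R) (h0 : σ.reg c = j)
    (h1 : σ.reg (c + 1) = P j) (h2 : σ.reg (c + 2) = others I p (P j)) :
    Triple w S I (advance p c) σ fun u τ => u ≤ 60 ∧ ∃ v,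
      τ = (((σ.setReg (c + 3) v).setReg (c + 2) (others I p (P (j + 1)))).setReg (c + 1)
        (P (j + 1))).setReg c (j + 1) := by
  have hI := d.proper
  have hw := hI.1
  have hsmall := d.small
  have hR := d.R_lt
  have hlen := d.cuts.le_length hj
  refine Triple.seq (Triple.cond hI (by simp; omega) (fun hlt => ?_) fun hlt => ?_)
  · simp only [Expr.val_lt, Expr.val_var, h0, hσ.reg_r, ne_eq, ite_eq_right_iff, one_ne_zero,
      imp_false, not_not] at hlt
    have hjq : j / q ≤ R / q := Nat.div_le_div_right hj
    have hrec := d.rec_lt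
    have hmod := Nat.mod_lt j d.q_pos
    have hmul : j % q * f < 2 ^ w :=
      lt_of_le_of_lt (Nat.mul_le_mul_right f hmod.le) d.shift_lt
    have hPlt : P j < P (j + 1) := d.lt_succ j hlt
    have hlen1 : P (j + 1) ≤ I.length := d.cuts.le_length hlt
    have hl := d.len_lt j hlt
    have ho := others_le I p (P (j + 1))
    have hol := hσ.lens j hlt
    unfold packed at hol
    have heq := d.cuts.others_eq p hlt hPlt.le le_rfl
    refine Triple.seq (Triple.assign hI ?_ ?_)
    · simp only [Expr.ok_mod, Expr.ok_shr, Expr.ok_load, Expr.ok_mul, Expr.ok_var,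
        Expr.val_var, Expr.val_mod, h0, hσ.reg_q, hσ.reg_f]
      exact ⟨⟨d.ok_cell _ _ (by norm_num) (by simp; omega) (by simp [h0, hσ.reg_q]; omega),
        ⟨by omega, by omega⟩, by omega, hmul⟩, by omega⟩
    · have hv : Expr.val I σ ((load (cell (var c / var rQ) 5) >>>
          (var c % var rQ * var rF)) % var rM) = P (j + 1) - P j := by
        simp [h0, hσ.reg_q, hσ.reg_f, hσ.reg_m, hol]
      rw [hv]
      have hP : P j + (P (j + 1) - P j) = P (j + 1) := by omega
      refine Triple.seq (Triple.cond hI (by simp [h1]; omega) (fun hc => ?_) fun hc => ?_)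
      · simp [h1] at hc
        rw [if_pos hc, add_zero] at heq
        refine Triple.skip (Triple.assign hI (by simp [h1]; omega) ?_)
        refine Triple.assign hI (by simp [h0]; omega) ⟨by simp, P (j + 1) - P j, ?_⟩
        rw [heq, ← h2]
        simp only [State.setReg, State.mk.injEq, and_true]
        ext r
        by_cases hr : r = c + 2 <;> simp [Function.update_apply, h0, h1, hP, hr]
      · simp [h1] at hc
        rw [if_neg hc] at heq
        refine Triple.assign hI (by simp [h2]; omega) ?_
        refine Triple.assign hI (by simp [h1]; omega) ?_
        refine Triple.assign hI (by simp [h0]; omega) ⟨by simp, P (j + 1) - P j, ?_⟩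
        rw [heq, ← h2]
        simp [State.setReg, h0, h1, hP]
  · simp only [Expr.val_lt, Expr.val_var, h0, hσ.reg_r, ite_eq_right_iff, one_ne_zero,
      imp_false, not_lt] at hlt
    obtain rfl : j = R := le_antisymm hj hlt
    refine Triple.skip (Triple.assign hI (by simp [h0]; omega) ⟨by simp, σ.reg (c + 3), ?_⟩)
    rw [d.beyond (j + 1) (by omega), ← d.beyond j le_rfl, ← h2, ← h1]
    simp [State.setReg_self, h0]
/-- The cursor in the registers `c, c + 1, c + 2` is at the boundary `j`. -/
structure Cursor (I : List ℕ) (p : ℕ) (P : ℕ → ℕ) (c j : ℕ) (σ : State) : Prop where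
  num : σ.reg c = j
  pos : σ.reg (c + 1) = P j
  oth : σ.reg (c + 2) = others I p (P j)

theorem Cursor.frame {p c j : ℕ} {σ τ : State} (h : Cursor I p P c j σ)
    (hr : ∀ r, c ≤ r → r < c + 3 → τ.reg r = σ.reg r) : Cursor I p P c j τ :=
  ⟨by rw [hr _ (by omega) (by omega)]; exact h.num,
    by rw [hr _ (by omega) (by omega)]; exact h.pos,
    by rw [hr _ (by omega) (by omega)]; exact h.oth⟩

theorem triple_advance (d : Setting w S I t f q L R N P) {p c j : ℕ} (hp : p ≤ 1) (hc : 9 ≤ c)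
    (hc' : c ≤ 20) {σ : State} (hσ : Ready I t f q L R P σ) (hj : j ≤ R)
    (h : Cursor I p P c j σ) :
    Triple w S I (advance p c) σ fun u τ => u ≤ 60 ∧ Cursor I p P c (j + 1) τ ∧ τ.mem = σ.mem ∧
      ∀ r, r < c ∨ c + 4 ≤ r → τ.reg r = σ.reg r := by
  refine (triple_advance_eq d hp hc hc' hσ hj h.num h.pos h.oth).mono ?_
  rintro u τ ⟨hu, v, rfl⟩
  refine ⟨hu, ⟨by simp, by simp, by simp⟩, rfl, fun r hr => ?_⟩
  simp only [State.setReg_reg]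
  rw [if_neg (by omega), if_neg (by omega), if_neg (by omega), if_neg (by omega)]

/-- The product of two comparison bits is their conjunction and cannot overflow. -/
theorem ok_lt_mul_lt (hw : 0 < w) {σ : State} {a b c d : Expr} :
    (a.lt b * c.lt d).Ok w S I σ ↔
      (a.Ok w S I σ ∧ b.Ok w S I σ) ∧ c.Ok w S I σ ∧ d.Ok w S I σ := by
  have := Nat.one_lt_two_pow hw.ne'
  rw [Expr.ok_mul, Expr.ok_lt, Expr.ok_lt, Expr.val_lt, Expr.val_lt, ← and_assoc]
  refine and_iff_left ?_
  split_ifs <;> omega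

theorem val_lt_mul_lt {σ : State} {a b c d : Expr} :
    (a.lt b * c.lt d).val I σ = 0 ↔
      ¬(a.val I σ < b.val I σ ∧ c.val I σ < d.val I σ) := by
  rw [Expr.val_mul, Expr.val_lt, Expr.val_lt]
  split_ifs <;> simp <;> omega

/-- Move the cursor `rA` until at least `z0` characters other than `p` are between it and the
cursor `rI`. -/
def seek (p : ℕ) : Prog :=
  .whileDo (.lt (var rA) (var rR) * .lt (var (rA + 2) - var (rI + 2)) (var rZ)) (advance p rA)

/-- The cost is charged to the movement of the cursor, so that repeated seeks that never move back
are cheap in total. If the cursor stops at `R`, the count there may still be below `z0`. -/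
theorem triple_seek (d : Setting w S I t f q L R N P) {p i z0 lo : ℕ} (hp : p ≤ 1) {σ : State}
    (hσ : Ready I t f q L R P σ) (hi : Cursor I p P rI i σ) (hz : σ.reg rZ = z0)
    (hlo : Cursor I p P rA lo σ) (hloR : lo ≤ R)
    (hbelow : ∀ k < lo, others I p (P k) - others I p (P i) < z0) :
    Triple w S I (seek p) σ fun u τ => τ.mem = σ.mem ∧ (∀ r < 16, τ.reg r = σ.reg r) ∧
      ∃ lo', lo ≤ lo' ∧ lo' ≤ R ∧ u + 100 * lo ≤ 100 * lo' + 20 ∧ Cursor I p P rA lo' τ ∧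
      (∀ k < lo', others I p (P k) - others I p (P i) < z0) ∧
      (lo' < R → z0 ≤ others I p (P lo') - others I p (P i)) := by
  have hI := d.proper
  have hw := hI.1
  refine Triple.whileDo hI (fun u τ => τ.mem = σ.mem ∧ (∀ r < 16, τ.reg r = σ.reg r) ∧
      ∃ lo', lo ≤ lo' ∧ lo' ≤ R ∧ u + 100 * lo ≤ 100 * lo' ∧ Cursor I p P rA lo' τ ∧
      (∀ k < lo', others I p (P k) - others I p (P i) < z0)) (100 * R)
    ⟨rfl, fun _ _ => rfl, lo, le_rfl, hloR, by omega, hlo, hbelow⟩ ?_ ?_ ?_ ?_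
  · rintro u τ ⟨-, -, lo', h1, h2, h3, -⟩
    omega
  · rintro u τ -
    rw [ok_lt_mul_lt hw]
    simp
  · rintro u τ ⟨hm, hf, lo', h1, h2, h3, h4, h5⟩ hv
    have hr : Ready I t f q L R P τ := hσ.frame (fun r hr => hf r (by omega)) (by simp [hm])
    have e1 := h4.num
    have e2 := h4.oth
    have e3 := hf (rI + 2) (by norm_num)
    have e4 := hi.oth
    have e5 := hf rZ (by norm_num)
    norm_num at e2 e3 e4
    rw [Ne, val_lt_mul_lt, not_not] at hv
    simp [e1, e2, e3, e4, e5, hr.reg_r, hz] at hv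
    refine (triple_advance d hp (by norm_num) (by norm_num) hr h2 h4).mono ?_
    rintro v υ ⟨k1, k2, k3, k4⟩
    refine ⟨k3.trans hm, fun r hr => (k4 r (by omega)).trans (hf r hr), lo' + 1, by omega, by omega,
      by simp; omega, k2, fun k hk => ?_⟩
    rcases Nat.lt_succ_iff_lt_or_eq.mp hk with hk | rfl
    · exact h5 k hk
    · exact hv.2
  · rintro u τ ⟨hm, hf, lo', h1, h2, h3, h4, h5⟩ hv
    have hr : Ready I t f q L R P τ := hσ.frame (fun r hr => hf r (by omega)) (by simp [hm])
    have e1 := h4.num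
    have e2 := h4.oth
    have e3 := hf (rI + 2) (by norm_num)
    have e4 := hi.oth
    have e5 := hf rZ (by norm_num)
    norm_num at e2 e3 e4
    rw [val_lt_mul_lt] at hv
    simp [e1, e2, e3, e4, e5, hr.reg_r, hz] at hv
    exact ⟨hm, hf, lo', h1, h2, by simp; omega, h4, h5, by omega⟩

/-! ### Filling the table for one range of `z` -/

/-- The windows from the boundary `i` to boundaries before `j` are accounted for in the table of
the windows with at least `z0` and less than `z0 + L` characters other than `p`. -/
def Covered (I : List ℕ) (L R : ℕ) (P : ℕ → ℕ) (p z0 i j : ℕ) (σ : State) : Prop :=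
  ∀ k < j, k ≤ R → z0 ≤ others I p (P k) - others I p (P i) →
    others I p (P k) - others I p (P i) < z0 + L →
    (P k - P i) - (others I p (P k) - others I p (P i)) ≤
      σ.mem (8 * (others I p (P k) - others I p (P i) - z0) + 6)

/-- Account in the table for the window between the cursors `rI` and `rJ`. -/
def note : Prog :=
  .cond (.lt (load (cell (var (rJ + 2) - var (rI + 2) - var rZ) 6))
      ((var (rJ + 1) - var (rI + 1)) - (var (rJ + 2) - var (rI + 2))))
    (.put (cell (var (rJ + 2) - var (rI + 2) - var rZ) 6)
      ((var (rJ + 1) - var (rI + 1)) - (var (rJ + 2) - var (rI + 2)))) .skip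

/-- The table changes from that of `σ` to that of `τ` in an admissible way. -/
structure TabStep (I : List ℕ) (L p z0 : ℕ) (σ τ : State) : Prop where
  off : ∀ a, a % 8 ≠ 6 → τ.mem a = σ.mem a
  grow : ∀ k, σ.mem (8 * k + 6) ≤ τ.mem (8 * k + 6)
  sound : ∀ k < L, τ.mem (8 * k + 6) ≤ maxOcc I p (z0 + k)

theorem TabStep.trans {p z0 : ℕ} {σ τ υ : State} (h : TabStep I L p z0 σ τ)
    (h' : TabStep I L p z0 τ υ) : TabStep I L p z0 σ υ :=
  ⟨fun a ha => (h'.off a ha).trans (h.off a ha), fun k => (h.grow k).trans (h'.grow k), h'.sound⟩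

theorem TabStep.of_mem_eq {p z0 : ℕ} {σ τ υ : State} (h : TabStep I L p z0 σ τ)
    (h' : υ.mem = τ.mem) : TabStep I L p z0 σ υ :=
  ⟨by simpa [h'] using h.off, by simpa [h'] using h.grow, by simpa [h'] using h.sound⟩

theorem Covered.grow {p z0 i j : ℕ} {σ τ : State} (h : Covered I L R P p z0 i j σ)
    (hg : ∀ k, σ.mem (8 * k + 6) ≤ τ.mem (8 * k + 6)) : Covered I L R P p z0 i j τ :=
  fun k h1 h2 h3 h4 => (h k h1 h2 h3 h4).trans (hg _)

theorem triple_note (d : Setting w S I t f q L R N P) {p z0 i j : ℕ} {σ : State}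
    (hz : σ.reg rZ = z0) (hiR : i ≤ R) (hjR : j ≤ R) (hi : Cursor I p P rI i σ)
    (hj : Cursor I p P rJ j σ) (hlt : others I p (P j) - others I p (P i) < z0 + L)
    (hs : ∀ k < L, σ.mem (8 * k + 6) ≤ maxOcc I p (z0 + k)) :
    Triple w S I note σ fun u τ => u ≤ 60 ∧ τ.reg = σ.reg ∧ TabStep I L p z0 σ τ ∧
      (P j - P i) - (others I p (P j) - others I p (P i)) ≤
        τ.mem (8 * (others I p (P j) - others I p (P i) - z0) + 6) := by
  have hI := d.proper
  have hL := d.L_pos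
  have hLN := d.tab_le
  have ei := hi.oth
  have ej := hj.oth
  have pi := hi.pos
  have pj := hj.pos
  norm_num at ei ej pi pj
  have hidx : (var (rJ + 2) - var (rI + 2) - var rZ).val I σ =
      others I p (P j) - others I p (P i) - z0 := by simp [ei, ej, hz]
  have hval : ((var (rJ + 1) - var (rI + 1)) - (var (rJ + 2) - var (rI + 2))).val I σ =
      (P j - P i) - (others I p (P j) - others I p (P i)) := by simp [ei, ej, pi, pj]
  have hcell := d.ok_cell (var (rJ + 2) - var (rI + 2) - var rZ) 6 (by norm_num) (σ := σ)
    (by simp) (by rw [hidx]; omega)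
  refine Triple.cond hI ⟨hcell, by simp, trivial⟩ (fun hv => ?_) fun hv => ?_
  · refine Triple.put hI hcell.1 (by simp) hcell.2 ⟨by simp, rfl, ⟨fun a ha => ?_, fun k => ?_,
      fun k hk => ?_⟩, ?_⟩
    · rw [State.setMem_mem, val_cell, if_neg (by omega)]
    · rw [Expr.val_lt, Expr.val_load, val_cell, hidx, hval] at hv
      rw [State.setMem_mem, val_cell, hidx, hval]
      split_ifs with h
      · simp at hv
        rw [h]
        omega
      · exact le_rfl
    · rw [State.setMem_mem, val_cell, hidx, hval]
      split_ifs with h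
      · exact le_maxOcc (d.cuts.le_length hiR) (d.cuts.le_length hjR) (by omega)
      · exact hs k hk
    · rw [State.setMem_mem, val_cell, hidx, hval, if_pos rfl]
  · rw [Expr.val_lt, Expr.val_load, val_cell, hidx, hval] at hv
    refine Triple.skip ⟨by simp, rfl, ⟨fun _ _ => rfl, fun _ => le_rfl, hs⟩, ?_⟩
    simpa using hv

/-- Account in the table for the windows between the cursor `rI` and the boundaries from the cursor
`rJ` on. -/
def scan (p : ℕ) : Prog :=
  .whileDo (.lt (var rJ) (var rR + lit 1) *
      .lt (var (rJ + 2) - var (rI + 2)) (var rZ + var rL))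
    (.seq note (advance p rJ))

/-- The number of other characters is monotone in the right boundary: once it reaches `z0 + L` no
later boundary belongs to the range, so stopping there still covers all boundaries up to `R`. The
cost is proportional to the distance travelled. -/
theorem triple_scan (d : Setting w S I t f q L R N P) {p z0 i lo : ℕ} (hp : p ≤ 1) {σ : State}
    (hσ : Ready I t f q L R P σ) (hz : σ.reg rZ = z0) (hzn : z0 ≤ I.length) (hiR : i ≤ R)
    (hloR : lo ≤ R) (hi : Cursor I p P rI i σ) (hj : Cursor I p P rJ lo σ)
    (hs : ∀ k < L, σ.mem (8 * k + 6) ≤ maxOcc I p (z0 + k))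
    (hbelow : ∀ k < lo, others I p (P k) - others I p (P i) < z0) :
    Triple w S I (scan p) σ fun u τ => (∀ r < 20, τ.reg r = σ.reg r) ∧ TabStep I L p z0 σ τ ∧
      Covered I L R P p z0 i (R + 1) τ ∧
      ∃ j, lo ≤ j ∧ j ≤ R + 1 ∧ u + 200 * lo ≤ 200 * j + 20 ∧
      ∀ k < j, others I p (P k) - others I p (P i) < z0 + L := by
  have hI := d.proper
  have hw := hI.1
  have hn := d.small
  have hL := d.L_le
  have hL0 := d.L_pos
  have hR := d.R_lt
  have hval : ∀ τ : State, (∀ r < 20, τ.reg r = σ.reg r) → TabStep I L p z0 σ τ →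
      Ready I t f q L R P τ ∧ Cursor I p P rI i τ ∧ τ.reg rZ = z0 :=
    fun τ h1 h2 => ⟨hσ.frame (fun r hr => h1 r (by omega)) fun k => h2.off _ (by omega),
      hi.frame fun r _ hr => h1 r (by omega), (h1 _ (by norm_num)).trans hz⟩
  refine Triple.whileDo hI (fun u τ => (∀ r < 20, τ.reg r = σ.reg r) ∧ TabStep I L p z0 σ τ ∧
      ∃ j, lo ≤ j ∧ j ≤ R + 1 ∧ u + 200 * lo ≤ 200 * j ∧ Cursor I p P rJ j τ ∧
      Covered I L R P p z0 i j τ ∧ ∀ k < j, others I p (P k) - others I p (P i) < z0 + L)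
    (200 * (R + 1)) ⟨fun _ _ => rfl, ⟨fun _ _ => rfl, fun _ => le_rfl, hs⟩, lo, le_rfl, by omega,
      by omega, hj, fun k h1 h2 h3 => absurd (hbelow k h1) (by omega),
      fun k hk => by have := hbelow k hk; omega⟩ ?_ ?_ ?_ ?_
  · rintro u τ ⟨-, -, j, h1, h2, h3, -⟩
    omega
  · rintro u τ ⟨h1, h2, -⟩
    obtain ⟨hr, -, hz'⟩ := hval τ h1 h2
    rw [ok_lt_mul_lt hw]
    simp [hr.reg_r, hr.reg_l, hz']
    omega
  · rintro u τ ⟨h1, h2, j, h3, h4, h5, h6, h7, h8⟩ hv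
    obtain ⟨hr, hi', hz'⟩ := hval τ h1 h2
    have e1 := h6.num
    have e2 := h6.oth
    have e3 := hi'.oth
    norm_num at e2 e3
    rw [Ne, val_lt_mul_lt, not_not] at hv
    simp [e1, e2, e3, hr.reg_r, hr.reg_l, hz'] at hv
    refine Triple.seq ((triple_note d hz' hiR (by omega) hi' h6 hv.2 h2.sound).mono ?_)
    rintro v υ ⟨k1, k2, k3, k4⟩
    refine (triple_advance d hp (by norm_num) (by norm_num)
      (hr.frame (fun r _ => by rw [k2]) fun k => k3.off _ (by omega)) (by omega : j ≤ R)
      (h6.frame fun r _ _ => by rw [k2])).mono ?_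
    rintro v' υ' ⟨l1, l2, l3, l4⟩
    refine ⟨fun r hr => by rw [l4 r (by omega), k2, h1 r hr], (h2.trans k3).of_mem_eq l3, j + 1,
      by omega, by omega, by simp; omega, l2, fun k m1 m2 m3 m4 => ?_, fun k hk => ?_⟩
    · rw [l3]
      rcases Nat.lt_succ_iff_lt_or_eq.mp m1 with hk | rfl
      · exact (h7.grow k3.grow) k hk m2 m3 m4
      · exact k4
    · rcases Nat.lt_succ_iff_lt_or_eq.mp hk with hk | rfl
      · exact h8 k hk
      · exact hv.2
  · rintro u τ ⟨h1, h2, j, h3, h4, h5, h6, h7, h8⟩ hv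
    obtain ⟨hr, hi', hz'⟩ := hval τ h1 h2
    have e1 := h6.num
    have e2 := h6.oth
    have e3 := hi'.oth
    norm_num at e2 e3
    rw [val_lt_mul_lt] at hv
    simp [e1, e2, e3, hr.reg_r, hr.reg_l, hz'] at hv
    refine ⟨h1, h2, fun k m1 m2 m3 m4 => ?_, j, h3, h4, by simp; omega, h8⟩
    by_cases hk : k < j
    · exact h7 k hk m2 m3 m4
    · have := hv (by omega)
      have := others_mono I p (d.cuts.mono (not_lt.mp hk))
      omega

end WordRAM

namespace WordRAM
variable {w S : ℕ} {I : List ℕ} {t f q L R N : ℕ} {P : ℕ → ℕ}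

/-- Set a cursor to the first boundary. -/
def rewind (c : ℕ) : Prog :=
  .seq (.assign c (lit 0)) (.seq (.assign (c + 1) (lit 0)) (.assign (c + 2) (lit 0)))

theorem triple_rewind (hI : Proper w I) (h : Cuts I R P) (p : ℕ) {c : ℕ} {σ : State} :
    Triple w S I (rewind c) σ fun u τ => u ≤ 6 ∧ Cursor I p P c 0 τ ∧ τ.mem = σ.mem ∧
      ∀ r, r < c ∨ c + 3 ≤ r → τ.reg r = σ.reg r := by
  refine Triple.seq (Triple.assign hI (by simp) ?_)
  refine Triple.seq (Triple.assign hI (by simp) ?_)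
  refine Triple.assign hI (by simp) ⟨by simp, ⟨by simp, by simp [h.zero],
    by simp [h.zero, others_zero]⟩, rfl, fun r hr => ?_⟩
  simp only [State.setReg_reg]
  rw [if_neg (by omega), if_neg (by omega), if_neg (by omega)]

/-- Set the cursor `rJ` to the cursor `rA`. -/
def copyCursor : Prog :=
  .seq (.assign rJ (var rA)) (.seq (.assign (rJ + 1) (var (rA + 1)))
    (.assign (rJ + 2) (var (rA + 2))))

theorem triple_copyCursor (hI : Proper w I) {p j : ℕ} {σ : State} (h : Cursor I p P rA j σ) :
    Triple w S I copyCursor σ fun u τ => u ≤ 6 ∧ Cursor I p P rJ j τ ∧ τ.mem = σ.mem ∧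
      ∀ r < 20, τ.reg r = σ.reg r := by
  have e1 := h.num
  have e2 := h.pos
  have e3 := h.oth
  norm_num at e2 e3
  refine Triple.seq (Triple.assign hI (by simp) ?_)
  refine Triple.seq (Triple.assign hI (by simp) ?_)
  refine Triple.assign hI (by simp) ⟨by simp, ⟨by simp [e1], by simp [e2],
    by simp [e3]⟩, rfl, fun r hr => ?_⟩
  simp only [State.setReg_reg]
  rw [if_neg (by omega), if_neg (by omega), if_neg (by omega)]

/-- Account in the table for all windows between boundaries. -/
def rows (p : ℕ) : Prog :=
  .seq (rewind rI) (.seq (rewind rA) (.whileDo (.lt (var rI) (var rR + lit 1))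
    (.seq (seek p) (.seq copyCursor (.seq (scan p) (advance p rI))))))

/-- The number of boundaries with less than `z` characters other than `p` between the boundary `i`
and them. -/
def below (I : List ℕ) (R : ℕ) (P : ℕ → ℕ) (p z i : ℕ) : ℕ :=
  ((Finset.range (R + 1)).filter fun k => others I p (P k) - others I p (P i) < z).card

theorem below_le (p z i : ℕ) : below I R P p z i ≤ R + 1 :=
  (Finset.card_filter_le _ _).trans (by simp)

/-- With `below_le_of`, this turns cursor positions into the counts `below`. These depend only on
the input and the threshold, so the costs of consecutive ranges telescope. -/
theorem le_below {p z i j : ℕ} (hj : j ≤ R + 1)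
    (h : ∀ k < j, others I p (P k) - others I p (P i) < z) : j ≤ below I R P p z i := by
  unfold below
  calc j = (Finset.range j).card := by simp
    _ ≤ _ := Finset.card_le_card fun k hk => by
      rw [Finset.mem_range] at hk
      rw [Finset.mem_filter, Finset.mem_range]
      exact ⟨by omega, h k hk⟩

theorem below_le_of {p z i j : ℕ}
    (h : ∀ k ≤ R, others I p (P k) - others I p (P i) < z → k < j) : below I R P p z i ≤ j := by
  unfold below
  calc _ ≤ (Finset.range j).card := Finset.card_le_card fun k hk => by
        rw [Finset.mem_filter, Finset.mem_range] at hk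
        rw [Finset.mem_range]
        exact h k (by omega) hk.2
    _ = j := by simp

/-- The scan for `i` costs about `below (z0 + L) i - below z0 i`, up to a constant factor and an
additive constant. All seeks together cost `O(R)`, because the cursor `rA` keeps its place from one
`i` to the next. The subtracted sum is moved to the left side to avoid truncated subtraction. -/
theorem triple_rows (d : Setting w S I t f q L R N P) {p z0 : ℕ} (hp : p ≤ 1) {σ : State}
    (hσ : Ready I t f q L R P σ) (hz : σ.reg rZ = z0) (hzn : z0 ≤ I.length)
    (hs : ∀ k < L, σ.mem (8 * k + 6) ≤ maxOcc I p (z0 + k)) :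
    Triple w S I (rows p) σ fun u τ => (∀ r < 12, τ.reg r = σ.reg r) ∧ TabStep I L p z0 σ τ ∧
      (∀ i ≤ R, Covered I L R P p z0 i (R + 1) τ) ∧
      u + 200 * ∑ i ∈ Finset.range (R + 1), below I R P p z0 i ≤
        200 * (∑ i ∈ Finset.range (R + 1), below I R P p (z0 + L) i) + 500 * (R + 1) := by
  have hI := d.proper
  have hw := hI.1
  have hn := d.small
  have hR := d.R_lt
  refine Triple.seq ((triple_rewind hI d.cuts p).mono ?_)
  rintro u1 σ1 ⟨a1, a2, a3, a4⟩
  refine Triple.seq ((triple_rewind hI d.cuts p).mono ?_)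
  rintro u2 σ2 ⟨b1, b2, b3, b4⟩
  have hf : ∀ r < 12, σ2.reg r = σ.reg r := fun r hr => by rw [b4 r (by omega), a4 r (by omega)]
  have hm : σ2.mem = σ.mem := b3.trans a3
  have hval : ∀ τ : State, (∀ r < 12, τ.reg r = σ.reg r) → TabStep I L p z0 σ τ →
      Ready I t f q L R P τ ∧ τ.reg rZ = z0 :=
    fun τ h1 h2 => ⟨hσ.frame (fun r hr => h1 r (by omega)) fun k => h2.off _ (by omega),
      (h1 _ (by norm_num)).trans hz⟩
  refine Triple.whileDo hI (fun u τ => (∀ r < 12, τ.reg r = σ.reg r) ∧ TabStep I L p z0 σ τ ∧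
      ∃ i lo, i ≤ R + 1 ∧ lo ≤ R ∧ Cursor I p P rI i τ ∧ Cursor I p P rA lo τ ∧
      (∀ k < lo, others I p (P k) - others I p (P i) < z0) ∧
      (∀ i' < i, Covered I L R P p z0 i' (R + 1) τ) ∧
      u + 200 * ∑ i' ∈ Finset.range i, below I R P p z0 i' ≤
        200 * (∑ i' ∈ Finset.range i, below I R P p (z0 + L) i') + 350 * i + 100 * lo)
    (200 * ((R + 1) * (R + 1)) + 350 * (R + 1) + 100 * R)
    ⟨hf, ⟨fun _ _ => by rw [hm], fun _ => by rw [hm], by simpa [hm] using hs⟩, 0, 0, by omega,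
      by omega, a2.frame fun r h1 h2 => b4 r (by omega), b2, by simp, by simp, by simp⟩ ?_ ?_ ?_ ?_
  · rintro u τ ⟨-, -, i, lo, h1, h2, -, -, -, -, h3⟩
    have : ∑ i' ∈ Finset.range i, below I R P p (z0 + L) i' ≤ i * (R + 1) := by
      calc _ ≤ ∑ i' ∈ Finset.range i, (R + 1) := Finset.sum_le_sum fun _ _ => below_le ..
        _ = _ := by simp
    have : i * (R + 1) ≤ (R + 1) * (R + 1) := Nat.mul_le_mul_right _ h1
    omega
  · rintro u τ ⟨h1, h2, -⟩
    obtain ⟨hr, -⟩ := hval τ h1 h2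
    simp [hr.reg_r]
    omega
  · rintro u τ ⟨h1, h2, i, lo, h3, h4, h5, h6, h7, h8, h9⟩ hv
    obtain ⟨hr, hz'⟩ := hval τ h1 h2
    have e1 := h5.num
    simp [e1, hr.reg_r] at hv
    refine Triple.seq ((triple_seek d hp hr h5 hz' h6 h4 h7).mono ?_)
    rintro v1 τ1 ⟨k1, k2, lo', k3, k4, k5, k6, k7, k8⟩
    refine Triple.seq ((triple_copyCursor hI k6).mono ?_)
    rintro v2 τ2 ⟨l1, l2, l3, l4⟩
    have hr2 : Ready I t f q L R P τ2 :=
      hr.frame (fun r hr => by rw [l4 r (by omega), k2 r (by omega)]) (by simp [l3, k1])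
    have h52 : Cursor I p P rI i τ2 :=
      h5.frame fun r _ hr => by rw [l4 r (by omega), k2 r (by omega)]
    refine Triple.seq ((triple_scan d hp hr2
      (by rw [l4 _ (by norm_num), k2 _ (by norm_num), hz']) hzn hv k4 h52 l2
      (by simpa [l3, k1] using h2.sound) k7).mono ?_)
    rintro v3 τ3 ⟨m1, m2, m3, j, m4, m5, m6, m7⟩
    have hr3 : Ready I t f q L R P τ3 :=
      hr2.frame (fun r hr => m1 r (by omega)) fun k => m2.off _ (by omega)
    refine (triple_advance d hp (by norm_num) (by norm_num) hr3 hv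
      (h52.frame fun r _ hr => m1 r (by omega))).mono ?_
    rintro v4 τ4 ⟨n1, n2, n3, n4⟩
    have hb1 := le_below m5 m7
    -- The `+ 1` is for `lo' = R`, where the boundary `R` itself may have fewer than `z0` other
    -- characters.
    have hb2 : below I R P p z0 i ≤ lo' + 1 := below_le_of fun k hk hlt => by
      by_contra hc
      have := k8 (by omega)
      have := others_mono I p (d.cuts.mono (show lo' ≤ k by omega))
      omega
    have hstep : TabStep I L p z0 τ τ3 :=
      ⟨fun a ha => by rw [m2.off a ha, l3, k1], fun k => by
        have := m2.grow k
        rwa [l3, k1] at this, m2.sound⟩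
    refine ⟨fun r hr => by rw [n4 r (by omega), m1 r (by omega), l4 r (by omega), k2 r (by omega),
      h1 r hr], (h2.trans hstep).of_mem_eq n3, i + 1, lo', by omega, k4, n2, ?_, ?_, ?_, ?_⟩
    · refine k6.frame fun r hr hr' => ?_
      rw [n4 r (by omega), m1 r (by omega), l4 r (by omega)]
    -- Moving the left boundary right can only decrease the number of other characters, so `lo'`
    -- remains a valid start for `i + 1`.
    · intro k hk
      have := k7 k hk
      have := others_mono I p (d.cuts.mono (Nat.le_add_right i 1))
      omega
    · intro i' hi'
      have : Covered I L R P p z0 i' (R + 1) τ3 := by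
        rcases Nat.lt_succ_iff_lt_or_eq.mp hi' with hi' | rfl
        · exact (h8 i' hi').grow hstep.grow
        · exact m3
      exact this.grow fun k => by rw [n3]
    · rw [Finset.sum_range_succ, Finset.sum_range_succ]
      simp
      omega
  · rintro u τ ⟨h1, h2, i, lo, h3, h4, h5, h6, h7, h8, h9⟩ hv
    obtain ⟨hr, hz'⟩ := hval τ h1 h2
    have e1 := h5.num
    simp [e1, hr.reg_r] at hv
    obtain rfl : i = R + 1 := by omega
    refine ⟨h1, h2, fun i' hi' => h8 i' (by omega), ?_⟩
    simp
    omega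

/-- Set the table to zero. -/
def clearTable : Prog :=
  .seq (.assign rY (lit 0)) (.whileDo (.lt (var rY) (var rL))
    (.seq (.put (cell (var rY) 6) (lit 0)) (.assign rY (var rY + lit 1))))

theorem triple_clearTable (d : Setting w S I t f q L R N P) {σ : State}
    (hσ : Ready I t f q L R P σ) :
    Triple w S I clearTable σ fun u τ => (∀ r < 24, τ.reg r = σ.reg r) ∧
      (∀ a, a % 8 ≠ 6 → τ.mem a = σ.mem a) ∧ (∀ k < L, τ.mem (8 * k + 6) = 0) ∧
      u ≤ 30 * L + 20 := by
  have hI := d.proper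
  have hw := hI.1
  have hn := d.small
  have hL := d.L_le
  have hLN := d.tab_le
  refine Triple.seq (Triple.assign hI (by simp) ?_)
  refine Triple.whileDo hI (fun u τ => (∀ r < 24, τ.reg r = σ.reg r) ∧
      (∀ a, a % 8 ≠ 6 → τ.mem a = σ.mem a) ∧ ∃ k, k ≤ L ∧ τ.reg rY = k ∧ u ≤ 30 * k ∧
      (∀ k' < k, τ.mem (8 * k' + 6) = 0)) (30 * L)
    ⟨fun r hr => by rw [State.setReg_reg, if_neg (by omega)], fun _ _ => rfl, 0, by omega,
      by simp, by simp, by simp⟩ ?_ ?_ ?_ ?_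
  · rintro u τ ⟨-, -, k, h1, h2, h3, -⟩
    omega
  · rintro u τ -
    simp
  · rintro u τ ⟨h1, h2, k, h3, h4, h5, h6⟩ hv
    have hr : Ready I t f q L R P τ :=
      hσ.frame (fun r hr => h1 r (by omega)) fun k => h2 _ (by omega)
    simp [h4, hr.reg_l] at hv
    have hcell := d.ok_cell (var rY) 6 (by norm_num) (σ := τ) (by simp) (by simp [h4]; omega)
    refine Triple.seq (Triple.put hI hcell.1 (by simp) hcell.2 ?_)
    refine Triple.assign hI (by simp [h4]; omega) ⟨fun r hr => ?_, fun a ha => ?_, k + 1, hv, ?_,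
      ?_, fun k' hk' => ?_⟩
    · rw [State.setReg_reg, if_neg (by omega), State.setMem_reg, h1 r hr]
    · rw [State.setReg_mem, State.setMem_mem, val_cell, if_neg (by omega), h2 a ha]
    · simp [h4]
    · simp
      omega
    · rw [State.setReg_mem, State.setMem_mem]
      simp only [val_cell, Expr.val_var, h4, Expr.val_lit]
      split_ifs with h
      · rfl
      · exact h6 k' (by omega)
  · rintro u τ ⟨h1, h2, k, h3, h4, h5, h6⟩ hv
    have hr : Ready I t f q L R P τ :=
      hσ.frame (fun r hr => h1 r (by omega)) fun k => h2 _ (by omega)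
    simp [h4, hr.reg_l] at hv
    obtain rfl : k = L := by omega
    exact ⟨h1, h2, h6, by simp; omega⟩

end WordRAM

/-! ### The bit string encoding `maxOcc` and its rank structure -/

namespace WordRAM
variable {w S : ℕ} {I : List ℕ} {t f q L R N : ℕ} {P : ℕ → ℕ}

/-- The number `r` of ones among the first `m` bits of the bit string that encodes `maxOcc I p`. -/
def RankSpec (I : List ℕ) (p m r : ℕ) : Prop :=
  r ≤ m ∧ r ≤ maxOcc I p (m - r) ∧ ∀ z < m - r, maxOcc I p z ≤ r

/-- Here `m - r` is the number of zeros among the first `m = a + b` bits. If `b ≤ r`, then `m - r ≤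
a` and monotonicity applies. If `r < b`, then `a < m - r`, so the value at `a` is at most `r`. -/
theorem RankSpec.le_iff {p a b r : ℕ} (h : RankSpec I p (a + b) r) : b ≤ r ↔ b ≤ maxOcc I p a := by
  obtain ⟨h1, h2, h3⟩ := h
  constructor
  · intro hb
    exact hb.trans (h2.trans (maxOcc_mono I p (by omega)))
  · intro hb
    by_contra hc
    have := h3 a (by omega)
    omega

/-- The rank structure for the characters `p` in a memory. -/
def RankMem (I : List ℕ) (t p m r : ℕ) (mem : ℕ → ℕ) : Prop :=
  RankInv t (RankSpec I p) (fun k => mem (8 * k + 2 * p)) (fun k => mem (8 * k + (2 * p + 1))) m r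

theorem RankMem.frame {p m r : ℕ} {mem mem' : ℕ → ℕ} (h : RankMem I t p m r mem)
    (h0 : ∀ k, mem' (8 * k + 2 * p) = mem (8 * k + 2 * p))
    (h1 : ∀ k, mem' (8 * k + (2 * p + 1)) = mem (8 * k + (2 * p + 1))) :
    RankMem I t p m r mem' := by
  unfold RankMem at h ⊢
  simpa only [h0, h1] using h

/-- Table entry `k` need only account for windows with exactly `z0 + k` other characters: those with
fewer are bounded by the earlier values. Hence no prefix maxima are formed in the table. -/
theorem _root_.Cuts.maxOcc_le_of_table (h : Cuts I R P) {p z0 k r : ℕ} {σ : State} (hk : k < L)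
    (hcov : ∀ i ≤ R, Covered I L R P p z0 i (R + 1) σ) (hr : ∀ z < z0 + k, maxOcc I p z ≤ r)
    (hT : σ.mem (8 * k + 6) ≤ r) : maxOcc I p (z0 + k) ≤ r := by
  refine h.maxOcc_le fun i hi j hj hz => ?_
  rcases hz.lt_or_eq with hlt | heq
  · exact (le_maxOcc (h.le_length hi) (h.le_length hj) le_rfl).trans (hr _ hlt)
  · have := hcov i hi j (by omega) hj (by omega) (by omega)
    rw [heq, Nat.add_sub_cancel_left] at this
    rw [heq]
    omega

/-- Write the bits of the rank structure that the table determines. -/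
def emit (p : ℕ) : Prog :=
  .seq (.assign rY (lit 0)) (.whileDo (.lt (var rY) (var rL)) (.block [
    .assign (rY + 1) (.lt (var rK) (load (cell (var rY) 6))),
    .put (cell (var rU / var rT) (2 * p + 1))
      (load (cell (var rU / var rT) (2 * p + 1)) + (var (rY + 1) <<< (var rU % var rT))),
    .assign rK (var rK + var (rY + 1)),
    .put (cell (var rU / var rT + lit 1) (2 * p)) (var rK),
    .assign rU (var rU + lit 1),
    .assign rY (var rY + (lit 1 - var (rY + 1)))]))

/-- The staircase is walked one bit per round: a one while the table entry exceeds the current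
value, otherwise a zero and the next entry. The clock is charged to the number of bits written, and
the number of ones never exceeds `I.length`. -/
theorem triple_emit (d : Setting w S I t f q L R N P) {p z0 m r : ℕ} (hp : p ≤ 1) {σ : State}
    (hσ : Ready I t f q L R P σ) (hzn : z0 ≤ I.length)
    (hs : ∀ k < L, σ.mem (8 * k + 6) ≤ maxOcc I p (z0 + k))
    (hcov : ∀ i ≤ R, Covered I L R P p z0 i (R + 1) σ)
    (hU : σ.reg rU = m) (hK : σ.reg rK = r) (hm : m = z0 + r) (hr : RankMem I t p m r σ.mem) :
    Triple w S I (emit p) σ fun u τ => (∀ r < 10, τ.reg r = σ.reg r) ∧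
      (∀ a, a % 8 ≠ 2 * p → a % 8 ≠ 2 * p + 1 → τ.mem a = σ.mem a) ∧
      ∃ m' r', τ.reg rU = m' ∧ τ.reg rK = r' ∧ m' = z0 + L + r' ∧ RankMem I t p m' r' τ.mem ∧
      u + 100 * m ≤ 100 * m' + 20 := by
  have hI := d.proper
  have hw := hI.1
  have hn := d.small
  have hL := d.L_le
  have hLN := d.tab_le
  have hout := d.out_lt
  have htw := d.two_pow_t
  have hfr : ∀ τ : State, (∀ r < 10, τ.reg r = σ.reg r) →
      (∀ a, a % 8 ≠ 2 * p → a % 8 ≠ 2 * p + 1 → τ.mem a = σ.mem a) → Ready I t f q L R P τ :=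
    fun τ h1 h2 => hσ.frame (fun r hr => h1 r (by omega)) fun k => h2 _ (by omega) (by omega)
  refine Triple.seq (Triple.assign hI (by simp) ?_)
  refine Triple.whileDo hI (fun u τ => (∀ r < 10, τ.reg r = σ.reg r) ∧
      (∀ a, a % 8 ≠ 2 * p → a % 8 ≠ 2 * p + 1 → τ.mem a = σ.mem a) ∧
      ∃ k m' r', k ≤ L ∧ τ.reg rY = k ∧ τ.reg rU = m' ∧ τ.reg rK = r' ∧ m' = z0 + k + r' ∧
      r' ≤ I.length ∧ RankMem I t p m' r' τ.mem ∧ u + 100 * m ≤ 100 * m')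
    (100 * (z0 + L + I.length))
    ⟨fun r hr => by rw [State.setReg_reg, if_neg (by omega)], fun _ _ _ => rfl, 0, m, r,
      by omega, by simp, by simp [hU], by simp [hK], by omega, ?_, hr, by omega⟩ ?_ ?_ ?_ ?_
  · have h := hr.spec m le_rfl
    rw [hr.rank_eq] at h
    exact h.2.1.trans (maxOcc_le_length ..)
  · rintro u τ ⟨-, -, k, m', r', h1, h2, h3, h4, h5, h6, h7, h8⟩
    omega
  · rintro u τ -
    simp
  · rintro u τ ⟨h1, h2, k, m', r', h3, h4, h5, h6, h7, h8, h9, h10⟩ hv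
    have hrd := hfr τ h1 h2
    simp [h4, hrd.reg_l] at hv
    have hspec := h9.spec m' le_rfl
    rw [h9.rank_eq] at hspec
    obtain ⟨s1, s2, s3⟩ := hspec
    have hmt : m' / t ≤ (3 * I.length + 3) / t := Nat.div_le_div_right (by omega)
    have hmod := Nat.mod_lt m' d.t_pos
    have hpow : 2 ^ (m' % t + 1) ≤ 2 ^ t := Nat.pow_le_pow_right (by norm_num) hmod
    have hlow := h9.low
    rw [pow_succ] at hpow
    have hcell := d.ok_cell (var rY) 6 (by norm_num) (σ := τ) (by simp) (by simp [h4]; omega)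
    -- The emitted bit. It is added to the value, and `1 - β` to the table index.
    obtain ⟨β, hβ⟩ : ∃ β, β = if r' < τ.mem (8 * k + 6) then 1 else 0 := ⟨_, rfl⟩
    have hβ1 : β ≤ 1 := by rw [hβ]; split_ifs <;> simp
    have hβm : β * 2 ^ (m' % t) ≤ 2 ^ (m' % t) := by
      simpa using Nat.mul_le_mul_right (2 ^ (m' % t)) hβ1
    have hTk : τ.mem (8 * k + 6) = σ.mem (8 * k + 6) := h2 _ (by omega) (by omega)
    have hnext : RankSpec I p (m' + 1) (r' + β) := by
      rw [hTk] at hβ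
      have hz : m' - r' = z0 + k := by omega
      rw [hz] at s2 s3
      have hsk := hs k hv
      unfold RankSpec
      by_cases hlt : r' < σ.mem (8 * k + 6)
      · rw [if_pos hlt] at hβ
        rw [hβ, show m' + 1 - (r' + 1) = z0 + k by omega]
        exact ⟨by omega, by omega, fun z hz => (s3 z hz).trans (Nat.le_succ _)⟩
      · rw [if_neg hlt] at hβ
        rw [hβ, add_zero, show m' + 1 - r' = z0 + k + 1 by omega]
        refine ⟨by omega, s2.trans (maxOcc_mono I p (Nat.le_succ _)), fun z hz => ?_⟩
        rcases Nat.lt_succ_iff_lt_or_eq.mp hz with hz | rfl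
        · exact s3 z hz
        · exact d.cuts.maxOcc_le_of_table hv hcov s3 (not_lt.mp hlt)
    have hr'n : r' + β ≤ I.length := hnext.2.1.trans (maxOcc_le_length ..)
    refine Triple.seq (Triple.assign hI ⟨by simp, hcell, trivial⟩ ?_)
    have e1 : (Expr.lt (var rK) (load (cell (var rY) 6))).val I τ = β := by
      simp [h6, h4, hβ]
    rw [e1]
    generalize hτ1 : τ.setReg (rY + 1) β = τ1
    have r1 : ∀ r, τ1.reg r = if r = 25 then β else τ.reg r := fun r => by simp [← hτ1]
    have m1 : τ1.mem = τ.mem := by rw [← hτ1]; rfl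
    have hcell1 := d.ok_cell (var rU / var rT) (2 * p + 1) (by omega) (σ := τ1) (by simp)
      (by simp [r1, h5, hrd.reg_t]; omega)
    refine Triple.seq (Triple.put hI hcell1.1 ?_ hcell1.2 ?_)
    · simp only [Expr.ok_add, Expr.ok_load, Expr.ok_shl, Expr.ok_mod, Expr.ok_var, Expr.val_load,
        Expr.val_shl, Expr.val_mod, Expr.val_var, val_cell, Expr.val_div]
      refine ⟨⟨hcell1.1, hcell1.2⟩, ⟨by norm_num, by norm_num, ?_⟩, ?_⟩
      · simp [r1, h5, hrd.reg_t]; omega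
      · simp [r1, h5, hrd.reg_t, m1]; omega
    have e2 : (cell (var rU / var rT) (2 * p + 1)).val I τ1 = 8 * (m' / t) + (2 * p + 1) := by
      simp [r1, h5, hrd.reg_t]
    have e3 : (load (cell (var rU / var rT) (2 * p + 1)) +
        (var (rY + 1) <<< (var rU % var rT))).val I τ1 =
        τ.mem (8 * (m' / t) + (2 * p + 1)) + β * 2 ^ (m' % t) := by
      simp [r1, h5, hrd.reg_t, m1]
    rw [e2, e3]
    generalize hτ2 : τ1.setMem _ _ = τ2
    have r2 : ∀ r, τ2.reg r = if r = 25 then β else τ.reg r := fun r => by rw [← hτ2, ← r1]; rfl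
    have m2 : ∀ a, τ2.mem a = if a = 8 * (m' / t) + (2 * p + 1) then
        τ.mem (8 * (m' / t) + (2 * p + 1)) + β * 2 ^ (m' % t) else τ.mem a :=
      fun a => by rw [← hτ2, State.setMem_mem, m1]
    refine Triple.seq (Triple.assign hI (by simp [r2, h6]; omega) ?_)
    have e4 : (var rK + var (rY + 1)).val I τ2 = r' + β := by simp [r2, h6]
    rw [e4]
    have hcell3 := d.ok_cell (var rU / var rT + lit 1) (2 * p) (by omega)
      (σ := τ2.setReg rK (r' + β))
      (by simp [r2, h5, hrd.reg_t]; have := d.space; have := d.S_le; omega)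
      (by simp [r2, h5, hrd.reg_t]; omega)
    refine Triple.seq (Triple.put hI hcell3.1 (by simp) hcell3.2 ?_)
    have e5 : (cell (var rU / var rT + lit 1) (2 * p)).val I (τ2.setReg rK (r' + β)) =
        8 * (m' / t + 1) + 2 * p := by
      simp [r2, h5, hrd.reg_t]
    rw [e5]
    refine Triple.seq (Triple.assign hI (by simp [r2, h5]; omega) ?_)
    refine Triple.assign hI (by simp [r2, h4]; omega) ⟨fun r hr => ?_, fun a ha ha' => ?_,
      k + (1 - β), m' + 1, r' + β, ?_, ?_, ?_, ?_, by omega, hr'n, ?_, ?_⟩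
    · simp only [State.setReg_reg, State.setMem_reg]
      rw [if_neg (by omega), if_neg (by omega), if_neg (by omega), r2, if_neg (by omega), h1 r hr]
    · simp only [State.setReg_mem, State.setMem_mem]
      rw [if_neg (by omega), m2, if_neg (by omega), h2 a ha ha']
    · omega
    · simp [r2, h4]
    · simp [r2, h5]
    · simp
    · refine RankInv.step d.t_pos h9 hβ1 hnext (fun i => ?_) fun i => ?_
      · simp only [State.setReg_mem, State.setMem_mem, Expr.val_var, State.setReg_reg, if_true]
        by_cases hi : i = m' / t + 1
        · rw [if_pos (by omega), if_pos hi]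
        · rw [if_neg (by omega), if_neg hi, m2, if_neg (by omega)]
      · simp only [State.setReg_mem, State.setMem_mem]
        rw [if_neg (by omega), m2]
        by_cases hi : i = m' / t
        · rw [if_pos (by omega), if_pos hi]
        · rw [if_neg (by omega), if_neg hi]
    · simp
      omega
  · rintro u τ ⟨h1, h2, k, m', r', h3, h4, h5, h6, h7, h8, h9, h10⟩ hv
    have hrd := hfr τ h1 h2
    simp [h4, hrd.reg_l] at hv
    exact ⟨h1, h2, m', r', h5, h6, by omega, h9, by simp; omega⟩

/-- Write the rank structure for the characters `p`. -/
def pass (p : ℕ) : Prog := .block [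
  .assign rZ (lit 0), .assign rU (lit 0), .assign rK (lit 0),
  .whileDo (.lt (var rZ) (var rN + lit 1)) (.block [
    clearTable, rows p, emit p, .assign rZ (var rZ + var rL)])]

/-- The ranges start at the multiples of `L` up to `I.length`. More than `I.length` zeros are
written in the end, which is enough for every position that a query can ask for. -/
theorem triple_pass (d : Setting w S I t f q L R N P) {p : ℕ} (hp : p ≤ 1) {σ : State}
    (hσ : Ready I t f q L R P σ) (hA : ∀ k, σ.mem (8 * k + 2 * p) = 0)
    (hB : ∀ k, σ.mem (8 * k + (2 * p + 1)) = 0) :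
    Triple w S I (pass p) σ fun u τ => (∀ r < 9, τ.reg r = σ.reg r) ∧
      (∀ a, a % 8 ≠ 2 * p → a % 8 ≠ 2 * p + 1 → a % 8 ≠ 6 → τ.mem a = σ.mem a) ∧
      (∃ m r, I.length ≤ m ∧ RankMem I t p m r τ.mem) ∧
      u ≤ 600 * ((I.length / L + 1) * (L + R + 2)) + 200 * (R + 1) ^ 2 +
        300 * (I.length + 1) + 40 := by
  have hI := d.proper
  have hw := hI.1
  have hn := d.small
  have hL := d.L_le
  have hL0 := d.L_pos
  refine Triple.seq (Triple.assign hI (by simp) ?_)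
  refine Triple.seq (Triple.assign hI (by simp) ?_)
  refine Triple.seq (Triple.assign hI (by simp) ?_)
  have hfr : ∀ τ : State, (∀ r < 9, τ.reg r = σ.reg r) →
      (∀ a, a % 8 ≠ 2 * p → a % 8 ≠ 2 * p + 1 → a % 8 ≠ 6 → τ.mem a = σ.mem a) →
      Ready I t f q L R P τ :=
    fun τ h1 h2 => hσ.frame h1 fun k => h2 _ (by omega) (by omega) (by omega)
  have hsum : ∀ z, ∑ i ∈ Finset.range (R + 1), below I R P p z i ≤ (R + 1) ^ 2 := fun z => by
    calc _ ≤ ∑ i ∈ Finset.range (R + 1), (R + 1) := Finset.sum_le_sum fun _ _ => below_le ..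
      _ = _ := by simp [sq]
  -- `b` counts the finished ranges; the hypothesis says that at most one range went past the end.
  have hbT : ∀ b, b * L ≤ I.length + L → b * (L + R + 2) ≤ (I.length / L + 1) * (L + R + 2) := by
    intro b hb
    refine Nat.mul_le_mul_right _ ?_
    rcases b with _ | b
    · exact Nat.zero_le _
    · rw [Nat.add_le_add_iff_right, Nat.le_div_iff_mul_le hL0]
      rw [add_mul] at hb
      omega
  -- In the time bound the sum of `below` telescopes from range to range and never exceeds `(R + 1)
  -- ^ 2`; `100 * m` pays for the emitted bits, and the product for clearing the table and for the
  -- overhead of the rows.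
  refine Triple.whileDo hI (fun u τ => (∀ r < 9, τ.reg r = σ.reg r) ∧
      (∀ a, a % 8 ≠ 2 * p → a % 8 ≠ 2 * p + 1 → a % 8 ≠ 6 → τ.mem a = σ.mem a) ∧
      ∃ b m r, b * L ≤ I.length + L ∧ τ.reg rZ = b * L ∧ τ.reg rU = m ∧ τ.reg rK = r ∧
      m = b * L + r ∧ RankMem I t p m r τ.mem ∧
      u ≤ 600 * (b * (L + R + 2)) +
        200 * (∑ i ∈ Finset.range (R + 1), below I R P p (b * L) i) + 100 * m)
    (600 * ((I.length / L + 1) * (L + R + 2)) + 200 * (R + 1) ^ 2 + 300 * (I.length + 1))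
    ⟨fun r hr => ?_, fun _ _ _ _ => rfl, 0, 0, 0, by omega, by simp, by simp, by simp, by simp,
      RankInv.init (hA 0) hB ⟨le_rfl, by simp, by simp⟩, by simp⟩ ?_ ?_ ?_ ?_
  · simp only [State.setReg_reg]
    rw [if_neg (by omega), if_neg (by omega), if_neg (by omega)]
  · rintro u τ ⟨-, -, b, m, r, h1, h2, h3, h4, h5, h6, h7⟩
    have k1 := hbT b h1
    have k2 := hsum (b * L)
    have k3 := h6.spec m le_rfl
    rw [h6.rank_eq] at k3
    have k4 := k3.2.1.trans (maxOcc_le_length ..)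
    omega
  · rintro u τ ⟨h1, h2, -⟩
    simp [(hfr τ h1 h2).reg_n]
    omega
  · rintro u τ ⟨h1, h2, b, m, r, h3, h4, h5, h6, h7, h8, h9⟩ hv
    have hrd := hfr τ h1 h2
    simp [h4, hrd.reg_n] at hv
    refine Triple.seq ((triple_clearTable d hrd).mono ?_)
    rintro v1 τ1 ⟨k1, k2, k3, k4⟩
    have hrd1 : Ready I t f q L R P τ1 :=
      hrd.frame (fun r hr => k1 r (by omega)) fun k => k2 _ (by omega)
    refine Triple.seq ((triple_rows d hp hrd1 ((k1 _ (by norm_num)).trans h4) (by omega)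
      fun k hk => by rw [k3 k hk]; exact Nat.zero_le _).mono ?_)
    rintro v2 τ2 ⟨l1, l2, l3, l4⟩
    have hrd2 : Ready I t f q L R P τ2 :=
      hrd1.frame (fun r hr => l1 r (by omega)) fun k => l2.off _ (by omega)
    have hoff : ∀ a, a % 8 ≠ 6 → τ2.mem a = τ.mem a := fun a ha => by rw [l2.off a ha, k2 a ha]
    refine Triple.seq ((triple_emit d hp hrd2 (by omega) l2.sound l3
      (by rw [l1 _ (by norm_num), k1 _ (by norm_num)]; exact h5)
      (by rw [l1 _ (by norm_num), k1 _ (by norm_num)]; exact h6) h7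
      (h8.frame (fun k => hoff _ (by omega)) fun k => hoff _ (by omega))).mono ?_)
    rintro v3 τ3 ⟨n1, n2, m', r', n3, n4, n5, n6, n7⟩
    have hz3 : τ3.reg rZ = b * L := by
      rw [n1 _ (by norm_num), l1 _ (by norm_num), k1 _ (by norm_num), h4]
    have hl3 : τ3.reg rL = L := by rw [n1 _ (by norm_num), hrd2.reg_l]
    refine Triple.assign hI (by simp [hz3, hl3]; omega) ⟨fun r hr => ?_, fun a a1 a2 a3 => ?_,
      b + 1, m', r', ?_, ?_, ?_, ?_, ?_, n6, ?_⟩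
    · rw [State.setReg_reg, if_neg (by omega), n1 r (by omega), l1 r (by omega), k1 r (by omega),
        h1 r hr]
    · rw [State.setReg_mem, n2 a a1 a2, hoff a a3, h2 a a1 a2 a3]
    · rw [add_mul]; omega
    · simp [hz3, hl3]; ring
    · simpa using n3
    · simpa using n4
    · rw [n5]; ring
    · rw [show (b + 1) * L = b * L + L by ring,
        show (b + 1) * (L + R + 2) = b * (L + R + 2) + (L + R + 2) by ring]
      simp
      omega
  · rintro u τ ⟨h1, h2, b, m, r, h3, h4, h5, h6, h7, h8, h9⟩ hv
    have hrd := hfr τ h1 h2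
    simp [h4, hrd.reg_n] at hv
    refine ⟨h1, h2, ⟨m, r, by omega, h8⟩, ?_⟩
    have k1 := hbT b h3
    have k2 := hsum (b * L)
    have k3 := h8.spec m le_rfl
    rw [h8.rank_eq] at k3
    have k4 := k3.2.1.trans (maxOcc_le_length ..)
    simp
    omega

end WordRAM

/-! ### Decomposition into blocks of bounded length -/

/-- The state of the decomposition of the first `x` characters into blocks of at most `l` equal
characters: `r` blocks are complete and the lengths of these are in a packed array, the current
block has `c` characters. -/
structure BlockInv (I : List ℕ) (f q l : ℕ) (A P : ℕ → ℕ) (r c x : ℕ) : Prop where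
  zero : P 0 = 0
  beyond : ∀ k, r ≤ k → P k = P r
  cur : P r + c = x
  lt : ∀ k < r, P k < P (k + 1)
  len_le : ∀ k < r, P (k + 1) ≤ P k + l
  same : ∀ k < r, ∀ y, P k ≤ y → y < P (k + 1) → chr I y = chr I (P k)
  inv : PackedInv f q A r
  lens : ∀ k < r, packed f q A k = P (k + 1) - P k
  c_lt : c < l
  x_le : x ≤ I.length
  final : x = I.length → c = 0
  run : x < I.length → ∀ y, P r ≤ y → y ≤ x → chr I y = chr I (P r)
  count : x < I.length → l * r + c ≤ x + l * changes I x
  count_final : x = I.length → l * r ≤ x + l * (changes I (x - 1) + 1)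

namespace BlockInv
variable {I : List ℕ} {f q l : ℕ} {A A' P : ℕ → ℕ} {r c x : ℕ}

theorem init (hl : 0 < l) (hA : ∀ k, A k = 0) : BlockInv I f q l A (fun _ => 0) 0 0 0 where
  zero := rfl
  beyond _ _ := rfl
  cur := rfl
  lt _ h := absurd h (Nat.not_lt_zero _)
  len_le _ h := absurd h (Nat.not_lt_zero _)
  same _ h := absurd h (Nat.not_lt_zero _)
  inv := ⟨by simp [hA], fun k _ => hA k⟩
  lens _ h := absurd h (Nat.not_lt_zero _)
  c_lt := hl
  x_le := Nat.zero_le _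
  final _ := rfl
  run _ y h h' := by rw [Nat.le_antisymm h' h]
  count _ := by simp
  count_final _ := by simp

theorem changes_succ (I : List ℕ) (x : ℕ) :
    changes I (x + 1) = changes I x + if chr I (x + 1) ≠ chr I x then 1 else 0 :=
  Nat.count_succ _ _

theorem keep (h : BlockInv I f q l A P r c x) (hx : x + 1 < I.length) (hc : c + 1 ≠ l)
    (hs : chr I (x + 1) = chr I x) : BlockInv I f q l A P r (c + 1) (x + 1) where
  zero := h.zero
  beyond := h.beyond
  cur := by have := h.cur; omega
  lt := h.lt
  len_le := h.len_le
  same := h.same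
  inv := h.inv
  lens := h.lens
  c_lt := by have := h.c_lt; omega
  x_le := hx.le
  final h' := by omega
  run _ y h1 h2 := by
    have h3 := h.cur
    rcases Nat.le_or_eq_of_le_succ h2 with h2 | rfl
    · exact h.run (by omega) y h1 h2
    · rw [hs]; exact h.run (by omega) x (by omega) le_rfl
  count _ := by
    have := h.count (by omega)
    rw [changes_succ, mul_add]
    omega
  count_final h' := by omega

/-- A block ends because it is full, and then its `l` characters pay the `l` for it in `count`, or
at a change of character, which pays `l` instead. The last block may be neither; this is the
additional `l` in `count_final`. -/
theorem flush (h : BlockInv I f q l A P r c x) (hx : x < I.length) (hq : 0 < q) (hlf : l < 2 ^ f)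
    (hs : x + 1 < I.length → c + 1 = l ∨ chr I (x + 1) ≠ chr I x)
    (hA : ∀ k, A' k = if k = r / q then A (r / q) + (c + 1) * 2 ^ (r % q * f) else A k) :
    BlockInv I f q l A' (fun k => if k ≤ r then P k else x + 1) (r + 1) 0 (x + 1) := by
  have hcur := h.cur
  have hc := h.c_lt
  obtain ⟨k1, k2, k3⟩ := h.inv.step hq (by omega) hA
  have hcount := h.count hx
  refine ⟨by simp [h.zero], fun k hk => ?_, by simp, fun k hk => ?_, fun k hk => ?_,
    fun k hk y hy hy' => ?_, k1, fun k hk => ?_, by omega, hx, fun _ => rfl, fun hx' y hy hy' => ?_,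
    fun hx' => ?_, fun hx' => ?_⟩
  · rw [if_neg (by omega), if_neg (by omega)]
  · rcases Nat.lt_succ_iff_lt_or_eq.mp hk with hk | rfl
    · rw [if_pos (by omega), if_pos (by omega)]; exact h.lt k hk
    · rw [if_pos le_rfl, if_neg (by omega)]; omega
  · rcases Nat.lt_succ_iff_lt_or_eq.mp hk with hk | rfl
    · rw [if_pos (by omega), if_pos (by omega)]; exact h.len_le k hk
    · rw [if_pos le_rfl, if_neg (by omega)]; omega
  · rcases Nat.lt_succ_iff_lt_or_eq.mp hk with hk | rfl
    · rw [if_pos (by omega)] at hy hy' ⊢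
      exact h.same k hk y hy hy'
    · rw [if_pos le_rfl] at hy ⊢
      rw [if_neg (by omega)] at hy'
      exact h.run hx y hy (by omega)
  · rcases Nat.lt_succ_iff_lt_or_eq.mp hk with hk | rfl
    · rw [if_pos (by omega), if_pos (by omega), k3 k hk]; exact h.lens k hk
    · rw [if_pos le_rfl, if_neg (by omega), k2]; omega
  · rw [if_neg (by omega)] at hy ⊢
    rw [Nat.le_antisymm hy' hy]
  · rw [changes_succ, mul_add, mul_add]
    rcases hs hx' with h' | h'
    · omega
    · rw [if_pos h']; omega
  · rw [Nat.add_sub_cancel, mul_add, mul_add]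
    omega

end BlockInv

theorem PackedInv.add_lt {f q : ℕ} {A : ℕ → ℕ} {r v : ℕ} (h : PackedInv f q A r) (hv : v < 2 ^ f)
    (hq : 0 < q) : A (r / q) + v * 2 ^ (r % q * f) < 2 ^ (q * f) := by
  have hlow := h.low
  have h1 : (v + 1) * 2 ^ (r % q * f) ≤ 2 ^ f * 2 ^ (r % q * f) := Nat.mul_le_mul_right _ hv
  have h2 : 2 ^ ((r % q + 1) * f) ≤ 2 ^ (q * f) :=
    Nat.pow_le_pow_right (by norm_num) (Nat.mul_le_mul_right _ (Nat.mod_lt r hq))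
  rw [add_mul, one_mul] at h1
  rw [add_mul, one_mul, pow_add, mul_comm] at h2
  omega

/-! ### Programs for the auxiliary quantities and for the blocks -/

namespace WordRAM
variable {w S N : ℕ} {I : List ℕ}

theorem ok_cell_of_lt (hN : 8 * N ≤ S) (hS : S ≤ 2 ^ w) (h8 : 8 < 2 ^ w) {σ : State} (k : Expr)
    (c : ℕ) (hc : c < 8) (hk : k.Ok w S I σ) (h : k.val I σ < N) :
    (cell k c).Ok w S I σ ∧ (cell k c).val I σ < S := by
  refine ⟨ok_cell _ _ _ _ _ _ hc hk h8 (by omega), ?_⟩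
  simp only [val_cell]
  omega

/-- `R[b]` becomes the number of binary digits of `R[a]`. -/
def bitLength (a b : ℕ) : Prog :=
  .seq (.assign b (lit 0)) (.whileDo (var a >>> var b) (.assign b (var b + lit 1)))

theorem triple_bitLength (hI : Proper w I) {a b x : ℕ} (ha : a < 32) (hb : b < 32) (hab : a ≠ b)
    {σ : State} (hx : σ.reg a = x) (hw : Nat.size x + 1 < 2 ^ w) :
    Triple w S I (bitLength a b) σ fun u τ => τ = σ.setReg b (Nat.size x) ∧
      u ≤ 20 * Nat.size x + 20 := by
  refine Triple.seq (Triple.assign hI (by simp) ?_)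
  have hss : ∀ v v', (σ.setReg b v).setReg b v' = σ.setReg b v' := fun v v' => by
    simp [State.setReg]
  refine Triple.whileDo hI (fun u τ => ∃ v ≤ Nat.size x, τ = σ.setReg b v ∧ u ≤ 20 * v)
    (20 * Nat.size x) ⟨0, Nat.zero_le _, rfl, by omega⟩ ?_ ?_ ?_ ?_
  · rintro u τ ⟨v, h1, -, h2⟩
    omega
  · rintro u τ -
    simp [ha, hb]
  · rintro u τ ⟨v, h1, rfl, h2⟩ hv
    have hlt : v < Nat.size x := by
      rw [Nat.lt_size]
      simp [hab, hx] at hv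
      exact hv
    refine Triple.assign hI (by simp [hb]; have := hI.1; omega)
      ⟨v + 1, hlt, by rw [hss]; simp, by simp; omega⟩
  · rintro u τ ⟨v, h1, rfl, h2⟩ hv
    have hle : Nat.size x ≤ v := by
      rw [Nat.size_le]
      simp [hab, hx] at hv
      exact hv
    obtain rfl : v = Nat.size x := le_antisymm h1 hle
    exact ⟨rfl, by simp; omega⟩

/-- Compute the table of population counts. -/
def popTable : Prog :=
  .seq (.assign rY (lit 1)) (.whileDo (.lt (var rY) (lit 1 <<< var rT))
    (.seq (.put (cell (var rY) 4) (load (cell (var rY / lit 2) 4) + var rY % lit 2))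
      (.assign rY (var rY + lit 1))))

theorem triple_popTable (hI : Proper w I) (hN : 8 * N ≤ S) (hS : S ≤ 2 ^ w) (h8 : 8 < 2 ^ w)
    {t : ℕ} (ht : 2 ^ t ≤ N) {σ : State} (hσ : σ.reg rT = t) (h0 : σ.mem 4 = 0) :
    Triple w S I popTable σ fun u τ => (∀ r < 24, τ.reg r = σ.reg r) ∧
      (∀ a, a % 8 ≠ 4 → τ.mem a = σ.mem a) ∧
      (∀ x < 2 ^ t, τ.mem (8 * x + 4) = popCount x) ∧ u ≤ 50 * 2 ^ t + 20 := by
  have hw := hI.1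
  have hpos : 0 < 2 ^ t := by positivity
  refine Triple.seq (Triple.assign hI (by simp; omega) ?_)
  refine Triple.whileDo hI (fun u τ => (∀ r < 24, τ.reg r = σ.reg r) ∧
      (∀ a, a % 8 ≠ 4 → τ.mem a = σ.mem a) ∧ ∃ y, 0 < y ∧ y ≤ 2 ^ t ∧ τ.reg rY = y ∧
      (∀ x < y, τ.mem (8 * x + 4) = popCount x) ∧ u ≤ 50 * y)
    (50 * 2 ^ t) ⟨fun r hr => by rw [State.setReg_reg, if_neg (by omega)], fun _ _ => rfl, 1,
      one_pos, hpos, by simp, fun x hx => ?_, by omega⟩ ?_ ?_ ?_ ?_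
  · obtain rfl : x = 0 := by omega
    simp [h0, popCount_zero]
  · rintro u τ ⟨-, -, y, h1, h2, -, -, h3⟩
    omega
  · rintro u τ ⟨h1, -⟩
    simp [(h1 rT (by norm_num)).trans hσ]
    omega
  · rintro u τ ⟨h1, h2, y, h3, h4, h5, h6, h7⟩ hv
    have hT := (h1 rT (by norm_num)).trans hσ
    simp [hT, h5] at hv
    have hc := ok_cell_of_lt (I := I) hN hS h8 (σ := τ) (var rY) 4 (by norm_num) (by simp)
      (by simp [h5]; omega)
    have hc2 := ok_cell_of_lt (I := I) hN hS h8 (σ := τ) (var rY / lit 2) 4 (by norm_num)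
      (by simp; omega) (by simp [h5]; omega)
    have hpc := popCount_le (y / 2)
    have e0 := popCount_eq y
    have e1 := h6 (y / 2) (by omega)
    refine Triple.seq (Triple.put hI hc.1 ?_ hc.2 ?_)
    · rw [Expr.ok_add, Expr.ok_load, Expr.ok_mod]
      refine ⟨hc2, by simp; omega, ?_⟩
      simp [h5, e1]
      omega
    · refine Triple.assign hI (by simp [h5]; omega) ⟨fun r hr => ?_, fun a ha => ?_, y + 1,
        by omega, hv, by simp [h5], fun x hx => ?_, by simp; omega⟩
      · rw [State.setReg_reg, if_neg (by omega), State.setMem_reg, h1 r hr]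
      · rw [State.setReg_mem, State.setMem_mem, val_cell, if_neg (by omega), h2 a ha]
      · rw [State.setReg_mem, State.setMem_mem]
        simp only [val_cell, Expr.val_var, h5, Expr.val_add, Expr.val_load, Expr.val_div,
          Expr.val_lit, Expr.val_mod, e1]
        split_ifs with h
        · obtain rfl : x = y := by omega
          omega
        · exact h6 x (by omega)
  · rintro u τ ⟨h1, h2, y, h3, h4, h5, h6, h7⟩ hv
    have hT := (h1 rT (by norm_num)).trans hσ
    simp [hT, h5] at hv
    exact ⟨h1, h2, fun x hx => h6 x (by omega), by simp; omega⟩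

/-- Count the changes between consecutive characters. -/
def countChanges : Prog := .block [
  .assign rZ (lit 0), .assign rY (lit 0),
  .whileDo (.lt (var rY + lit 1) (var rN)) (.block [
    .assign rZ (var rZ + (lit 1 - .eq (read (var rY + lit 1)) (read (var rY)))),
    .assign rY (var rY + lit 1)])]

theorem changes_le_self (I : List ℕ) (x : ℕ) : changes I x ≤ x := Nat.count_le ..

theorem triple_countChanges (hI : Proper w I) (hn : 16 * (I.length + 1) < 2 ^ w) {σ : State}
    (hσ : σ.reg rN = I.length) :
    Triple w S I countChanges σ fun u τ => (∀ r < 9, τ.reg r = σ.reg r) ∧ τ.mem = σ.mem ∧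
      τ.reg rZ = changes I (I.length - 1) ∧ u ≤ 50 * I.length + 20 := by
  have hw := hI.1
  refine Triple.seq (Triple.assign hI (by simp) ?_)
  refine Triple.seq (Triple.assign hI (by simp) ?_)
  refine Triple.whileDo hI (fun u τ => (∀ r < 9, τ.reg r = σ.reg r) ∧ τ.mem = σ.mem ∧
      ∃ y, y ≤ I.length - 1 ∧ τ.reg rY = y ∧ τ.reg rZ = changes I y ∧ u ≤ 50 * y)
    (50 * I.length) ⟨fun r hr => ?_, rfl, 0, by omega, by simp, by simp [changes], by omega⟩
    ?_ ?_ ?_ ?_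
  · simp only [State.setReg_reg]
    rw [if_neg (by omega), if_neg (by omega)]
  · rintro u τ ⟨-, -, y, h1, -, -, h2⟩
    omega
  · rintro u τ ⟨-, -, y, h1, h2, -⟩
    simp [h2]
    omega
  · rintro u τ ⟨h1, h2, y, h3, h4, h5, h6⟩ hv
    have hN := (h1 rN (by norm_num)).trans hσ
    simp [hN, h4] at hv
    have hy := changes_le_self I y
    refine Triple.seq (Triple.assign hI ?_ ?_)
    · simp [h4, h5]
      refine ⟨⟨by omega, ⟨by omega, by omega⟩, by omega⟩, ?_⟩
      split_ifs <;> omega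
    · refine Triple.assign hI (by simp [h4]; omega) ⟨fun r hr => ?_, h2, y + 1, by omega,
        by simp [h4], ?_, by simp; omega⟩
      · simp only [State.setReg_reg]
        rw [if_neg (by omega), if_neg (by omega), h1 r hr]
      · rw [BlockInv.changes_succ]
        simp [h4, h5]
        split_ifs <;> simp
  · rintro u τ ⟨h1, h2, y, h3, h4, h5, h6⟩ hv
    have hN := (h1 rN (by norm_num)).trans hσ
    simp [hN, h4] at hv
    obtain rfl : y = I.length - 1 := by omega
    exact ⟨h1, h2, h5, by simp; omega⟩

/-- Cut the input into blocks of at most `R[rE]` equal characters. -/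
def cutBlocks : Prog := .block [
  .assign rR (lit 0), .assign rZ (lit 0), .assign rY (lit 0),
  .whileDo (.lt (var rY) (var rN)) (.block [
    .assign rZ (var rZ + lit 1), .assign rY (var rY + lit 1),
    .cond (.lt (var rY) (var rN))
      (.cond (.eq (var rZ) (var rE)) (.assign rK (lit 1))
        (.assign rK (lit 1 - .eq (read (var rY)) (read (var rY - lit 1)))))
      (.assign rK (lit 1)),
    .cond (var rK) (.block [
      .put (cell (var rR / var rQ) 5)
        (load (cell (var rR / var rQ) 5) + (var rZ <<< (var rR % var rQ * var rF))),
      .assign rR (var rR + lit 1), .assign rZ (lit 0)]) .skip])]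

theorem triple_cutBlocks (hI : Proper w I) (hN : 8 * N ≤ S) (hS : S ≤ 2 ^ w)
    (hn : 16 * (I.length + 1) < 2 ^ w) {f q l : ℕ} (hq : 0 < q) (hl : 0 < l)
    (hln : l ≤ I.length + 1) (hlf : l < 2 ^ f) (hqf : 2 ^ (q * f) < 2 ^ w)
    (hlD : I.length < l * (changes I (I.length - 1) + 1))
    (hr : ∀ r ≤ 2 * (changes I (I.length - 1) + 1), r / q < N) {σ : State}
    (hσn : σ.reg rN = I.length) (hσf : σ.reg rF = f) (hσq : σ.reg rQ = q) (hσl : σ.reg rE = l)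
    (h0 : ∀ k, σ.mem (8 * k + 5) = 0) :
    Triple w S I cutBlocks σ fun u τ => (∀ r, r < 7 ∨ r = 8 → τ.reg r = σ.reg r) ∧
      (∀ a, a % 8 ≠ 5 → τ.mem a = σ.mem a) ∧ u ≤ 150 * I.length + 20 ∧
      ∃ r P, τ.reg rR = r ∧ r ≤ 2 * (changes I (I.length - 1) + 1) ∧
      BlockInv I f q l (fun k => τ.mem (8 * k + 5)) P r 0 I.length := by
  have hw := hI.1
  -- With `D` changes, `l * r ≤ n + l * (D + 1) < 2 * l * (D + 1)`, the last step because `n < l *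
  -- (D + 1)`: the cap on block lengths costs at most a factor of about two.
  have hbound : ∀ r c x A P, BlockInv I f q l A P r c x →
      r ≤ 2 * (changes I (I.length - 1) + 1) := by
    intro r c x A P h
    have key : l * r ≤ I.length + l * (changes I (I.length - 1) + 1) := by
      rcases h.x_le.lt_or_eq with hx | hx
      · have h1 := h.count hx
        have h2 : changes I x ≤ changes I (I.length - 1) := Nat.count_monotone _ (by omega)
        have h3 := Nat.mul_le_mul_left l h2
        rw [mul_add]
        omega
      · have := h.count_final hx
        rwa [hx] at this
    by_contra hc
    have h4 := Nat.mul_le_mul_left l (show 2 * (changes I (I.length - 1) + 1) ≤ r by omega)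
    rw [show l * (2 * (changes I (I.length - 1) + 1)) =
      2 * (l * (changes I (I.length - 1) + 1)) by ring] at h4
    omega
  refine Triple.seq (Triple.assign hI (by simp) ?_)
  refine Triple.seq (Triple.assign hI (by simp) ?_)
  refine Triple.seq (Triple.assign hI (by simp) ?_)
  refine Triple.whileDo hI (fun u τ => (∀ r, r < 7 ∨ r = 8 → τ.reg r = σ.reg r) ∧
      (∀ a, a % 8 ≠ 5 → τ.mem a = σ.mem a) ∧ ∃ r c x P, τ.reg rR = r ∧ τ.reg rZ = c ∧
      τ.reg rY = x ∧ u ≤ 150 * x ∧ BlockInv I f q l (fun k => τ.mem (8 * k + 5)) P r c x)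
    (150 * I.length) ⟨fun r hr => ?_, fun _ _ => rfl, 0, 0, 0, fun _ => 0, by simp, by simp,
      by simp, by simp, BlockInv.init hl h0⟩ ?_ ?_ ?_ ?_
  · simp only [State.setReg_reg]
    rw [if_neg (by omega), if_neg (by omega), if_neg (by omega)]
  · rintro u τ ⟨-, -, r, c, x, P, -, -, -, h1, h2⟩
    have := h2.x_le
    omega
  · rintro u τ -
    simp
  · rintro u τ ⟨h1, h2, r, c, x, P, h3, h4, h5, h6, h7⟩ hv
    have en := (h1 rN (by norm_num)).trans hσn
    have ef := (h1 rF (by norm_num)).trans hσf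
    have eq := (h1 rQ (by norm_num)).trans hσq
    have el := (h1 rE (by norm_num)).trans hσl
    simp [en, h5] at hv
    have hcl := h7.c_lt
    have hrD := hbound _ _ _ _ _ h7
    have hrN := hr r hrD
    have hD := changes_le_self I (I.length - 1)
    have hadd := h7.inv.add_lt (v := c + 1) (by omega) hq
    have hqf' : q * f < 2 ^ (q * f) := Nat.lt_two_pow_self
    have hmod : r % q * f ≤ q * f := Nat.mul_le_mul_right _ (Nat.mod_lt _ hq).le
    refine Triple.seq (Triple.assign hI (by simp [h4]; omega) ?_)
    refine Triple.seq (Triple.assign hI (by simp [h5]; omega) ?_)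
    generalize hτ2 : State.setReg (State.setReg τ _ _) _ _ = τ2
    have r2 : ∀ r, τ2.reg r = if r = 24 then x + 1 else if r = 9 then c + 1 else τ.reg r :=
      fun r => by simp [← hτ2, h4, h5]
    have m2 : τ2.mem = τ.mem := by rw [← hτ2]; rfl
    obtain ⟨g, hg⟩ : ∃ g, g = if x + 1 < I.length ∧ c + 1 ≠ l ∧ chr I (x + 1) = chr I x
      then 0 else 1 := ⟨_, rfl⟩
    -- All branches of the nested test establish one common postcondition, the flag `g` in `rK`, so
    -- the rest is treated once. The nesting also guards the read of the next character at the end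
    -- of the input.
    refine Triple.seq (Triple.mono (Q := fun u τ3 => u ≤ 40 ∧ τ3 = τ2.setReg rK g) ?_ ?_)
    · refine Triple.cond hI (by simp) (fun hv1 => ?_) fun hv1 => ?_
      · simp [r2, en] at hv1
        refine Triple.cond hI (by simp) (fun hv2 => ?_) fun hv2 => ?_
        · simp [r2, el] at hv2
          refine Triple.assign hI (by simp; omega) ⟨by simp, ?_⟩
          rw [hg, if_neg (by omega)]
          simp
        · simp [r2, el] at hv2
          refine Triple.assign hI (by simp [r2]; omega) ⟨by simp, ?_⟩
          simp only [Expr.val_sub, Expr.val_lit, Expr.val_eq, val_read_eq_chr, Expr.val_var, r2, hg,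
            if_true, Nat.add_sub_cancel]
          by_cases hch : chr I (x + 1) = chr I x
          · rw [if_pos hch, if_pos ⟨hv1, hv2, hch⟩]
          · rw [if_neg hch, if_neg fun h => hch h.2.2]
      · simp [r2, en] at hv1
        refine Triple.assign hI (by simp; omega) ⟨by simp, ?_⟩
        rw [hg, if_neg (by omega)]
        simp
    · rintro u3 τ3 ⟨hu3, rfl⟩
      refine Triple.cond hI (by simp) (fun hv3 => ?_) fun hv3 => ?_
      · have hflush : x + 1 < I.length → c + 1 = l ∨ chr I (x + 1) ≠ chr I x := by
          intro hx
          by_contra! hcon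
          simp [hg] at hv3
          exact hv3 hx hcon.1 hcon.2
        have hc := ok_cell_of_lt (I := I) hN hS (by omega) (σ := τ2.setReg rK g)
          (var rR / var rQ) 5 (by norm_num) (by simp) (by simp [r2, h3, eq, hrN])
        have e1 : (cell (var rR / var rQ) 5).val I (τ2.setReg rK g) = 8 * (r / q) + 5 := by
          simp [r2, h3, eq]
        have e2 : (load (cell (var rR / var rQ) 5) +
            (var rZ <<< (var rR % var rQ * var rF))).val I (τ2.setReg rK g) =
            τ.mem (8 * (r / q) + 5) + (c + 1) * 2 ^ (r % q * f) := by
          simp [r2, h3, eq, ef, m2]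
        have e3 : (var rR % var rQ * var rF).val I (τ2.setReg rK g) = r % q * f := by
          simp [r2, h3, eq, ef]
        have e4 : (var rZ <<< (var rR % var rQ * var rF)).val I (τ2.setReg rK g) =
            (c + 1) * 2 ^ (r % q * f) := by
          simp [r2, h3, eq, ef]
        refine Triple.seq (Triple.put hI hc.1 ⟨⟨hc.1, hc.2⟩, ⟨by simp,
          ⟨⟨by simp, by simp, trivial⟩, by simp, ?_⟩, ?_⟩, ?_⟩ hc.2 ?_)
        · exact lt_of_eq_of_lt e3 (by omega)
        · exact lt_of_eq_of_lt e4 (by omega)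
        · exact lt_of_eq_of_lt e2 (by omega)
        · rw [e1, e2]
          refine Triple.seq (Triple.assign hI (by simp [r2, h3]; omega) ?_)
          refine Triple.assign hI (by simp) ⟨fun r' hr' => ?_, fun a ha => ?_, r + 1, 0, x + 1, _,
            by simp [r2, h3], by simp, by simp [r2], by simp; omega,
            h7.flush hv hq hlf hflush fun k => ?_⟩
          · simp only [State.setReg_reg, State.setMem_reg]
            rw [if_neg (by omega), if_neg (by omega), if_neg (by omega), r2, if_neg (by omega),
              if_neg (by omega), h1 r' hr']
          · simp only [State.setReg_mem, State.setMem_mem, m2]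
            rw [if_neg (by omega), h2 a ha]
          · simp only [State.setReg_mem, State.setMem_mem, m2]
            by_cases hk : k = r / q
            · rw [if_pos (by omega), if_pos hk]
            · rw [if_neg (by omega), if_neg hk]
      · simp [hg] at hv3
        refine Triple.skip ⟨fun r' hr' => ?_, fun a ha => ?_, r, c + 1, x + 1, P,
          by simp [r2, h3], by simp [r2], by simp [r2], by simp; omega, ?_⟩
        · simp only [State.setReg_reg]
          rw [if_neg (by omega), r2, if_neg (by omega), if_neg (by omega), h1 r' hr']
        · simp only [State.setReg_mem, m2]
          exact h2 a ha
        · simp only [State.setReg_mem, m2]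
          exact h7.keep hv3.1 hv3.2.1 hv3.2.2
  · rintro u τ ⟨h1, h2, r, c, x, P, h3, h4, h5, h6, h7⟩ hv
    have en := (h1 rN (by norm_num)).trans hσn
    simp [en, h5] at hv
    obtain rfl : x = I.length := le_antisymm h7.x_le hv
    obtain rfl := h7.final rfl
    exact ⟨h1, h2, by simp; omega, r, P, h3, hbound _ _ _ _ _ h7, h7⟩

end WordRAM

/-! Sizes of the parts of the data structure. -/

theorem two_pow_size_le (n : ℕ) : 2 ^ Nat.size n ≤ 2 * n + 1 := by
  rcases Nat.eq_zero_or_pos n with rfl | h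
  · simp
  · have h1 := Nat.size_pos.mpr h
    have h2 : 2 ^ (Nat.size n - 1) ≤ n := Nat.lt_size.mp (by omega)
    have h3 : 2 ^ Nat.size n = 2 * 2 ^ (Nat.size n - 1) := by
      rw [← pow_succ', Nat.sub_add_cancel h1]
    omega

theorem size_le_self (n : ℕ) : Nat.size n ≤ n := Nat.size_le.mpr Nat.lt_two_pow_self

/-- It absorbs `(log n)²` into `O(n)` in the time bound. -/
theorem sq_le_two_pow_succ (k : ℕ) : k ^ 2 ≤ 2 ^ (k + 1) := by
  induction k with
  | zero => simp
  | succ k ih =>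
    have := @Nat.lt_two_pow_self k
    have e1 : (k + 1) ^ 2 = k ^ 2 + 2 * k + 1 := by ring
    rw [e1, pow_succ 2 (k + 1)]
    rw [pow_succ 2 k] at ih ⊢
    omega

/-- The number of bits per word of a rank structure for `n` positions. -/
def bitsPerWord (n : ℕ) : ℕ := (Nat.size n + 1) / 2 + 1

/-- The number of cells of each of the interleaved arrays. -/
def numCells (n : ℕ) : ℕ := 2 ^ bitsPerWord n + (8 * n + 4) / bitsPerWord n + 2

theorem bitsPerWord_pos (n : ℕ) : 0 < bitsPerWord n := Nat.succ_pos _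

theorem bitsPerWord_le (n : ℕ) : bitsPerWord n ≤ Nat.size n + 1 := by
  unfold bitsPerWord
  omega

theorem two_pow_bitsPerWord_le (n : ℕ) : 2 ^ bitsPerWord n ≤ 2 * 2 ^ Nat.size n := by
  rw [← pow_succ']
  exact Nat.pow_le_pow_right (by norm_num) (bitsPerWord_le n)

theorem div_add_le_numCells (n : ℕ) :
    (8 * n + 4) / bitsPerWord n + 3 ≤ numCells n := by
  have h : 0 < 2 ^ bitsPerWord n := by positivity
  unfold numCells
  generalize (8 * n + 4) / bitsPerWord n = k
  omega

theorem two_pow_le_numCells (n : ℕ) : 2 ^ bitsPerWord n ≤ numCells n := by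
  unfold numCells
  rw [add_assoc]
  exact Nat.le_add_right _ _

theorem numCells_le (n : ℕ) : numCells n ≤ 16 * 2 ^ Nat.size n := by
  have h1 := two_pow_bitsPerWord_le n
  have h2 := Nat.div_le_self (8 * n + 4) (bitsPerWord n)
  have h3 := Nat.lt_size_self n
  unfold numCells
  omega

/-- The population counts take `O(√n)` cells, and `√n log n = O(n)`; the remaining `O(n / log n)`
cells of logarithmic length take `O(n)` bits. -/
theorem numCells_mul_le (n : ℕ) : numCells n * (Nat.size n + 10) ≤ 180 * (n + 1) := by
  have hz := two_pow_size_le n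
  have hs := size_le_self n
  have h1 : 2 ^ bitsPerWord n * (Nat.size n + 10) ≤ 80 * (n + 1) := by
    unfold bitsPerWord
    set h := (Nat.size n + 1) / 2
    have k1 := @Nat.lt_two_pow_self h
    have k2 : 2 ^ h * 2 ^ h ≤ 2 * 2 ^ Nat.size n := by
      rw [← pow_add, ← pow_succ']
      exact Nat.pow_le_pow_right (by norm_num) (by omega)
    calc 2 ^ (h + 1) * (Nat.size n + 10) ≤ (2 * 2 ^ h) * (10 * 2 ^ h) :=
          Nat.mul_le_mul (by rw [pow_succ']) (by omega)
      _ = 20 * (2 ^ h * 2 ^ h) := by ring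
      _ ≤ _ := by omega
  have h2 : (8 * n + 4) / bitsPerWord n * (Nat.size n + 10) ≤ 80 * (n + 1) := by
    calc _ ≤ (8 * n + 4) / bitsPerWord n * (10 * bitsPerWord n) :=
          Nat.mul_le_mul_left _ (by unfold bitsPerWord; omega)
      _ = 10 * ((8 * n + 4) / bitsPerWord n * bitsPerWord n) := by ring
      _ ≤ 10 * (8 * n + 4) := Nat.mul_le_mul_left _ (Nat.div_mul_le_self _ _)
      _ ≤ _ := by omega
  unfold numCells
  rw [add_mul, add_mul]
  omega

/-- The bound on the lengths of blocks when there are `D` changes. -/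
def blockLength (n D : ℕ) : ℕ := n / (D + 1) + 1

/-- The number of block lengths per word. -/
def lensPerWord (n D : ℕ) : ℕ := (Nat.size n + 1) / Nat.size (blockLength n D)

/-- The number of cells of the table. -/
def tableSize (n : ℕ) : ℕ := n / (Nat.size n + 1) + 1

section
variable {n D : ℕ}

theorem blockLength_pos : 0 < blockLength n D := Nat.succ_pos _

theorem blockLength_le : blockLength n D ≤ n + 1 := Nat.succ_le_succ (Nat.div_le_self _ _)

theorem lt_blockLength_mul : n < blockLength n D * (D + 1) := by
  unfold blockLength
  rw [mul_comm]
  exact Nat.lt_mul_div_succ n (Nat.succ_pos D)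

theorem blockLength_mul_le : blockLength n D * (D + 1) ≤ n + (D + 1) := by
  unfold blockLength
  rw [add_mul, one_mul]
  exact Nat.add_le_add_right (Nat.div_mul_le_self _ _) _

theorem size_blockLength_pos : 0 < Nat.size (blockLength n D) := Nat.size_pos.mpr blockLength_pos

theorem size_blockLength_le : Nat.size (blockLength n D) ≤ Nat.size n + 1 := by
  rw [Nat.size_le, pow_succ]
  have := Nat.lt_size_self n
  have := blockLength_le (n := n) (D := D)
  omega

theorem lensPerWord_pos : 0 < lensPerWord n D :=
  Nat.div_pos size_blockLength_le size_blockLength_pos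

theorem lensPerWord_mul_le : lensPerWord n D * Nat.size (blockLength n D) ≤ Nat.size n + 1 :=
  Nat.div_mul_le_self _ _

/-- With `l` the length cap and `f` its bit length, the packed entries have `O(f (D + 1))` bits in
all, and `f ≤ l` gives `f (D + 1) ≤ l (D + 1) ≤ n + D + 1`. Rounding down the number `q` of entries
per word wastes at most about half of each word. -/
theorem div_lensPerWord_lt (hD : D ≤ n) {r : ℕ} (hr : r ≤ 2 * (D + 1)) :
    r / lensPerWord n D < numCells n := by
  set f := Nat.size (blockLength n D) with hf
  set q := lensPerWord n D with hq
  have hf0 : 0 < f := size_blockLength_pos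
  have hq0 : 0 < q := lensPerWord_pos
  have h1 : Nat.size n + 1 ≤ 2 * f * q := by
    have h2 : Nat.size n + 1 < f * (q + 1) := Nat.lt_mul_div_succ _ hf0
    have h3 : f * 1 ≤ f * q := Nat.mul_le_mul_left _ hq0
    rw [mul_add] at h2
    rw [mul_assoc]
    omega
  have h2 : bitsPerWord n * (r / q) ≤ 8 * n + 4 := by
    calc bitsPerWord n * (r / q) ≤ (2 * f * q) * (r / q) :=
          Nat.mul_le_mul_right _ ((bitsPerWord_le n).trans h1)
      _ = 2 * f * (q * (r / q)) := by ring
      _ ≤ 2 * f * (2 * (D + 1)) := Nat.mul_le_mul_left _ ((Nat.mul_div_le r q).trans hr)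
      _ = 4 * (f * (D + 1)) := by ring
      _ ≤ 4 * (blockLength n D * (D + 1)) :=
          Nat.mul_le_mul_left _ (Nat.mul_le_mul_right _ (size_le_self _))
      _ ≤ 4 * (n + (D + 1)) := Nat.mul_le_mul_left _ blockLength_mul_le
      _ ≤ _ := by omega
  have h3 : r / q ≤ (8 * n + 4) / bitsPerWord n := by
    rw [Nat.le_div_iff_mul_le (bitsPerWord_pos n), mul_comm]
    exact h2
  have := div_add_le_numCells n
  omega

theorem tableSize_le : tableSize n ≤ n + 1 := Nat.succ_le_succ (Nat.div_le_self _ _)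

theorem tableSize_le_numCells : tableSize n ≤ numCells n := by
  have h1 : n / (Nat.size n + 1) ≤ n / bitsPerWord n :=
    Nat.div_le_div_left (bitsPerWord_le n) (bitsPerWord_pos n)
  have h2 : n / bitsPerWord n ≤ (8 * n + 4) / bitsPerWord n := Nat.div_le_div_right (by omega)
  have h3 := div_add_le_numCells n
  unfold tableSize
  omega

theorem div_bitsPerWord_lt {x : ℕ} (hx : x ≤ 3 * n + 3) :
    x / bitsPerWord n + 1 < numCells n := by
  have h2 : x / bitsPerWord n ≤ (8 * n + 4) / bitsPerWord n := Nat.div_le_div_right (by omega)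
  have h3 := div_add_le_numCells n
  omega

/-- This bounds the number of ranges by `O(log n)`, the price of a table with only `O(n / log n)`
cells. -/
theorem div_tableSize_le (n : ℕ) : n / tableSize n ≤ Nat.size n := by
  rw [← Nat.lt_succ_iff, Nat.div_lt_iff_lt_mul (show 0 < tableSize n from Nat.succ_pos _)]
  exact Nat.lt_mul_div_succ n (Nat.succ_pos _)

end

/-! ### The construction program -/

namespace WordRAM

/-- Compute the parameters, the table of population counts and the blocks. -/
def prepare : Prog := .block [
  bitLength rN rW, .assign rW (var rW + lit 1), .assign rT (var rW / lit 2 + lit 1),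
  popTable, countChanges,
  .assign rE (var rN / (var rZ + lit 1) + lit 1), bitLength rE rF,
  .assign rM (lit 1 <<< var rF), .assign rQ (var rW / var rF),
  .assign rL (var rN / var rW + lit 1), cutBlocks]

theorem triple_prepare {w : ℕ} {I : List ℕ} (hI : Proper w I) (hw : Nat.size I.length + 10 ≤ w)
    {σ : State} (hσ : σ.reg rN = I.length) (hm : ∀ a, σ.mem a = 0) :
    Triple w (8 * numCells I.length) I prepare σ fun u τ => ∃ f q R P,
      Setting w (8 * numCells I.length) I (bitsPerWord I.length) f q (tableSize I.length) R
        (numCells I.length) P ∧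
      Ready I (bitsPerWord I.length) f q (tableSize I.length) R P τ ∧
      R ≤ 2 * (changes I (I.length - 1) + 1) ∧
      (∀ x < 2 ^ bitsPerWord I.length, τ.mem (8 * x + 4) = popCount x) ∧
      (∀ a, a % 8 ≠ 4 → a % 8 ≠ 5 → τ.mem a = 0) ∧ u ≤ 500 * (I.length + 1) := by
  set n := I.length with hn
  -- The ten spare bits of a word rule out every overflow: addresses stay below `128 * 2 ^ Nat.size
  -- n`, and packed words below `2 * 2 ^ Nat.size n`.
  have hpw : 1024 * 2 ^ Nat.size n ≤ 2 ^ w := by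
    calc 1024 * 2 ^ Nat.size n = 2 ^ (Nat.size n + 10) := by rw [pow_add]; ring
      _ ≤ _ := Nat.pow_le_pow_right (by norm_num) hw
  have hz := Nat.lt_size_self n
  have hz2 := two_pow_size_le n
  have hzn := size_le_self n
  have hN := numCells_le n
  have ht2 := two_pow_bitsPerWord_le n
  have htl := bitsPerWord_le n
  have hS : 8 * numCells n ≤ 2 ^ w := by omega
  refine Triple.seq ((triple_bitLength hI (by norm_num) (by norm_num) (by norm_num) hσ
    (by omega)).mono ?_)
  rintro u1 τ1 ⟨rfl, b1⟩
  refine Triple.seq (Triple.assign hI (by simp; omega) ?_)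
  refine Triple.seq (Triple.assign hI (by simp; omega) ?_)
  generalize hτ2 : State.setReg (State.setReg (State.setReg σ _ _) _ _) _ _ = τ2
  have r2n : τ2.reg rN = n := by rw [← hτ2]; simp [hσ]
  have r2w : τ2.reg rW = Nat.size n + 1 := by rw [← hτ2]; simp
  have r2t : τ2.reg rT = bitsPerWord n := by rw [← hτ2]; simp [bitsPerWord]
  have m2 : τ2.mem = σ.mem := by rw [← hτ2]; rfl
  refine Triple.seq ((triple_popTable hI le_rfl hS (by omega)
    (two_pow_le_numCells n) r2t (by rw [m2, hm])).mono ?_)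
  rintro u3 τ3 ⟨a3, m3, p3, b3⟩
  refine Triple.seq ((triple_countChanges hI (by omega)
    ((a3 _ (by norm_num)).trans r2n)).mono ?_)
  rintro u4 τ4 ⟨a4, m4, d4, b4⟩
  rw [← hn] at d4 b4
  have hD := changes_le_self I (n - 1)
  obtain ⟨D, hDe⟩ : ∃ D, D = changes I (n - 1) := ⟨_, rfl⟩
  rw [← hDe] at d4 hD
  have r4n : τ4.reg rN = n := by rw [a4 _ (by norm_num), a3 _ (by norm_num), r2n]
  have r4w : τ4.reg rW = Nat.size n + 1 := by rw [a4 _ (by norm_num), a3 _ (by norm_num), r2w]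
  have r4t : τ4.reg rT = bitsPerWord n := by rw [a4 _ (by norm_num), a3 _ (by norm_num), r2t]
  have hl := blockLength_le (n := n) (D := D)
  have hl' : n / (D + 1) ≤ n := Nat.div_le_self _ _
  have hsl := size_blockLength_le (n := n) (D := D)
  refine Triple.seq (Triple.assign hI (by simp [r4n, d4]; omega) ?_)
  have e5 : (var rN / (var rZ + lit 1) + lit 1).val I τ4 = blockLength n D := by
    simp [r4n, d4, blockLength]
  rw [e5]
  refine Triple.seq ((triple_bitLength hI (x := blockLength n D) (by norm_num) (by norm_num)
    (by norm_num) (by simp) (by omega)).mono ?_)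
  rintro u6 τ6 ⟨rfl, b6⟩
  have hf2 : 2 ^ Nat.size (blockLength n D) ≤ 2 * 2 ^ Nat.size n := by
    rw [← pow_succ']
    exact Nat.pow_le_pow_right (by norm_num) hsl
  refine Triple.seq (Triple.assign hI (by simp; omega) ?_)
  refine Triple.seq (Triple.assign hI (by simp) ?_)
  have hnW : n / (Nat.size n + 1) ≤ n := Nat.div_le_self _ _
  refine Triple.seq (Triple.assign hI (by simp [r4n, r4w]; omega) ?_)
  generalize hτ7 : State.setReg (State.setReg (State.setReg (State.setReg (State.setReg τ4 _ _)
    _ _) _ _) _ _) _ _ = τ7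
  have r7n : τ7.reg rN = n := by rw [← hτ7]; simp [r4n]
  have r7t : τ7.reg rT = bitsPerWord n := by rw [← hτ7]; simp [r4t]
  have r7f : τ7.reg rF = Nat.size (blockLength n D) := by rw [← hτ7]; simp
  have r7q : τ7.reg rQ = lensPerWord n D := by rw [← hτ7]; simp [r4w, lensPerWord]
  have r7e : τ7.reg rE = blockLength n D := by rw [← hτ7]; simp
  have r7m : τ7.reg rM = 2 ^ Nat.size (blockLength n D) := by rw [← hτ7]; simp
  have r7l : τ7.reg rL = tableSize n := by rw [← hτ7]; simp [r4w, r4n, tableSize]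
  have m7 : τ7.mem = τ3.mem := by rw [← hτ7, ← m4]; rfl
  have hqf := lensPerWord_mul_le (n := n) (D := D)
  have hqf2 : 2 ^ (lensPerWord n D * Nat.size (blockLength n D)) ≤ 2 * 2 ^ Nat.size n := by
    rw [← pow_succ']
    exact Nat.pow_le_pow_right (by norm_num) hqf
  have hDn : D ≤ n := by omega
  refine (triple_cutBlocks (N := numCells n) (f := Nat.size (blockLength n D))
    (q := lensPerWord n D) (l := blockLength n D) hI le_rfl hS (by omega) lensPerWord_pos
    blockLength_pos hl (Nat.lt_size_self _) (by omega) (by rw [← hDe]; exact lt_blockLength_mul)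
    (fun r hr => div_lensPerWord_lt hDn (by rwa [hDe])) r7n r7f r7q r7e
    (fun k => by rw [m7, m3 _ (by omega), m2, hm])).mono ?_
  rintro u8 τ8 ⟨a8, m8, b8, R, P, r8r, hR, hB⟩
  rw [← hn, ← hDe] at hR
  rw [← hn] at hB
  have hlast : P R = n := by simpa using hB.cur
  have hmono : Monotone P := monotone_nat_of_le_succ fun k => by
    rcases Nat.lt_or_ge k R with hk | hk
    · exact (hB.lt k hk).le
    · rw [hB.beyond k hk, hB.beyond (k + 1) (by omega)]
  refine ⟨Nat.size (blockLength n D), lensPerWord n D, R, P, ?_, ?_, by rw [← hDe]; exact hR,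
    fun x hx => by rw [m8 _ (by omega), m7, p3 x hx],
    fun a h4 h5 => by rw [m8 a h5, m7, m3 a h4, m2, hm], ?_⟩
  · exact
    { proper := hI
      cuts := ⟨hmono, hB.zero, hlast, hB.same⟩
      beyond := fun k hk => by rw [hB.beyond k hk, hlast]
      t_pos := bitsPerWord_pos n
      q_pos := lensPerWord_pos
      L_pos := Nat.succ_pos _
      space := le_rfl
      S_le := hS
      small := by omega
      L_le := tableSize_le
      R_lt := by omega
      two_pow_t := by omega
      shift_lt := by omega
      lt_succ := hB.lt
      len_lt := fun k hk => by
        have h1 := hB.len_le k hk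
        have h2 := Nat.lt_size_self (blockLength n D)
        omega
      rec_lt := div_lensPerWord_lt hDn hR
      tab_le := tableSize_le_numCells
      out_lt := div_bitsPerWord_lt le_rfl }
  · exact
    { reg_n := by rw [a8 _ (by norm_num), r7n]
      reg_t := by rw [a8 _ (by norm_num), r7t]
      reg_f := by rw [a8 _ (by norm_num), r7f]
      reg_q := by rw [a8 _ (by norm_num), r7q]
      reg_m := by rw [a8 _ (by norm_num), r7m]
      reg_r := r8r
      reg_l := by rw [a8 _ (by norm_num), r7l]
      lens := hB.lens }
  · simp
    omega

/-- The memory of the index of a string. -/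
structure IndexMem (I : List ℕ) (mem : ℕ → ℕ) : Prop where
  len : mem 7 = I.length
  bits : mem 15 = bitsPerWord I.length
  pop : ∀ x < 2 ^ bitsPerWord I.length, mem (8 * x + 4) = popCount x
  ones : ∃ m r, I.length ≤ m ∧ RankMem I (bitsPerWord I.length) 1 m r mem
  zeros : ∃ m r, I.length ≤ m ∧ RankMem I (bitsPerWord I.length) 0 m r mem

/-- Store the length of the input and the number of bits per word, and compute the length of the
index. -/
def finish : Prog := .block [
  .put (cell (lit 0) 7) (var rN), .put (cell (lit 1) 7) (var rT),
  .assign rN (lit 8 * ((lit 1 <<< var rT) + (lit 8 * var rN + lit 4) / var rT + lit 2))]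

/-- The construction program. -/
def build : Prog := .block [prepare, pass 1, pass 0, finish]

theorem triple_build {w : ℕ} {I : List ℕ} (hI : Proper w I) (hw : Nat.size I.length + 10 ≤ w)
    {σ : State} (hσ : σ.reg rN = I.length) (hm : ∀ a, σ.mem a = 0) {D : ℕ}
    (hD : changes I (I.length - 1) ≤ 2 * D) :
    Triple w (8 * numCells I.length) I build σ fun u τ => τ.reg rN = 8 * numCells I.length ∧
      IndexMem I τ.mem ∧ u ≤ 100000 * (I.length + D ^ 2 + 1) := by
  refine Triple.seq ((triple_prepare hI hw hσ hm).mono ?_)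
  rintro u1 τ1 ⟨f, q, R, P, d, h1, hR, hp1, m1, b1⟩
  refine Triple.seq ((triple_pass d (p := 1) le_rfl h1 (fun k => m1 _ (by omega) (by omega))
    fun k => m1 _ (by omega) (by omega)).mono ?_)
  rintro u2 τ2 ⟨a2, m2, ⟨j2, k2, l2, s2⟩, b2⟩
  have h2 := h1.frame a2 fun k => m2 _ (by omega) (by omega) (by omega)
  refine Triple.seq ((triple_pass d (p := 0) (by norm_num) h2
    (fun k => by rw [m2 _ (by omega) (by omega) (by omega), m1 _ (by omega) (by omega)])
    fun k => by rw [m2 _ (by omega) (by omega) (by omega), m1 _ (by omega) (by omega)]).mono ?_)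
  rintro u3 τ3 ⟨a3, m3, ⟨j3, k3, l3, s3⟩, b3⟩
  have h3 := h2.frame a3 fun k => m3 _ (by omega) (by omega) (by omega)
  have hsp := d.small
  have hS := d.S_le
  have htw := d.two_pow_t
  have hcells : 2 < numCells I.length :=
    (Nat.le_add_left 3 _).trans (div_add_le_numCells I.length)
  have hc0 := d.ok_cell (σ := τ3) (lit 0) 7 (by norm_num) (by simp) (by simp; omega)
  refine Triple.seq (Triple.put hI hc0.1 (by simp) hc0.2 ?_)
  generalize hτ4 : State.setMem _ _ _ = τ4
  have hc1 := d.ok_cell (σ := τ4) (lit 1) 7 (by norm_num) (by simp; omega) (by simp; omega)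
  refine Triple.seq (Triple.put hI hc1.1 (by simp) hc1.2 ?_)
  have r4 : ∀ r, τ4.reg r = τ3.reg r := fun r => by rw [← hτ4]; rfl
  have e : (8 * I.length + 4) / bitsPerWord I.length ≤ 8 * I.length + 4 := Nat.div_le_self _ _
  have hNe : 8 * (2 ^ bitsPerWord I.length + (8 * I.length + 4) / bitsPerWord I.length + 2) =
      8 * numCells I.length := rfl
  refine Triple.assign hI ?_ ⟨?_, ⟨?_, ?_, ?_, ?_, ?_⟩, ?_⟩
  · simp [r4, h3.reg_t, h3.reg_n]
    have hlt : 8 * numCells I.length < 2 ^ w := by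
      have h5 := numCells_le I.length
      have h6 : 2 ^ (Nat.size I.length + 10) ≤ 2 ^ w := Nat.pow_le_pow_right (by norm_num) hw
      have h7 : 0 < 2 ^ Nat.size I.length := by positivity
      rw [pow_add] at h6
      omega
    rw [← hNe] at hlt
    generalize (8 * I.length + 4) / bitsPerWord I.length = k at *
    omega
  · simp [r4, h3.reg_t, h3.reg_n, numCells]
  · simp [← hτ4, h3.reg_n]
  · simp [r4, h3.reg_t]
  · intro x hx
    simp only [State.setReg_mem, State.setMem_mem, val_cell, Expr.val_lit, ← hτ4]
    rw [if_neg (by omega), if_neg (by omega), m3 _ (by omega) (by omega) (by omega),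
      m2 _ (by omega) (by omega) (by omega), hp1 x hx]
  · refine ⟨j2, k2, l2, s2.frame (fun k => ?_) fun k => ?_⟩
    · simp only [State.setReg_mem, State.setMem_mem, val_cell, Expr.val_lit, ← hτ4]
      rw [if_neg (by omega), if_neg (by omega), m3 _ (by omega) (by omega) (by omega)]
    · simp only [State.setReg_mem, State.setMem_mem, val_cell, Expr.val_lit, ← hτ4]
      rw [if_neg (by omega), if_neg (by omega), m3 _ (by omega) (by omega) (by omega)]
  · refine ⟨j3, k3, l3, s3.frame (fun k => ?_) fun k => ?_⟩
    · simp only [State.setReg_mem, State.setMem_mem, val_cell, Expr.val_lit, ← hτ4]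
      rw [if_neg (by omega), if_neg (by omega)]
    · simp only [State.setReg_mem, State.setMem_mem, val_cell, Expr.val_lit, ← hτ4]
      rw [if_neg (by omega), if_neg (by omega)]
  · have hz2 := two_pow_size_le I.length
    have hsq := sq_le_two_pow_succ (Nat.size I.length + 1)
    rw [pow_succ 2, pow_succ 2] at hsq
    have hdiv := div_tableSize_le I.length
    have hmul := Nat.div_mul_le_self I.length (tableSize I.length)
    have hL := tableSize_le (n := I.length)
    -- `D` bounds the number of runs here: there are at most `2 D` changes and at most twice
    -- (changes + 1) blocks.
    have hRD : R + 2 ≤ 4 * (D + 1) := by omega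
    have hDD : (D + 1) ^ 2 ≤ 2 * (D ^ 2 + 1) := by
      zify
      nlinarith [sq_nonneg ((D : ℤ) - 1)]
    have k4 : (R + 1) ^ 2 ≤ 32 * (D ^ 2 + 1) := by
      have : (R + 1) ^ 2 ≤ (4 * (D + 1)) ^ 2 := Nat.pow_le_pow_left (by omega) 2
      rw [mul_pow] at this
      omega
    -- The mixed term `R log n` is split by the inequality `4 x y ≤ x² + 4 y²`; the square of the
    -- logarithm is then absorbed by `n`.
    have k5 : (I.length / tableSize I.length + 1) * (R + 2) ≤
        (Nat.size I.length + 1) ^ 2 + 32 * (D ^ 2 + 1) := by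
      have h5 : (I.length / tableSize I.length + 1) * (R + 2) ≤
          (Nat.size I.length + 1) * (4 * (D + 1)) :=
        Nat.mul_le_mul (by omega) hRD
      have h6 : ∀ a b : ℕ, a * (4 * b) ≤ a ^ 2 + 4 * b ^ 2 := fun a b => by
        zify
        nlinarith [sq_nonneg ((a : ℤ) - 2 * b)]
      have := h6 (Nat.size I.length + 1) (D + 1)
      omega
    have k6 : (I.length / tableSize I.length + 1) * (tableSize I.length + R + 2) ≤
        2 * I.length + 1 + ((Nat.size I.length + 1) ^ 2 + 32 * (D ^ 2 + 1)) := by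
      rw [add_assoc, mul_add, add_mul, one_mul]
      omega
    simp
    omega

end WordRAM

/-! ### The query program -/

namespace WordRAM

/-- The rank of the position `R[4]` in the rank structure for the characters `p` of an index with
`R[3]` bits per word. -/
def rankExpr (p : ℕ) : Expr :=
  read (cell (var 4 / var 3) (2 * p)) +
    read (cell (read (cell (var 4 / var 3) (2 * p + 1)) % (lit 1 <<< (var 4 % var 3))) 4)

/-- The query program. -/
def query : Prog := .block [
  .assign 2 (read (cell (lit 0) 7)), .assign 3 (read (cell (lit 1) 7)),
  .cond (.lt (var 2) (var 0)) (.assign 0 (lit 0))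
    (.cond (.lt (var 2) (var 1)) (.assign 0 (lit 0)) (.block [
      .assign 4 (var 0 + var 1),
      .cond (.eq (var 4) (lit 0)) (.assign 0 (lit 0))
        (.cond (.lt (var 2) (var 4)) (.assign 0 (lit 0))
          (.cond (.lt (rankExpr 1) (var 1)) (.assign 0 (lit 0))
            (.cond (.lt (rankExpr 0) (var 0)) (.assign 0 (lit 0)) (.assign 0 (lit 1)))))]))]

variable {w : ℕ} {I ix : List ℕ} {mem : ℕ → ℕ}

theorem rankExpr_spec (hlen : ix.length = 8 * numCells I.length)
    (hix : ∀ a < 8 * numCells I.length, chr ix a = mem a)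
    (hw : 128 * 2 ^ Nat.size I.length < 2 ^ w) (hmem : IndexMem I mem) {p m : ℕ} (hp : p ≤ 1)
    (hm : m ≤ I.length)
    (hr : ∃ m r, I.length ≤ m ∧ RankMem I (bitsPerWord I.length) p m r mem) {σ : State}
    (h3 : σ.reg 3 = bitsPerWord I.length) (h4 : σ.reg 4 = m) :
    (rankExpr p).Ok w 0 ix σ ∧ RankSpec I p m ((rankExpr p).val ix σ) := by
  obtain ⟨m', r', hm', hr'⟩ := hr
  have hspec := hr'.spec m (hm.trans hm')
  have hz := Nat.lt_size_self I.length
  have hN := numCells_le I.length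
  have ht2 := two_pow_bitsPerWord_le I.length
  have htN := two_pow_le_numCells I.length
  have hmod := Nat.mod_lt m (bitsPerWord_pos I.length)
  have hpow : 2 ^ (m % bitsPerWord I.length) ≤ 2 ^ bitsPerWord I.length :=
    Nat.pow_le_pow_right (by norm_num) hmod.le
  have hdiv := div_bitsPerWord_lt (n := I.length) (x := m) (by omega)
  have hlt : mem (8 * (m / bitsPerWord I.length) + (2 * p + 1)) % 2 ^ (m % bitsPerWord I.length) <
      2 ^ bitsPerWord I.length := (Nat.mod_lt _ (by positivity)).trans_le hpow
  have e1 : (read (cell (var 4 / var 3) (2 * p))).val ix σ =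
      mem (8 * (m / bitsPerWord I.length) + 2 * p) := by
    simp only [val_read_eq_chr, val_cell, Expr.val_div, Expr.val_var, h3, h4]
    exact hix _ (by omega)
  have e2 : (read (cell (var 4 / var 3) (2 * p + 1))).val ix σ =
      mem (8 * (m / bitsPerWord I.length) + (2 * p + 1)) := by
    simp only [val_read_eq_chr, val_cell, Expr.val_div, Expr.val_var, h3, h4]
    exact hix _ (by omega)
  have e3 : (read (cell (var 4 / var 3) (2 * p + 1)) % (lit 1 <<< (var 4 % var 3))).val ix σ =
      mem (8 * (m / bitsPerWord I.length) + (2 * p + 1)) % 2 ^ (m % bitsPerWord I.length) := by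
    rw [Expr.val_mod, e2]
    simp [h3, h4]
  have e4 : (read (cell (read (cell (var 4 / var 3) (2 * p + 1)) %
      (lit 1 <<< (var 4 % var 3))) 4)).val ix σ =
      popCount (mem (8 * (m / bitsPerWord I.length) + (2 * p + 1)) %
        2 ^ (m % bitsPerWord I.length)) := by
    rw [val_read_eq_chr, val_cell, e3, hix _ (by omega), hmem.pop _ hlt]
  have e5 : (rankExpr p).val ix σ = rank (bitsPerWord I.length) (fun k => mem (8 * k + 2 * p))
      (fun k => mem (8 * k + (2 * p + 1))) m := by
    rw [rankExpr, Expr.val_add, e1, e4]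
    rfl
  rw [← e5] at hspec
  refine ⟨⟨⟨ok_cell _ _ _ _ _ _ (by omega) (by simp) (by omega) ?_, ?_⟩,
    ⟨ok_cell _ _ _ _ _ _ (by omega) ?_ (by omega) ?_, ?_⟩, ?_⟩, hspec⟩
  · simp only [Expr.val_div, Expr.val_var, h3, h4]
    omega
  · simp only [val_cell, Expr.val_div, Expr.val_var, h3, h4]
    omega
  · rw [Expr.ok_mod, Expr.ok_read, Expr.ok_shl]
    refine ⟨⟨ok_cell _ _ _ _ _ _ (by omega) (by simp) (by omega) ?_, ?_⟩, ?_, by simp, ?_⟩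
    · simp only [Expr.val_div, Expr.val_var, h3, h4]
      omega
    · simp only [val_cell, Expr.val_div, Expr.val_var, h3, h4]
      omega
    · rw [Expr.ok_lit]
      omega
    · simp only [Expr.val_lit, Expr.val_mod, Expr.val_var, h3, h4]
      omega
  · rw [e3]
    omega
  · rw [val_cell, e3]
    omega
  · have := hspec.1
    exact (show (rankExpr p).val ix σ < 2 ^ w by omega)

theorem triple_query (hI : Proper w ix) (hlen : ix.length = 8 * numCells I.length)
    (hix : ∀ a < 8 * numCells I.length, chr ix a = mem a)
    (hw : 128 * 2 ^ Nat.size I.length < 2 ^ w) (hmem : IndexMem I mem) {a b : ℕ} {σ : State}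
    (ha : σ.reg 0 = a) (hb : σ.reg 1 = b) :
    Triple w 0 ix query σ fun u τ => u ≤ 200 ∧
      (a + b ≠ 0 ∧ a + b ≤ I.length ∧ b ≤ maxOcc I 1 a ∧ a ≤ maxOcc I 0 b → τ.reg 0 = 1) ∧
      (¬(a + b ≠ 0 ∧ a + b ≤ I.length ∧ b ≤ maxOcc I 1 a ∧ a ≤ maxOcc I 0 b) → τ.reg 0 = 0) := by
  have hz := Nat.lt_size_self I.length
  have hN := numCells_le I.length
  have hN3 : 3 ≤ numCells I.length :=
    (Nat.le_add_left 3 _).trans (div_add_le_numCells I.length)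
  have h1w : 0 < w := hI.1
  refine Triple.seq (Triple.assign hI ⟨ok_cell _ _ _ _ _ _ (by norm_num) (by simp) (by omega)
    (by simp; omega), by simp; omega⟩ ?_)
  have e1 : (read (cell (lit 0) 7)).val ix σ = I.length := by
    rw [val_read_eq_chr, val_cell, ← hmem.len]
    exact hix _ (by simp; omega)
  rw [e1]
  refine Triple.seq (Triple.assign hI ⟨ok_cell _ _ _ _ _ _ (by norm_num) (by simp; omega) (by omega)
    (by simp; omega), by simp; omega⟩ ?_)
  have e2 : (read (cell (lit 1) 7)).val ix (σ.setReg 2 I.length) = bitsPerWord I.length := by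
    rw [val_read_eq_chr, val_cell, ← hmem.bits]
    exact hix _ (by simp; omega)
  rw [e2]
  have fail : ∀ (τ : State) (Q : ℕ → State → Prop), (∀ τ' : State, τ'.reg 0 = 0 → Q 2 τ') →
      Triple w 0 ix (.assign 0 (lit 0)) τ Q := fun τ Q h =>
    Triple.assign hI (by simp) (h _ (by simp))
  refine Triple.cond hI (by simp) (fun hv => fail _ _ fun τ hτ => ?_) fun hv => ?_
  · simp [ha] at hv
    exact ⟨by simp, fun h => absurd h.2.1 (by omega), fun _ => hτ⟩
  simp [ha] at hv
  refine Triple.cond hI (by simp) (fun hv' => fail _ _ fun τ hτ => ?_) fun hv' => ?_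
  · simp [hb] at hv'
    exact ⟨by simp, fun h => absurd h.2.1 (by omega), fun _ => hτ⟩
  simp [hb] at hv'
  -- `a` and `b` may be any words; the sum is formed only after both have been found to be at most
  -- the length, so it does not overflow.
  refine Triple.seq (Triple.assign hI (by simp [ha, hb]; omega) ?_)
  have e3 : (var 0 + var 1).val ix ((σ.setReg 2 I.length).setReg 3 (bitsPerWord I.length)) =
      a + b := by simp [ha, hb]
  rw [e3]
  generalize hτ : State.setReg (State.setReg (State.setReg σ _ _) _ _) _ _ = τ
  have t0 : τ.reg 0 = a := by rw [← hτ]; simp [ha]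
  have t1 : τ.reg 1 = b := by rw [← hτ]; simp [hb]
  have t2 : τ.reg 2 = I.length := by rw [← hτ]; simp
  have t3 : τ.reg 3 = bitsPerWord I.length := by rw [← hτ]; simp
  have t4 : τ.reg 4 = a + b := by rw [← hτ]; simp
  refine Triple.cond hI (by simp) (fun hs => fail _ _ fun τ hτ => ?_) fun hs => ?_
  · simp [t4] at hs
    exact ⟨by simp, fun h => absurd h.1 (by omega), fun _ => hτ⟩
  simp [t4] at hs
  refine Triple.cond hI (by simp) (fun hl => fail _ _ fun τ hτ => ?_) fun hl => ?_
  · simp [t4, t2] at hl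
    exact ⟨by simp, fun h => absurd h.2.1 (by omega), fun _ => hτ⟩
  simp [t4, t2] at hl
  obtain ⟨k1, s1⟩ := rankExpr_spec hlen hix hw hmem (p := 1) le_rfl hl hmem.ones t3 t4
  obtain ⟨k0, s0⟩ := rankExpr_spec hlen hix hw hmem (p := 0) (by norm_num) hl hmem.zeros t3 t4
  have q1 := s1.le_iff
  -- The same position `a + b` serves both rank structures; for the zeros the roles of `a` and `b`
  -- are exchanged.
  rw [add_comm a b] at s0
  have q0 := s0.le_iff
  refine Triple.cond hI ⟨k1, by simp, trivial⟩ (fun hr => fail _ _ fun τ hτ => ?_) fun hr => ?_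
  · rw [Expr.val_lt, Expr.val_var, t1] at hr
    simp at hr
    exact ⟨by simp [rankExpr], fun h => absurd (q1.mpr h.2.2.1) (by omega), fun _ => hτ⟩
  rw [Expr.val_lt, Expr.val_var, t1] at hr
  simp at hr
  refine Triple.cond hI ⟨k0, by simp, trivial⟩ (fun hr' => fail _ _ fun τ hτ => ?_) fun hr' => ?_
  · rw [Expr.val_lt, Expr.val_var, t0] at hr'
    simp at hr'
    exact ⟨by simp [rankExpr], fun h => absurd (q0.mpr h.2.2.2) (by omega), fun _ => hτ⟩
  rw [Expr.val_lt, Expr.val_var, t0] at hr'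
  simp at hr'
  exact Triple.assign hI (by simp; omega) ⟨by simp [rankExpr], by simp,
    fun h => absurd ⟨by omega, hl, q1.mp hr, q0.mp hr'⟩ h⟩

end WordRAM

/-! ### Space bound and final assembly -/

/-- Memory and registers have linearly many bits. -/
theorem space_le {n w K : ℕ} (g : ℕ) (h : w ≤ K * (Nat.size n + 10)) :
    (8 * numCells n + g) * w ≤ (K * (1440 + 10 * g) + 100000) * (n + 1) := by
  have h1 := numCells_mul_le n
  have h2 := size_le_self n
  have h3 : g * (Nat.size n + 10) ≤ g * (10 * (n + 1)) := Nat.mul_le_mul_left _ (by omega)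
  have h4 : (8 * numCells n + g) * (Nat.size n + 10) ≤ (1440 + 10 * g) * (n + 1) := by
    calc _ = 8 * (numCells n * (Nat.size n + 10)) + g * (Nat.size n + 10) := by ring
      _ ≤ 8 * (180 * (n + 1)) + g * (10 * (n + 1)) := by omega
      _ = _ := by ring
  calc _ ≤ (8 * numCells n + g) * (K * (Nat.size n + 10)) := Nat.mul_le_mul_left _ h
    _ = K * ((8 * numCells n + g) * (Nat.size n + 10)) := by ring
    _ ≤ K * ((1440 + 10 * g) * (n + 1)) := Nat.mul_le_mul_left _ h4
    _ = K * (1440 + 10 * g) * (n + 1) := by ring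
    _ ≤ _ := Nat.mul_le_mul_right _ (Nat.le_add_right _ _)

theorem theorem4 :
    ∃ (build query : WordRAM.Prog) (c : ℕ), ∀ K : ℕ, ∃ C : ℕ, ∀ (s : List Bool) (w : ℕ),
      Nat.size s.length + c ≤ w → w ≤ K * (Nat.size s.length + c) →
        ∃ ix : List ℕ,
          BuildsIndex build w s (C * (s.length + 1))
            (C * (s.length + numOneRuns s ^ 2 + 1)) ix ∧
          ix.length * w ≤ C * (s.length + 1) ∧
          AnswersQueries query w s C ix := by
  -- The summand with `K` pays for space: `1440 = 8 * 180` for the eight arrays and `10` per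
  -- register. The summand `100000` pays for the running times of both programs.
  refine ⟨WordRAM.build, WordRAM.query, 10,
    fun K => ⟨K * (1440 + 10 * WordRAM.build.numRegs) + 100000, fun s w h1 h2 => ?_⟩⟩
  have hlen : (inputOf s).length = s.length := List.length_map _
  have hz := Nat.lt_size_self s.length
  have hpw : 1024 * 2 ^ Nat.size s.length ≤ 2 ^ w := by
    calc 1024 * 2 ^ Nat.size s.length = 2 ^ (Nat.size s.length + 10) := by rw [pow_add]; ring
      _ ≤ _ := Nat.pow_le_pow_right (by norm_num) h1
  have hpos : 0 < 2 ^ w := by positivity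
  have hI : WordRAM.Proper w (inputOf s) := ⟨by omega, fun x => by
    have := chr_inputOf_eq s x
    unfold chr at this
    omega⟩
  obtain ⟨u, υ, τ, hex, hbd, hag, hτ0, hτm, hu⟩ := WordRAM.triple_build hI (by rwa [hlen])
    (σ := WordRAM.State.init [s.length]) (by simp [WordRAM.State.init]) (fun _ => rfl)
    (changes_le s _) (WordRAM.State.init [s.length])
    ⟨fun r => by rcases r with _ | r <;> simp [WordRAM.State.init] <;> omega, fun _ => hpos⟩
    ⟨fun _ _ => rfl, rfl⟩
  rw [hlen] at hex hτ0 hu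
  have hυ0 : υ.reg 0 = 8 * numCells s.length := by rw [hag.1 0 (by norm_num), hτ0]
  rw [← hag.2] at hτm
  have hspace := space_le WordRAM.build.numRegs h2
  have hlen' : υ.output.length = 8 * numCells s.length := by
    simp [WordRAM.State.output, hυ0]
  have hchr : ∀ a < 8 * numCells s.length, chr υ.output a = υ.mem a := fun a ha => by
    simp [chr, WordRAM.State.output, hυ0, ha]
  -- The triples keep all memory cells below `2 ^ w`, so the index left by the construction is a
  -- legitimate input of words for the query machine.
  have hIx : WordRAM.Proper w υ.output := ⟨hI.1, fun x => by
    by_cases hx : x < 8 * numCells s.length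
    · rw [show υ.output.getD x 0 = chr υ.output x from rfl, hchr x hx]
      exact hbd.2 x
    · rw [List.getD_eq_default _ _ (by omega)]
      exact hpos⟩
  refine ⟨υ.output, ⟨8 * numCells s.length, u, υ, hex, ?_, hspace, hυ0.le, rfl⟩, ?_, ?_⟩
  · exact hu.trans (Nat.mul_le_mul_right _ (Nat.le_add_left _ _))
  · rw [hlen']
    exact (Nat.mul_le_mul_right _ (Nat.le_add_right _ _)).trans hspace
  · intro a b ha hb
    obtain ⟨t, ρ, π, q1, -, q3, q4, q5, q6⟩ := WordRAM.triple_query hIx (I := inputOf s)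
      (by rw [hlen, hlen']) (by rwa [hlen]) (by rw [hlen]; have := hz; omega) hτm
      (σ := WordRAM.State.init [a, b]) (a := a) (b := b) (by simp [WordRAM.State.init])
      (by simp [WordRAM.State.init])
      (WordRAM.State.init [a, b]) ⟨fun r => by
        rcases r with _ | _ | r <;> simp [WordRAM.State.init] <;> omega, fun _ => hpos⟩
      ⟨fun _ _ => rfl, rfl⟩
    rw [hlen, ← jumbledOccurs_iff, ← q3.1 0 (by norm_num)] at q5 q6
    exact ⟨t, ρ, q1, by omega, q5, q6⟩
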